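/- Let $\varphi,\sigma:\mathbb R\to\mathbb R$ be Lipschitz functions and $\gamma>0$, all independent of $n$. For each $n\ge 1$ let $p=p(n)$, $T=T(n)$ be integers and $X=X_n\in\mathbb R^{p\times T}$ be deterministic, with $$0<\liminf_n \min\{p/n,T/n\}\le\limsup_n\max\{p/n,T/n\}<\infty,\qquad \limsup_n\|X\|<\infty,$$ where $\|\cdot\|$ is the operator norm. Let $\tilde W\in\mathbb R^{n\times p}$ have i.i.d. $\mathcal N(0,1)$ entries and put (functions acting entrywise) $W=\varphi(\tilde W)$, $\Sigma=\sigma(WX)\in\mathbb R^{n\times T}$ and $$Q=\Big(\tfrac1T\Sigma^{\mathsf T}\Sigma+\gamma I_T\Big)^{-1}.$$ Let $\Phi=\mathbb E[\sigma(w^{\mathsf T}X)^{\mathsf T}\sigma(w^{\mathsf T}X)]\in\mathbb R^{T\times T}$, where $w=\varphi(\tilde w)$ with $\tilde w\sim\mathcal N(0,I_p)$. Let $\delta$ be the unique nonnegative solution of $$\delta=\tfrac1T\operatorname{tr}(\Phi\bar Q),\qquad \bar Q=\Big(\tfrac nT\tfrac{\Phi}{1+\delta}+\gamma I_T\Big)^{-1}$$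 (it exists, and is positive unless $\Phi=0$), and let $\Psi=\frac nT\frac{\Phi}{1+\delta}$. Let $A=A_n\in\mathbb R^{T\times T}$ be symmetric nonnegative definite, where either $A=\Phi$ for all $n$, or $\sup_n\|A\|<\infty$. Then $1-\frac1n\operatorname{tr}(\Psi^2\bar Q^2)>0$ for all $n\ge1$, and for every $\varepsilon>0$ there is $c>0$ such that, for all $n\ge1$, $$\left\|\mathbb E[QAQ]-\left(\bar QA\bar Q+\frac{\frac1n\operatorname{tr}(\Psi\bar QA\bar Q)}{1-\frac1n\operatorname{tr}(\Psi^2\bar Q^2)}\,\bar Q\Psi\bar Q\right)\right\|\le c\,n^{-\frac12+\varepsilon}.$$ -/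

import Mathlib

open MeasureTheory ProbabilityTheory Filter
open scoped ENNReal NNReal Matrix

-- matrix norms are operator norms with respect to the Euclidean norms
open scoped Matrix.Norms.L2Operator

noncomputable section

namespace RandomFeatures

/-- The standard Gaussian law `N(0, I_p)` of a vector with i.i.d. `N(0,1)` entries. -/
def gaussianVec (p : ℕ) : Measure (Fin p → ℝ) :=
  Measure.pi fun _ => gaussianReal 0 1

/-- The law of an `n × p` array `W̃` with i.i.d. `N(0,1)` entries (`W̃ i k` is the entry in row
`i` and column `k`). -/
def gaussianMat (n p : ℕ) : Measure (Fin n → Fin p → ℝ) :=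
  Measure.pi fun _ => gaussianVec p

/-- `Σ = σ(W X)` with `W = φ(W̃)`, where `σ` and `φ` act entrywise. -/
def featureMatrix (σ φ : ℝ → ℝ) {n p T : ℕ} (X : Matrix (Fin p) (Fin T) ℝ)
    (Wt : Fin n → Fin p → ℝ) : Matrix (Fin n) (Fin T) ℝ :=
  ((Matrix.of Wt).map φ * X).map σ

/-- The resolvent `Q = ((1/T) Σᵀ Σ + γ I_T)⁻¹`, with `Σ = σ(φ(W̃) X)`. -/
def resolvent (σ φ : ℝ → ℝ) (γ : ℝ) {n p T : ℕ} (X : Matrix (Fin p) (Fin T) ℝ)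
    (Wt : Fin n → Fin p → ℝ) : Matrix (Fin T) (Fin T) ℝ :=
  ((1 / (T : ℝ)) • ((featureMatrix σ φ X Wt)ᵀ * featureMatrix σ φ X Wt)
    + γ • (1 : Matrix (Fin T) (Fin T) ℝ))⁻¹

/-- `Φ = E[σ(wᵀ X)ᵀ σ(wᵀ X)]`, with `w = φ(w̃)`, `w̃ ∼ N(0, I_p)`. -/
def Phi (σ φ : ℝ → ℝ) {p T : ℕ} (X : Matrix (Fin p) (Fin T) ℝ) :
    Matrix (Fin T) (Fin T) ℝ :=
  Matrix.of fun i j =>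
    ∫ w, σ (((fun k => φ (w k)) ᵥ* X) i) * σ (((fun k => φ (w k)) ᵥ* X) j) ∂(gaussianVec p)

/-- `E[Q A Q]`, the entrywise expectation. -/
def expectQAQ (σ φ : ℝ → ℝ) (γ : ℝ) (n : ℕ) {p T : ℕ} (X : Matrix (Fin p) (Fin T) ℝ)
    (A : Matrix (Fin T) (Fin T) ℝ) : Matrix (Fin T) (Fin T) ℝ :=
  Matrix.of fun i j =>
    ∫ Wt, (resolvent σ φ γ X Wt * A * resolvent σ φ γ X Wt) i j ∂(gaussianMat n p)

/-- `Ψ = (n/T) Φ / (1 + δ)`. -/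
def Psi (n : ℕ) {T : ℕ} (Φ : Matrix (Fin T) (Fin T) ℝ) (δ : ℝ) :
    Matrix (Fin T) (Fin T) ℝ :=
  ((n : ℝ) / (T : ℝ) / (1 + δ)) • Φ

/-- `Q̄ = ((n/T) Φ / (1 + δ) + γ I_T)⁻¹`. -/
def Qbar (n : ℕ) (γ : ℝ) {T : ℕ} (Φ : Matrix (Fin T) (Fin T) ℝ) (δ : ℝ) :
    Matrix (Fin T) (Fin T) ℝ :=
  (Psi n Φ δ + γ • (1 : Matrix (Fin T) (Fin T) ℝ))⁻¹

/-- `δ` is a nonnegative solution of `δ = (1/T) tr (Φ Q̄)`, where `Q̄` depends on `δ`. For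
`Φ ≠ 0` positive semidefinite such a solution is automatically positive; for `Φ = 0` it is `0`. -/
def IsDelta (n : ℕ) (γ : ℝ) {T : ℕ} (Φ : Matrix (Fin T) (Fin T) ℝ) (δ : ℝ) : Prop :=
  0 ≤ δ ∧ δ = 1 / (T : ℝ) * (Φ * Qbar n γ Φ δ).trace

/-- The deterministic equivalent
`Q̄ A Q̄ + [(1/n) tr(Ψ Q̄ A Q̄) / (1 - (1/n) tr(Ψ² Q̄²))] Q̄ Ψ Q̄`. -/
def equivQAQ (n : ℕ) (γ : ℝ) {T : ℕ} (Φ : Matrix (Fin T) (Fin T) ℝ) (δ : ℝ)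
    (A : Matrix (Fin T) (Fin T) ℝ) : Matrix (Fin T) (Fin T) ℝ :=
  let Ψ := Psi n Φ δ
  let R := Qbar n γ Φ δ
  R * A * R +
    ((1 / (n : ℝ) * (Ψ * R * A * R).trace) / (1 - 1 / (n : ℝ) * (Ψ ^ 2 * R ^ 2).trace)) •
      (R * Ψ * R)

end RandomFeatures

end

/-!
The rows of `Σ / √T` are independent vectors `y` in `ℝ^T`, each a Lipschitz function of a standard
Gaussian vector with Lipschitz constant `O(n ^ (-1/2))`, and `Q` is the resolvent of `∑ yᵢ yᵢᵀ`.
Write `F = E[y yᵀ] = Φ / T` and `m = E[y]`, and let `Q₋` be the resolvent without the row `y`.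

**Concentration.** Lipschitz functions of a Gaussian vector have dimension-free moments
(`lintegral_lipschitz_sub_integral_le`, by the rotation argument of Maurey and Pisier). Hence, given
the other rows, `y ⬝ h` and `y ⬝ B y` fluctuate by `O(n ^ (-1/2))` for bounded `h` and `B`. These
facts are collected in the structure `RowModel`, whose constants are uniform over a family, and the
argument uses nothing else about the rows. The traces `tr (F Q)` and `tr (F Q A Q)` fluctuate by
`O(n ^ (-1/2))` by the Efron–Stein inequality, since leaving out a row changes them by `O(1 / n)`.

**The mean direction.** The rows are not centred: `F = m mᵀ + O(1 / n)`, so that `n F`, and with it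
`Φ`, may be of order `n` in the direction `m`. The matrices `A` are therefore taken in the class
`0 ≤ A ≤ K (1 + n m mᵀ)` (`SpikeBdd`), which contains both the bounded matrices and `Φ`. As
`∑ yᵢ yᵢᵀ ≥ n ȳ ȳᵀ` for the empirical mean `ȳ`, and `n |ȳ - m|²` has bounded moments, the form of `Q`
at `m` is `O(1 / n)`; so `Q A Q` is bounded, up to a random factor with bounded moments
(`SpikeBdd.bounds`).

**Expansion.** By the resolvent identity,
`Q - Q̄ = Q̄ (Ψ - ∑ yᵢ yᵢᵀ) Q`. By exchangeability the mean of the sum is `n` times that of one term,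
and by the Sherman–Morrison formula `yᵀ Q = yᵀ Q₋ / (1 + y ⬝ Q₋ y)`. If `y ⬝ Q₋ y = d + O(n ^ (-1/2))`
and `Ψ = n F / (1 + d)`, then everything but a remainder of order `n ^ (-1/2)` cancels
(`RowModel.first_order`). This holds for `d = E tr (F Q₋)`, which therefore solves the equation
`d = tr (F Q̄)` up to `O(n ^ (-1/2))`. That equation is stable, because `tr (F Q̄) / (1 + d)` is
nonincreasing in `d` (`fixedPoint_stable`), so that `d` may be replaced by its solution `δ`
(`RowModel.lpBdd_Q_quad_sub_delta`).

**The second-order term.** The same expansion for `Q A Q` yields the further term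
`β / (1 + δ) · Q̄ Ψ Q̄`, with `β = E tr (F Q₋ A Q₋)` (`RowModel.second_order`). The trace of the whole
expansion against `F` is again `β` up to `O(n ^ (-1/2))`, and this linear equation determines `β`: its
coefficient is the denominator `1 - tr (Ψ² Q̄²) / n`, which is at least `1 / (1 + δ)`
(`trace_sandwich_le`), and its solution is the coefficient in the theorem
(`RowModel.sandwich_equivalent`). The rate so obtained is `n ^ (-1/2)`, without a loss of `n ^ ε`.
-/

namespace RandomFeatures

/-! ### Concentration of Lipschitz functions of a Gaussian vector -/

theorem pi_absolutelyContinuous_fin {μ ν : Measure ℝ} [SigmaFinite μ] [SigmaFinite ν]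
    (h : μ ≪ ν) (n : ℕ) :
    (Measure.pi fun _ : Fin n => μ) ≪ (Measure.pi fun _ : Fin n => ν) := by
  induction n with
  | zero =>
    rw [Measure.pi_of_empty (fun _ : Fin 0 => μ), Measure.pi_of_empty (fun _ : Fin 0 => ν)]
  | succ n ih =>
    have h1 := (measurePreserving_piFinSuccAbove (fun _ : Fin (n + 1) => μ) 0).symm
    have h2 := (measurePreserving_piFinSuccAbove (fun _ : Fin (n + 1) => ν) 0).symm
    rw [← h1.map_eq, ← h2.map_eq]
    exact (Measure.AbsolutelyContinuous.prod h ih).map (MeasurableEquiv.measurable _)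

section Gaussian

variable {E : Type*} [NormedAddCommGroup E] [InnerProductSpace ℝ E] [FiniteDimensional ℝ E]
  [MeasurableSpace E] [BorelSpace E]

theorem stdGaussian_absolutelyContinuous : stdGaussian E ≪ (volume : Measure E) := by
  have h1 := pi_absolutelyContinuous_fin (gaussianReal_absolutelyContinuous 0 one_ne_zero)
    (Module.finrank ℝ E)
  have h2 : MeasurePreserving (fun x : Fin (Module.finrank ℝ E) → ℝ =>
      ∑ i, x i • stdOrthonormalBasis ℝ E i) volume volume := by
    have h3 := (stdOrthonormalBasis ℝ E).measurePreserving_repr_symm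
    have h4 := (EuclideanSpace.volume_preserving_symm_measurableEquiv_toLp
      (Fin (Module.finrank ℝ E))).symm
    have h5 := h3.comp h4
    have h6 : (fun x : Fin (Module.finrank ℝ E) → ℝ => ∑ i, x i • stdOrthonormalBasis ℝ E i) =
        (stdOrthonormalBasis ℝ E).repr.symm ∘
          (MeasurableEquiv.toLp 2 (Fin (Module.finrank ℝ E) → ℝ)).symm.symm := by
      funext x
      exact (OrthonormalBasis.sum_repr_symm (stdOrthonormalBasis ℝ E) (WithLp.toLp 2 x))
    rw [h6]
    exact h5
  rw [← h2.map_eq, stdGaussian]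
  exact h1.map h2.measurable

/-- The absolute moments of the standard normal law. -/
noncomputable def gaussMoment (k : ℕ) : ℝ≥0∞ := ∫⁻ t, ‖t‖ₑ ^ k ∂(gaussianReal 0 1)

theorem gaussMoment_lt_top (k : ℕ) : gaussMoment k < ∞ := by
  rcases Nat.eq_zero_or_pos k with rfl | hk
  · simp [gaussMoment]
  have h := (memLp_id_gaussianReal (μ := 0) (v := 1) (k : ℝ≥0)).2
  have h' := (lintegral_rpow_enorm_lt_top_of_eLpNorm_lt_top (p := (k : ℝ≥0∞))
    (by exact_mod_cast hk.ne') (by simp) (by simpa using h))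
  simpa [gaussMoment] using h'

/-- A linear functional of a standard Gaussian vector is a centred normal variable whose standard
deviation is the norm of the functional. -/
theorem lintegral_dual_stdGaussian (L : StrongDual ℝ E) (k : ℕ) :
    ∫⁻ x, ‖L x‖ₑ ^ k ∂(stdGaussian E) = ‖L‖ₑ ^ k * gaussMoment k := by
  have h1 := IsGaussian.map_eq_gaussianReal (μ := stdGaussian E) L
  rw [integral_strongDual_stdGaussian, variance_dual_stdGaussian] at h1
  have h2 : (gaussianReal 0 1).map (fun x => ‖L‖ * x) = gaussianReal 0 (‖L‖ ^ 2).toNNReal := by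
    rw [gaussianReal_map_const_mul]
    congr 1
    · simp
    · ext; simp
  have h3 : ∫⁻ x, ‖L x‖ₑ ^ k ∂(stdGaussian E) = ∫⁻ t, ‖t‖ₑ ^ k ∂((stdGaussian E).map L) := by
    rw [lintegral_map (by fun_prop) (by fun_prop)]
  rw [h3, h1, ← h2, lintegral_map (by fun_prop) (by fun_prop), gaussMoment,
    ← lintegral_const_mul _ (by fun_prop)]
  refine lintegral_congr fun t => ?_
  rw [enorm_mul, mul_pow, enorm_norm]

/-- Jensen's inequality for powers on a quarter of a circle. -/
theorem lintegral_pow_le_quarter (g : ℝ → ℝ) (hg : Measurable g) (k : ℕ) (hk : 1 ≤ k) :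
    (∫⁻ θ in Set.Ioc 0 (Real.pi / 2), ‖g θ‖ₑ) ^ k ≤
      ENNReal.ofReal (Real.pi / 2) ^ (k - 1) *
        ∫⁻ θ in Set.Ioc 0 (Real.pi / 2), ‖g θ‖ₑ ^ k := by
  have hk0 : (k : ℝ) ≠ 0 := by positivity
  have h := eLpNorm'_le_eLpNorm'_mul_rpow_measure_univ
    (μ := volume.restrict (Set.Ioc 0 (Real.pi / 2))) (f := g) (p := 1) (q := k) one_pos
    (by exact_mod_cast hk) hg.aestronglyMeasurable
  simp only [eLpNorm'_eq_lintegral_enorm, ENNReal.rpow_one, div_one, Measure.restrict_apply_univ,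
    Real.volume_Ioc, sub_zero, ENNReal.rpow_natCast] at h
  calc _ ≤ _ := pow_le_pow_left₀ (by simp) h k
    _ = _ := by
      rw [mul_pow, ← ENNReal.rpow_natCast, ← ENNReal.rpow_mul, one_div_mul_cancel hk0,
        ENNReal.rpow_one, mul_comm]
      congr 1
      rw [← ENNReal.rpow_natCast, ← ENNReal.rpow_mul, ← ENNReal.rpow_natCast]
      congr 1
      rw [sub_mul, one_div_mul_cancel hk0, Nat.cast_sub hk]
      simp

/-- The Maurey–Pisier bound: if `f` is `L`-Lipschitz then `f x - f y`, for independent standard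
Gaussian vectors `x` and `y`, has moments bounded independently of the dimension. One integrates
the derivative of `f` along the quarter circle from `x` to `y`: at every point of it, position and
velocity are independent standard Gaussian vectors. -/
theorem lintegral_lipschitz_sub_le (f : E → ℝ) (L : ℝ≥0) (hf : LipschitzWith L f) (k : ℕ)
    (hk : 1 ≤ k) :
    ∫⁻ z : E × E, ‖f z.2 - f z.1‖ₑ ^ k ∂((stdGaussian E).prod (stdGaussian E)) ≤
      ENNReal.ofReal (Real.pi / 2) ^ k * gaussMoment k * (L : ℝ≥0∞) ^ k := by
  set μ := stdGaussian E with hμ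
  -- derivative of `f` at the first point along the second vector
  set G : E × E → ℝ := fun z => fderiv ℝ f z.1 z.2 with hG
  have hGm : Measurable G := by
    have h1 : Measurable fun z : E × E => (fderiv ℝ f z.1, z.2) :=
      ((measurable_fderiv ℝ f).comp measurable_fst).prodMk measurable_snd
    have h2 : Continuous fun q : (E →L[ℝ] ℝ) × E => q.1 q.2 :=
      isBoundedBilinearMap_apply.continuous
    exact h2.measurable.comp h1
  have hrotc : Continuous fun q : ℝ × (E × E) => ContinuousLinearMap.rotation q.1 q.2 := by
    simp only [ContinuousLinearMap.rotation_apply]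
    fun_prop
  have hrot : ∀ θ : ℝ, (μ.prod μ).map (ContinuousLinearMap.rotation θ) = μ.prod μ := fun θ =>
    IsGaussian.map_rotation_eq_self (by simp [hμ]) θ
  have hdiff : ∀ᵐ z ∂(μ.prod μ), DifferentiableAt ℝ f z.1 := by
    have h1 : ∀ᵐ x ∂μ, DifferentiableAt ℝ f x :=
      stdGaussian_absolutelyContinuous.ae_le hf.ae_differentiableAt
    exact (Measure.quasiMeasurePreserving_fst (μ := μ) (ν := μ)).ae h1
  have hDm : MeasurableSet {z : E × E | DifferentiableAt ℝ f z.1} :=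
    (measurableSet_of_differentiableAt ℝ f).preimage measurable_fst
  have hdiff2 : ∀ θ : ℝ, ∀ᵐ z ∂(μ.prod μ),
      DifferentiableAt ℝ f (ContinuousLinearMap.rotation θ z).1 := by
    intro θ
    have h1 := hdiff
    rw [← hrot θ] at h1
    exact ae_of_ae_map (f := ContinuousLinearMap.rotation θ)
      (p := fun z => DifferentiableAt ℝ f z.1) (by fun_prop) h1
  have hdiff3 : ∀ᵐ z ∂(μ.prod μ), ∀ᵐ θ ∂(volume : Measure ℝ),
      DifferentiableAt ℝ f (ContinuousLinearMap.rotation θ z).1 := by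
    have hm : MeasurableSet {q : ℝ × (E × E) |
        DifferentiableAt ℝ f (ContinuousLinearMap.rotation q.1 q.2).1} :=
      hDm.preimage hrotc.measurable
    have h1 : ∀ᵐ q ∂((volume : Measure ℝ).prod (μ.prod μ)),
        DifferentiableAt ℝ f (ContinuousLinearMap.rotation q.1 q.2).1 := by
      rw [Measure.ae_prod_iff_ae_ae hm]
      exact Eventually.of_forall hdiff2
    have h2 := Measure.ae_ae_comm (μ := (volume : Measure ℝ)) (ν := μ.prod μ)
      (p := fun θ z => DifferentiableAt ℝ f (ContinuousLinearMap.rotation θ z).1) hm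
    exact h2.1 (Eventually.of_forall hdiff2)
  have hpt : ∀ᵐ z ∂(μ.prod μ), ‖f z.2 - f z.1‖ₑ ^ k ≤ ENNReal.ofReal (Real.pi / 2) ^ (k - 1) *
      ∫⁻ θ in Set.Ioc 0 (Real.pi / 2), ‖G (ContinuousLinearMap.rotation θ z)‖ₑ ^ k := by
    filter_upwards [hdiff3] with z hz
    have hgm : Measurable fun θ : ℝ => G (ContinuousLinearMap.rotation θ z) :=
      hGm.comp (hrotc.comp (by fun_prop : Continuous fun θ : ℝ => (θ, z))).measurable
    refine le_trans (pow_le_pow_left₀ (by simp) ?_ k) (lintegral_pow_le_quarter _ hgm k hk)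
    have hpi : (0 : ℝ) ≤ Real.pi / 2 := by positivity
    set c : ℝ → E := fun θ => (ContinuousLinearMap.rotation θ z).1 with hc
    have hcd : ∀ θ, HasDerivAt c (ContinuousLinearMap.rotation θ z).2 θ := by
      intro θ
      have h1 := ((Real.hasDerivAt_cos θ).smul_const z.1).add
        ((Real.hasDerivAt_sin θ).smul_const z.2)
      exact h1
    have hcL : LipschitzOnWith (‖z.1‖₊ + ‖z.2‖₊) c (Set.uIcc 0 (Real.pi / 2)) := by
      refine (convex_uIcc _ _).lipschitzOnWith_of_nnnorm_hasDerivWithin_le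
        (fun θ _ => (hcd θ).hasDerivWithinAt) fun θ _ => ?_
      rw [← NNReal.coe_le_coe]
      simp only [coe_nnnorm, NNReal.coe_add, ContinuousLinearMap.rotation_apply]
      refine (norm_add_le _ _).trans ?_
      rw [norm_smul, norm_smul, norm_neg]
      have hs : ‖Real.sin θ‖ ≤ 1 := Real.abs_sin_le_one θ
      have hcos : ‖Real.cos θ‖ ≤ 1 := Real.abs_cos_le_one θ
      nlinarith [norm_nonneg z.1, norm_nonneg z.2]
    have hac : AbsolutelyContinuousOnInterval (f ∘ c) 0 (Real.pi / 2) :=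
      (hf.comp_lipschitzOnWith hcL).absolutelyContinuousOnInterval
    have hftc := hac.integral_deriv_eq_sub
    have he : f z.2 - f z.1 = ∫ θ in Set.Ioc 0 (Real.pi / 2), deriv (f ∘ c) θ := by
      rw [← intervalIntegral.integral_of_le hpi, hftc]
      simp [hc, ContinuousLinearMap.rotation_apply]
    rw [he]
    refine (enorm_integral_le_lintegral_enorm _).trans (le_of_eq ?_)
    refine lintegral_congr_ae (ae_restrict_of_ae ?_)
    filter_upwards [hz] with θ hθ
    have := (hθ.hasFDerivAt.comp_hasDerivAt θ (hcd θ)).deriv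
    rw [this]
  calc ∫⁻ z, ‖f z.2 - f z.1‖ₑ ^ k ∂(μ.prod μ)
      ≤ ∫⁻ z, (ENNReal.ofReal (Real.pi / 2) ^ (k - 1) *
        ∫⁻ θ in Set.Ioc 0 (Real.pi / 2), ‖G (ContinuousLinearMap.rotation θ z)‖ₑ ^ k)
          ∂(μ.prod μ) := lintegral_mono_ae hpt
    _ = ENNReal.ofReal (Real.pi / 2) ^ (k - 1) *
        ∫⁻ θ in Set.Ioc 0 (Real.pi / 2), ∫⁻ z, ‖G (ContinuousLinearMap.rotation θ z)‖ₑ ^ k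
          ∂(μ.prod μ) := by
      rw [lintegral_const_mul' _ _ (by simp)]
      congr 1
      refine lintegral_lintegral_swap (μ := μ.prod μ)
        (f := fun z θ => ‖G (ContinuousLinearMap.rotation θ z)‖ₑ ^ k) ?_
      have h1 : Measurable fun q : (E × E) × ℝ =>
          G (ContinuousLinearMap.rotation q.2 q.1) :=
        hGm.comp (hrotc.comp (by fun_prop : Continuous fun q : (E × E) × ℝ => (q.2, q.1))).measurable
      exact (h1.enorm.pow_const k).aemeasurable
    _ = ENNReal.ofReal (Real.pi / 2) ^ (k - 1) *
        ∫⁻ θ in Set.Ioc 0 (Real.pi / 2), ∫⁻ z, ‖G z‖ₑ ^ k ∂(μ.prod μ) := by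
      congr 1
      refine lintegral_congr fun θ => ?_
      conv_rhs => rw [← hrot θ]
      rw [lintegral_map (hGm.enorm.pow_const k) (by fun_prop)]
    _ = ENNReal.ofReal (Real.pi / 2) ^ k * ∫⁻ z, ‖G z‖ₑ ^ k ∂(μ.prod μ) := by
      rw [setLIntegral_const, Real.volume_Ioc, sub_zero]
      obtain ⟨j, rfl⟩ : ∃ j, k = j + 1 := ⟨k - 1, by omega⟩
      rw [Nat.add_sub_cancel, pow_succ]
      ring
    _ ≤ _ := by
      rw [mul_assoc]
      gcongr
      rw [lintegral_prod _ (hGm.enorm.pow_const k).aemeasurable]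
      calc ∫⁻ x, ∫⁻ y, ‖G (x, y)‖ₑ ^ k ∂μ ∂μ ≤ ∫⁻ _, gaussMoment k * (L : ℝ≥0∞) ^ k ∂μ := by
            refine lintegral_mono fun x => ?_
            simp only [hG]
            rw [lintegral_dual_stdGaussian, mul_comm]
            gcongr
            have := norm_fderiv_le_of_lipschitz ℝ (x₀ := x) hf
            rw [enorm_eq_nnnorm]
            exact_mod_cast this
        _ = _ := by simp

theorem lipschitz_integrable_stdGaussian (f : E → ℝ) (L : ℝ≥0) (hf : LipschitzWith L f) :
    Integrable f (stdGaussian E) := by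
  have h1 : Integrable (fun x : E => L * ‖x‖ + ‖f 0‖) (stdGaussian E) :=
    ((IsGaussian.integrable_id (μ := stdGaussian E)).norm.const_mul _).add (integrable_const _)
  refine h1.mono' hf.continuous.aestronglyMeasurable (Eventually.of_forall fun x => ?_)
  have := hf.dist_le_mul x 0
  rw [dist_zero_right, Real.dist_eq] at this
  have h2 := norm_add_le (f x - f 0) (f 0)
  rw [sub_add_cancel] at h2
  simp only [Real.norm_eq_abs] at *
  linarith

/-- The moments of `f - ∫ f` for a Lipschitz function `f` of a standard Gaussian vector are bounded
independently of the dimension. -/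
theorem lintegral_lipschitz_sub_integral_le (f : E → ℝ) (L : ℝ≥0) (hf : LipschitzWith L f) (k : ℕ)
    (hk : 1 ≤ k) :
    ∫⁻ x, ‖f x - ∫ y, f y ∂(stdGaussian E)‖ₑ ^ k ∂(stdGaussian E) ≤
      ENNReal.ofReal (Real.pi / 2) ^ k * gaussMoment k * (L : ℝ≥0∞) ^ k := by
  refine le_trans ?_ (lintegral_lipschitz_sub_le f L hf k hk)
  set μ := stdGaussian E with hμ
  have hfi : Integrable f μ := lipschitz_integrable_stdGaussian f L hf
  have hfm : Measurable f := hf.continuous.measurable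
  have hm : Measurable fun z : E × E => ‖f z.2 - f z.1‖ₑ ^ k :=
    ((hfm.comp measurable_snd).sub (hfm.comp measurable_fst)).enorm.pow_const k
  rw [lintegral_prod_symm _ hm.aemeasurable]
  refine lintegral_mono fun y => ?_
  have hk0 : (k : ℝ) ≠ 0 := by positivity
  have h1 : f y - ∫ x, f x ∂μ = ∫ x, (f y - f x) ∂μ := by
    rw [integral_sub (integrable_const _) hfi]; simp
  have h2 := eLpNorm'_le_eLpNorm'_mul_rpow_measure_univ
    (μ := μ) (f := fun x => f y - f x) (p := 1) (q := k) one_pos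
    (by exact_mod_cast hk) (hfm.const_sub _).aestronglyMeasurable
  simp only [eLpNorm'_eq_lintegral_enorm, ENNReal.rpow_one, div_one, measure_univ,
    ENNReal.one_rpow, mul_one, ENNReal.rpow_natCast] at h2
  rw [h1]
  calc _ ≤ (∫⁻ x, ‖f y - f x‖ₑ ∂μ) ^ k :=
        pow_le_pow_left₀ (by simp) (enorm_integral_le_lintegral_enorm _) k
    _ ≤ _ := pow_le_pow_left₀ (by simp) h2 k
    _ = _ := by
      rw [← ENNReal.rpow_natCast, ← ENNReal.rpow_mul, one_div_mul_cancel hk0, ENNReal.rpow_one]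

end Gaussian

end RandomFeatures

namespace RandomFeatures

/-! ### Quadratic forms and resolvents of positive semidefinite matrices -/

section LinearAlgebra

variable {τ : Type*} [Fintype τ]

theorem dot_mulVec_comm {M : Matrix τ τ ℝ} (hM : Mᵀ = M) (x y : τ → ℝ) :
    x ⬝ᵥ M *ᵥ y = (M *ᵥ x) ⬝ᵥ y := by
  rw [Matrix.dotProduct_mulVec, ← Matrix.mulVec_transpose, hM]

theorem dot_mulVec_swap {M : Matrix τ τ ℝ} (hM : Mᵀ = M) (x y : τ → ℝ) :
    x ⬝ᵥ M *ᵥ y = y ⬝ᵥ M *ᵥ x := by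
  rw [dot_mulVec_comm hM, dotProduct_comm]

theorem posSemidef_iff_quad {M : Matrix τ τ ℝ} :
    M.PosSemidef ↔ Mᵀ = M ∧ ∀ x : τ → ℝ, 0 ≤ x ⬝ᵥ M *ᵥ x := by
  rw [Matrix.posSemidef_iff_dotProduct_mulVec, Matrix.IsHermitian,
    Matrix.conjTranspose_eq_transpose_of_trivial]
  rfl

theorem PSD.symm {M : Matrix τ τ ℝ} (hM : M.PosSemidef) : Mᵀ = M := (posSemidef_iff_quad.1 hM).1

theorem PSD.nonneg {M : Matrix τ τ ℝ} (hM : M.PosSemidef) (x : τ → ℝ) : 0 ≤ x ⬝ᵥ M *ᵥ x :=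
  (posSemidef_iff_quad.1 hM).2 x

theorem dot_self_nonneg (x : τ → ℝ) : 0 ≤ x ⬝ᵥ x :=
  Finset.sum_nonneg fun _ _ => mul_self_nonneg _

/-- The Cauchy–Schwarz inequality for a positive semidefinite form. -/
theorem PSD.cauchy {M : Matrix τ τ ℝ} (hM : M.PosSemidef) (x y : τ → ℝ) :
    (x ⬝ᵥ M *ᵥ y) ^ 2 ≤ (x ⬝ᵥ M *ᵥ x) * (y ⬝ᵥ M *ᵥ y) := by
  have h : ∀ t : ℝ, 0 ≤ (y ⬝ᵥ M *ᵥ y) * (t * t) + (2 * (x ⬝ᵥ M *ᵥ y)) * t + x ⬝ᵥ M *ᵥ x := by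
    intro t
    have h1 := PSD.nonneg hM (x + t • y)
    simp only [Matrix.mulVec_add, Matrix.mulVec_smul, add_dotProduct, dotProduct_add,
      smul_dotProduct, dotProduct_smul, smul_eq_mul] at h1
    rw [dot_mulVec_swap (PSD.symm hM) y x] at h1
    linarith
  have := discrim_le_zero h
  rw [discrim] at this
  nlinarith

theorem PSD.two_mul_le {M : Matrix τ τ ℝ} (hM : M.PosSemidef) (x y : τ → ℝ) :
    2 * |x ⬝ᵥ M *ᵥ y| ≤ x ⬝ᵥ M *ᵥ x + y ⬝ᵥ M *ᵥ y := by
  have h1 := PSD.cauchy hM x y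
  have hx := PSD.nonneg hM x
  have hy := PSD.nonneg hM y
  have h2 : (2 * |x ⬝ᵥ M *ᵥ y|) ^ 2 ≤ (x ⬝ᵥ M *ᵥ x + y ⬝ᵥ M *ᵥ y) ^ 2 := by
    rw [mul_pow, sq_abs]
    nlinarith [sq_nonneg (x ⬝ᵥ M *ᵥ x - y ⬝ᵥ M *ᵥ y)]
  exact le_of_sq_le_sq h2 (by positivity)

theorem PSD.add_quad_le {M : Matrix τ τ ℝ} (hM : M.PosSemidef) (x y : τ → ℝ) :
    (x + y) ⬝ᵥ M *ᵥ (x + y) ≤ 2 * (x ⬝ᵥ M *ᵥ x) + 2 * (y ⬝ᵥ M *ᵥ y) := by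
  have h1 := PSD.two_mul_le hM x y
  have h2 := le_abs_self (x ⬝ᵥ M *ᵥ y)
  simp only [Matrix.mulVec_add, add_dotProduct, dotProduct_add]
  rw [dot_mulVec_swap (PSD.symm hM) y x]
  linarith

theorem dot_sq_le (x y : τ → ℝ) : (x ⬝ᵥ y) ^ 2 ≤ (x ⬝ᵥ x) * (y ⬝ᵥ y) := by
  classical
  have := PSD.cauchy (Matrix.PosSemidef.one (n := τ) (R := ℝ)) x y
  simpa using this

/-- A positive semidefinite matrix whose form is at most `β` has operator norm at most `β`. -/
theorem PSD.norm_le {B : Matrix τ τ ℝ} (hB : B.PosSemidef) {β : ℝ}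
    (h : ∀ x : τ → ℝ, x ⬝ᵥ B *ᵥ x ≤ β * (x ⬝ᵥ x)) (x : τ → ℝ) :
    (B *ᵥ x) ⬝ᵥ (B *ᵥ x) ≤ β ^ 2 * (x ⬝ᵥ x) := by
  have h1 := PSD.cauchy hB (B *ᵥ x) x
  have h2 : (B *ᵥ x) ⬝ᵥ B *ᵥ x ≤ 0 ∨ 0 < (B *ᵥ x) ⬝ᵥ B *ᵥ x := le_or_gt _ _
  rcases h2 with h2 | h2
  · exact h2.trans (mul_nonneg (sq_nonneg _) (dot_self_nonneg _))
  have h3 := h (B *ᵥ x)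
  have h4 := h x
  have h5 := PSD.nonneg hB x
  have h6 : ((B *ᵥ x) ⬝ᵥ (B *ᵥ x)) ^ 2 ≤
      (β * ((B *ᵥ x) ⬝ᵥ (B *ᵥ x))) * (β * (x ⬝ᵥ x)) :=
    h1.trans (mul_le_mul h3 h4 h5 ((PSD.nonneg hB _).trans h3))
  have h7 : ((B *ᵥ x) ⬝ᵥ (B *ᵥ x)) * ((B *ᵥ x) ⬝ᵥ (B *ᵥ x)) ≤
      ((B *ᵥ x) ⬝ᵥ (B *ᵥ x)) * (β ^ 2 * (x ⬝ᵥ x)) := by nlinarith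
  exact le_of_mul_le_mul_left h7 h2

/-- A trace against a positive semidefinite matrix is a sum of values of the quadratic form. -/
theorem PSD.exists_sum {F : Matrix τ τ ℝ} (hF : F.PosSemidef) :
    ∃ (k : ℕ) (r : Fin k → τ → ℝ), ∀ M : Matrix τ τ ℝ,
      (F * M).trace = ∑ i, r i ⬝ᵥ M *ᵥ r i := by
  obtain ⟨k, r, hr⟩ := Matrix.posSemidef_iff_eq_sum_vecMulVec.1 hF
  refine ⟨k, r, fun M => ?_⟩
  rw [hr, Finset.sum_mul, Matrix.trace_sum]
  refine Finset.sum_congr rfl fun i _ => ?_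
  rw [Matrix.vecMulVec_mul, Matrix.trace_vecMulVec, star_trivial, dotProduct_comm, Matrix.dotProduct_mulVec]

theorem dot_vecMulVec_mulVec (y x z : τ → ℝ) :
    z ⬝ᵥ Matrix.vecMulVec y y *ᵥ x = (z ⬝ᵥ y) * (y ⬝ᵥ x) := by
  rw [Matrix.vecMulVec_mulVec, dotProduct_smul]
  simp [mul_comm]

theorem vecMulVec_posSemidef (y : τ → ℝ) : (Matrix.vecMulVec y y).PosSemidef := by
  simpa using Matrix.posSemidef_vecMulVec_self_star y

theorem trace_mul_mono {F : Matrix τ τ ℝ} (hF : F.PosSemidef) {M M' : Matrix τ τ ℝ}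
    (h : ∀ x : τ → ℝ, x ⬝ᵥ M *ᵥ x ≤ x ⬝ᵥ M' *ᵥ x) : (F * M).trace ≤ (F * M').trace := by
  obtain ⟨k, r, hr⟩ := PSD.exists_sum hF
  rw [hr, hr]
  exact Finset.sum_le_sum fun i _ => h _

theorem trace_mul_nonneg {F M : Matrix τ τ ℝ} (hF : F.PosSemidef) (hM : M.PosSemidef) :
    0 ≤ (F * M).trace := by
  have := trace_mul_mono (M := 0) hF (M' := M) (fun x => by simpa using PSD.nonneg hM x)
  simpa using this

end LinearAlgebra
end RandomFeatures

namespace RandomFeatures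

section Resolvent

variable {τ : Type*} [Fintype τ] [DecidableEq τ]

/-- The resolvent `(S + γ)⁻¹` of a symmetric matrix `S`. -/
noncomputable def regInv (γ : ℝ) (S : Matrix τ τ ℝ) : Matrix τ τ ℝ := (S + γ • (1 : Matrix τ τ ℝ))⁻¹

variable {γ : ℝ} {S : Matrix τ τ ℝ}

theorem isUnit_det_add_smul (hγ : 0 < γ) (hS : S.PosSemidef) :
    IsUnit (S + γ • (1 : Matrix τ τ ℝ)).det := by
  have h1 : (γ • (1 : Matrix τ τ ℝ)).PosDef := Matrix.PosDef.one.smul hγ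
  exact (Matrix.isUnit_iff_isUnit_det _).1 (Matrix.PosDef.posSemidef_add hS h1).isUnit

theorem mul_regInv (hγ : 0 < γ) (hS : S.PosSemidef) :
    (S + γ • (1 : Matrix τ τ ℝ)) * regInv γ S = 1 :=
  Matrix.mul_nonsing_inv _ (isUnit_det_add_smul hγ hS)

theorem regInv_mul (hγ : 0 < γ) (hS : S.PosSemidef) :
    regInv γ S * (S + γ • (1 : Matrix τ τ ℝ)) = 1 :=
  Matrix.nonsing_inv_mul _ (isUnit_det_add_smul hγ hS)

theorem mulVec_regInv (hγ : 0 < γ) (hS : S.PosSemidef) (x : τ → ℝ) :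
    S *ᵥ (regInv γ S *ᵥ x) + γ • (regInv γ S *ᵥ x) = x := by
  have h := congrArg (· *ᵥ x) (mul_regInv hγ hS)
  simpa [← Matrix.mulVec_mulVec, Matrix.add_mulVec, Matrix.smul_mulVec] using h

/-- `z = (S + γ)⁻¹ x` is the unique solution of `S z + γ z = x`. -/
theorem regInv_mulVec_eq (hγ : 0 < γ) (hS : S.PosSemidef) {x z : τ → ℝ}
    (h : S *ᵥ z + γ • z = x) : regInv γ S *ᵥ x = z := by
  have h1 : (S + γ • (1 : Matrix τ τ ℝ)) *ᵥ z = x := by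
    simpa [Matrix.add_mulVec, Matrix.smul_mulVec] using h
  rw [← h1, Matrix.mulVec_mulVec, regInv_mul hγ hS, Matrix.one_mulVec]

theorem regInv_posSemidef (hγ : 0 < γ) (hS : S.PosSemidef) : (regInv γ S).PosSemidef :=
  (hS.add (Matrix.PosSemidef.one.smul hγ.le)).inv

theorem regInv_symm (hγ : 0 < γ) (hS : S.PosSemidef) : (regInv γ S)ᵀ = regInv γ S :=
  PSD.symm (regInv_posSemidef hγ hS)

theorem regInv_quad (hγ : 0 < γ) (hS : S.PosSemidef) (x : τ → ℝ) :
    x ⬝ᵥ regInv γ S *ᵥ x = (regInv γ S *ᵥ x) ⬝ᵥ S *ᵥ (regInv γ S *ᵥ x) +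
      γ * ((regInv γ S *ᵥ x) ⬝ᵥ (regInv γ S *ᵥ x)) := by
  conv_lhs => rw [dotProduct_comm]; arg 2; rw [← mulVec_regInv hγ hS x]
  rw [dotProduct_add, dotProduct_smul, smul_eq_mul]

theorem regInv_quad_ge (hγ : 0 < γ) (hS : S.PosSemidef) (x : τ → ℝ) :
    γ * ((regInv γ S *ᵥ x) ⬝ᵥ (regInv γ S *ᵥ x)) ≤ x ⬝ᵥ regInv γ S *ᵥ x := by
  have := PSD.nonneg hS (regInv γ S *ᵥ x)
  rw [regInv_quad hγ hS]; linarith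

theorem regInv_sandwich_le (hγ : 0 < γ) (hS : S.PosSemidef) (x : τ → ℝ) :
    (regInv γ S *ᵥ x) ⬝ᵥ S *ᵥ (regInv γ S *ᵥ x) ≤ x ⬝ᵥ regInv γ S *ᵥ x := by
  have := mul_nonneg hγ.le (dot_self_nonneg (regInv γ S *ᵥ x))
  rw [regInv_quad hγ hS x]; linarith

theorem regInv_norm_le (hγ : 0 < γ) (hS : S.PosSemidef) (x : τ → ℝ) :
    γ ^ 2 * ((regInv γ S *ᵥ x) ⬝ᵥ (regInv γ S *ᵥ x)) ≤ x ⬝ᵥ x := by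
  have h1 := regInv_quad_ge hγ hS x
  have h2 := dot_sq_le x (regInv γ S *ᵥ x)
  set q := (regInv γ S *ᵥ x) ⬝ᵥ (regInv γ S *ᵥ x)
  have hq : 0 ≤ q := dot_self_nonneg _
  have hx : 0 ≤ x ⬝ᵥ x := dot_self_nonneg _
  rcases hq.eq_or_lt with h0 | h0
  · rw [← h0]; simpa using hx
  have h3 : (γ * q) ^ 2 ≤ (x ⬝ᵥ x) * q := (pow_le_pow_left₀ (by positivity) h1 2).trans h2
  have h4 : q * (γ ^ 2 * q) ≤ q * (x ⬝ᵥ x) := by nlinarith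
  exact le_of_mul_le_mul_left h4 h0

theorem regInv_quad_le (hγ : 0 < γ) (hS : S.PosSemidef) (x : τ → ℝ) :
    x ⬝ᵥ regInv γ S *ᵥ x ≤ γ⁻¹ * (x ⬝ᵥ x) := by
  have h1 := regInv_norm_le hγ hS x
  have h2 := dot_sq_le x (regInv γ S *ᵥ x)
  have hx : 0 ≤ x ⬝ᵥ x := dot_self_nonneg _
  have h3 : (γ * (x ⬝ᵥ regInv γ S *ᵥ x)) ^ 2 ≤ (x ⬝ᵥ x) ^ 2 := by nlinarith
  have h4 := le_of_sq_le_sq h3 hx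
  rw [inv_mul_eq_div, le_div_iff₀ hγ]; linarith

theorem regInv_norm_le' (hγ : 0 < γ) (hS : S.PosSemidef) (x : τ → ℝ) :
    (regInv γ S *ᵥ x) ⬝ᵥ (regInv γ S *ᵥ x) ≤ (γ⁻¹) ^ 2 * (x ⬝ᵥ x) := by
  have h1 := regInv_norm_le hγ hS x
  rw [inv_pow, inv_mul_eq_div, le_div_iff₀ (by positivity)]; linarith

theorem mulVec_regInv_norm_le (hγ : 0 < γ) (hS : S.PosSemidef) (x : τ → ℝ) :
    (S *ᵥ (regInv γ S *ᵥ x)) ⬝ᵥ (S *ᵥ (regInv γ S *ᵥ x)) ≤ x ⬝ᵥ x := by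
  have h1 : S *ᵥ (regInv γ S *ᵥ x) = x - γ • (regInv γ S *ᵥ x) :=
    eq_sub_of_add_eq (mulVec_regInv hγ hS x)
  have h2 := regInv_quad_ge hγ hS x
  have h3 : 0 ≤ x ⬝ᵥ regInv γ S *ᵥ x := PSD.nonneg (regInv_posSemidef hγ hS) x
  rw [h1]
  simp only [sub_dotProduct, dotProduct_sub, smul_dotProduct, dotProduct_smul, smul_eq_mul]
  rw [dotProduct_comm (regInv γ S *ᵥ x) x]
  nlinarith

/-- The resolvent identity. -/
theorem regInv_sub (hγ : 0 < γ) (hS : S.PosSemidef) {S' : Matrix τ τ ℝ} (hS' : S'.PosSemidef) :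
    regInv γ S - regInv γ S' = regInv γ S' * (S' - S) * regInv γ S := by
  have h : S' - S = (S' + γ • (1 : Matrix τ τ ℝ)) - (S + γ • (1 : Matrix τ τ ℝ)) := by abel
  rw [h, mul_sub, sub_mul, regInv_mul hγ hS', mul_assoc, mul_regInv hγ hS, one_mul, mul_one]

/-- The effect of a rank-one perturbation on the resolvent (Sherman–Morrison). -/
theorem regInv_add_vecMulVec_mulVec (hγ : 0 < γ) (hS : S.PosSemidef) (y x : τ → ℝ) :
    regInv γ (Matrix.vecMulVec y y + S) *ᵥ x = regInv γ S *ᵥ x -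
      ((y ⬝ᵥ regInv γ S *ᵥ x) / (1 + y ⬝ᵥ regInv γ S *ᵥ y)) • (regInv γ S *ᵥ y) := by
  have hD : 0 ≤ y ⬝ᵥ regInv γ S *ᵥ y := PSD.nonneg (regInv_posSemidef hγ hS) y
  refine regInv_mulVec_eq hγ ((vecMulVec_posSemidef y).add hS) ?_
  have h1 := mulVec_regInv hγ hS x
  have h2 := mulVec_regInv hγ hS y
  set p := regInv γ S *ᵥ x
  set q := regInv γ S *ᵥ y
  have h3 : 1 + y ⬝ᵥ q ≠ 0 := by positivity
  ext i
  have h1i := congrFun h1 i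
  have h2i := congrFun h2 i
  simp only [Matrix.add_mulVec, Matrix.mulVec_sub, Matrix.mulVec_smul, Matrix.vecMulVec_mulVec,
    Pi.add_apply, Pi.sub_apply, Pi.smul_apply, smul_eq_mul, op_smul_eq_mul] at h1i h2i ⊢
  field_simp
  linear_combination (1 + y ⬝ᵥ q) * h1i - (y ⬝ᵥ p) * h2i

theorem regInv_add_vecMulVec (hγ : 0 < γ) (hS : S.PosSemidef) (y : τ → ℝ) :
    regInv γ (Matrix.vecMulVec y y + S) = regInv γ S -
      (1 + y ⬝ᵥ regInv γ S *ᵥ y)⁻¹ •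
        Matrix.vecMulVec (regInv γ S *ᵥ y) (regInv γ S *ᵥ y) := by
  refine Matrix.ext_of_mulVec_single fun i => ?_
  rw [regInv_add_vecMulVec_mulVec hγ hS, Matrix.sub_mulVec, Matrix.smul_mulVec,
    Matrix.vecMulVec_mulVec, dot_mulVec_comm (regInv_symm hγ hS) y]
  ext j
  simp [div_eq_inv_mul, mul_assoc, mul_comm]

end Resolvent

/-! ### The fixed-point equation -/

section FixedPoint

variable {τ : Type*} [Fintype τ] [DecidableEq τ]

/-- `Q̄ = (n F / (1 + d) + γ)⁻¹`, where `F = Φ / T` is the second moment of a normalised row. -/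
noncomputable def detRes (γ n : ℝ) (F : Matrix τ τ ℝ) (d : ℝ) : Matrix τ τ ℝ :=
  regInv γ ((n / (1 + d)) • F)

variable {γ n : ℝ} {F : Matrix τ τ ℝ}

/-- `|tr (F M)| ≤ c tr F` if the form of `M` is bounded by `c`. -/
theorem abs_trace_mul_le {F : Matrix τ τ ℝ} (hF : F.PosSemidef) {M : Matrix τ τ ℝ} {c : ℝ}
    (h : ∀ x : τ → ℝ, |x ⬝ᵥ M *ᵥ x| ≤ c * (x ⬝ᵥ x)) : |(F * M).trace| ≤ c * F.trace := by
  have h1 : (F * (c • 1)).trace = c * F.trace := by simp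
  have h2 : (F * (-(c • 1))).trace = -(c * F.trace) := by simp
  rw [abs_le]
  constructor
  · rw [← h2]
    refine trace_mul_mono hF fun x => ?_
    have := (abs_le.1 (h x)).1
    simpa [Matrix.neg_mulVec, Matrix.smul_mulVec] using this
  · rw [← h1]
    refine trace_mul_mono hF fun x => ?_
    have := (abs_le.1 (h x)).2
    simpa [Matrix.smul_mulVec] using this

/-- `d ↦ tr (F Q̄_d) / (1 + d)` is nonincreasing. -/
theorem trace_detRes_div_antitone (hγ : 0 < γ) (hn : 0 ≤ n) (hF : F.PosSemidef) {s t : ℝ}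
    (hs : 0 ≤ s) (hst : s ≤ t) :
    (F * detRes γ n F t).trace / (1 + t) ≤ (F * detRes γ n F s).trace / (1 + s) := by
  have hs1 : 0 < 1 + s := by linarith
  have ht1 : 0 < 1 + t := by linarith
  have h : (F * ((1 + t)⁻¹ • detRes γ n F t)).trace ≤ (F * ((1 + s)⁻¹ • detRes γ n F s)).trace := by
    refine trace_mul_mono hF fun v => ?_
    have hR := (hF.smul hn).smul (by positivity : (0 : ℝ) ≤ 1)
    have hnF : (n • F).PosSemidef := hF.smul hn
    have hgs : 0 < γ * (1 + s) := by positivity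
    have hgt : 0 < γ * (1 + t) := by positivity
    have e : ∀ u : ℝ, 0 ≤ u → ((1 + u)⁻¹ • detRes γ n F u) *ᵥ v =
        regInv (γ * (1 + u)) (n • F) *ᵥ v := by
      intro u hu
      have hu1 : 0 < 1 + u := by linarith
      refine (regInv_mulVec_eq (by positivity) hnF ?_).symm
      have h1 := mulVec_regInv hγ (hF.smul (div_nonneg hn hu1.le)) v
      conv_rhs => rw [← h1]
      ext i
      simp only [detRes, Matrix.smul_mulVec, Matrix.mulVec_smul, Pi.add_apply, Pi.smul_apply,
        smul_eq_mul]
      field_simp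
    rw [e t (hs.trans hst), e s hs]
    have hp := mulVec_regInv hgs hnF v
    have hq := mulVec_regInv hgt hnF v
    set p := regInv (γ * (1 + s)) (n • F) *ᵥ v
    set q := regInv (γ * (1 + t)) (n • F) *ᵥ v with hqd
    have hc : 0 ≤ γ * (1 + t) - γ * (1 + s) := by nlinarith
    have hpq : p = q + (γ * (1 + t) - γ * (1 + s)) • (regInv (γ * (1 + s)) (n • F) *ᵥ q) := by
      refine regInv_mulVec_eq hgs hnF ?_
      have h1 := mulVec_regInv hgs hnF q
      ext i
      have h1i := congrFun h1 i
      have hqi := congrFun hq i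
      simp only [Matrix.mulVec_add, Matrix.mulVec_smul, Pi.add_apply, Pi.smul_apply,
        smul_eq_mul] at h1i hqi ⊢
      linear_combination hqi + (γ * (1 + t) - γ * (1 + s)) * h1i
    have h0 : 0 ≤ q ⬝ᵥ p := by
      rw [hpq, dotProduct_add, dotProduct_smul]
      have := PSD.nonneg (regInv_posSemidef hgs hnF) q
      have := dot_self_nonneg q
      positivity
    have h2 : v ⬝ᵥ p - v ⬝ᵥ q = (γ * (1 + t) - γ * (1 + s)) * (q ⬝ᵥ p) := by
      have e1 : v ⬝ᵥ p = ((n • F) *ᵥ q + (γ * (1 + t)) • q) ⬝ᵥ p := by rw [hq]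
      have e2 : v ⬝ᵥ q = q ⬝ᵥ ((n • F) *ᵥ p + (γ * (1 + s)) • p) := by rw [hp, dotProduct_comm]
      rw [e1, e2, add_dotProduct, dotProduct_add, dot_mulVec_comm (PSD.symm hnF) q p,
        smul_dotProduct, dotProduct_smul, smul_eq_mul, smul_eq_mul]
      ring
    nlinarith [mul_nonneg hc h0]
  simpa [Matrix.mul_smul, Matrix.trace_smul, div_eq_inv_mul] using h

/-- An approximate solution of the fixed-point equation is close to the solution. -/
theorem fixedPoint_stable (hγ : 0 < γ) (hn : 0 ≤ n) (hF : F.PosSemidef) {α δ e : ℝ}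
    (hα : 0 ≤ α) (hδ : 0 ≤ δ) (hδe : δ = (F * detRes γ n F δ).trace)
    (he : |α - (F * detRes γ n F α).trace| ≤ e) : |α - δ| ≤ (1 + α) * (1 + δ) * e := by
  have ha1 : 0 < 1 + α := by linarith
  have hd1 : 0 < 1 + δ := by linarith
  have he0 : 0 ≤ e := (abs_nonneg _).trans he
  have key : ∀ x y : ℝ, x / (1 + α) ≤ y / (1 + δ) → x * (1 + δ) ≤ y * (1 + α) := by
    intro x y h
    rwa [div_le_div_iff₀ ha1 hd1] at h
  have h1 := abs_le.1 he
  rcases le_total δ α with h | h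
  · have h2 := key _ _ (trace_detRes_div_antitone hγ hn hF hδ h)
    rw [← hδe] at h2
    rw [abs_of_nonneg (by linarith)]
    nlinarith [mul_le_mul_of_nonneg_right h1.2 hd1.le, mul_nonneg he0 hd1.le,
      mul_nonneg (mul_nonneg he0 hd1.le) hα]
  · have h2 := trace_detRes_div_antitone hγ hn hF hα h
    rw [← hδe, div_le_div_iff₀ hd1 ha1] at h2
    rw [abs_of_nonpos (by linarith)]
    nlinarith [mul_le_mul_of_nonneg_right h1.1 hd1.le, mul_nonneg he0 hd1.le,
      mul_nonneg (mul_nonneg he0 hd1.le) hα]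

theorem fixedPoint_unique (hγ : 0 < γ) (hn : 0 ≤ n) (hF : F.PosSemidef) {α δ : ℝ}
    (hα : 0 ≤ α) (hδ : 0 ≤ δ) (hαe : α = (F * detRes γ n F α).trace)
    (hδe : δ = (F * detRes γ n F δ).trace) : α = δ := by
  have h := fixedPoint_stable hγ hn hF hα hδ hδe (e := 0) (by rw [← hαe]; simp)
  rw [mul_zero, abs_nonpos_iff, sub_eq_zero] at h
  exact h

theorem detRes_posSemidef (hγ : 0 < γ) (hn : 0 ≤ n) (hF : F.PosSemidef) {d : ℝ} (hd : 0 ≤ d) :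
    (detRes γ n F d).PosSemidef :=
  regInv_posSemidef hγ (hF.smul (div_nonneg hn (by linarith)))

theorem trace_mul_detRes_le (hγ : 0 < γ) (hn : 0 ≤ n) (hF : F.PosSemidef) {d : ℝ} (hd : 0 ≤ d) :
    (F * detRes γ n F d).trace ≤ γ⁻¹ * F.trace := by
  refine (le_abs_self _).trans (abs_trace_mul_le hF fun x => ?_)
  rw [abs_of_nonneg (PSD.nonneg (detRes_posSemidef hγ hn hF hd) x)]
  exact regInv_quad_le hγ (hF.smul (div_nonneg hn (by linarith))) x

theorem exists_fixedPoint (hγ : 0 < γ) (hn : 0 ≤ n) (hF : F.PosSemidef) :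
    ∃ δ : ℝ, 0 ≤ δ ∧ δ = (F * detRes γ n F δ).trace := by
  have htr : 0 ≤ γ⁻¹ * F.trace := mul_nonneg (by positivity) hF.trace_nonneg
  have hc : ContinuousOn (fun d : ℝ => d - (F * detRes γ n F d).trace)
      (Set.Icc 0 (γ⁻¹ * F.trace)) := by
    have h1 : ContinuousOn (fun d : ℝ => (n / (1 + d)) • F + γ • (1 : Matrix τ τ ℝ))
        (Set.Icc 0 (γ⁻¹ * F.trace)) := by
      refine ContinuousOn.fun_add (ContinuousOn.fun_smul ?_ continuousOn_const) continuousOn_const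
      exact continuousOn_const.div (by fun_prop) fun d hd => by have := hd.1; positivity
    have h2 : ContinuousOn (fun d : ℝ => detRes γ n F d) (Set.Icc 0 (γ⁻¹ * F.trace)) := by
      unfold detRes regInv
      simp only [Matrix.inv_def, Ring.inverse_eq_inv']
      refine ContinuousOn.fun_smul (ContinuousOn.fun_inv₀ ?_ fun d hd => ?_) ?_
      · exact (Continuous.matrix_det continuous_id).comp_continuousOn h1
      · exact (isUnit_det_add_smul hγ (hF.smul (div_nonneg hn (by linarith [hd.1])))).ne_zero
      · exact (Continuous.matrix_adjugate continuous_id).comp_continuousOn h1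
    have h3 : Continuous fun M : Matrix τ τ ℝ => (F * M).trace :=
      (continuous_const.matrix_mul continuous_id).matrix_trace
    exact continuousOn_id.sub (h3.comp_continuousOn h2)
  have hmem : (0 : ℝ) ∈ Set.Icc ((0 : ℝ) - (F * detRes γ n F 0).trace)
      (γ⁻¹ * F.trace - (F * detRes γ n F (γ⁻¹ * F.trace)).trace) := by
    constructor
    · have := trace_mul_nonneg hF (detRes_posSemidef hγ hn hF le_rfl)
      linarith
    · have := trace_mul_detRes_le hγ hn hF htr
      linarith
  obtain ⟨δ, hδ, h⟩ := intermediate_value_Icc htr hc hmem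
  exact ⟨δ, hδ.1, sub_eq_zero.1 h⟩

/-- The denominator of the deterministic equivalent is at least `1 / (1 + δ)`. -/
theorem trace_sandwich_le (hγ : 0 < γ) (hn : 0 ≤ n) (hF : F.PosSemidef) {δ : ℝ}
    (hδ : 0 ≤ δ) (hδe : δ = (F * detRes γ n F δ).trace) :
    (F * (detRes γ n F δ * ((n / (1 + δ)) • F) * detRes γ n F δ)).trace ≤ δ := by
  have hΨ : ((n / (1 + δ)) • F).PosSemidef := hF.smul (div_nonneg hn (by linarith))
  conv_rhs => rw [hδe]
  refine trace_mul_mono hF fun x => ?_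
  have h := regInv_sandwich_le hγ hΨ x
  rw [← Matrix.mulVec_mulVec, ← Matrix.mulVec_mulVec,
    dot_mulVec_comm (PSD.symm (detRes_posSemidef hγ hn hF hδ))]
  exact h

end FixedPoint
end RandomFeatures

namespace RandomFeatures

/-! ### Families of random variables with uniformly bounded moments -/

section Moments

variable {ι : Type*} {Ω Ω' : ι → Type*} [∀ i, MeasurableSpace (Ω i)] [∀ i, MeasurableSpace (Ω' i)]

/-- The moments of order `k` of the random variables `X i` are bounded uniformly in `i`. -/
def LpBdd (k : ℕ) (P : ∀ i, Measure (Ω i)) (X : ∀ i, Ω i → ℝ) : Prop :=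
  (∀ i, Measurable (X i)) ∧ ∃ C : ℝ≥0, ∀ i, ∫⁻ ω, ‖X i ω‖ₑ ^ k ∂(P i) ≤ C

/-- For every order, the moments of the random variables `X i` are bounded uniformly in `i`. -/
def MomentBdd (P : ∀ i, Measure (Ω i)) (X : ∀ i, Ω i → ℝ) : Prop := ∀ k, LpBdd k P X

variable {P : ∀ i, Measure (Ω i)} {P' : ∀ i, Measure (Ω' i)} {X Y Z : ∀ i, Ω i → ℝ} {k : ℕ}

theorem LpBdd.mono (h : LpBdd k P Y) (hX : ∀ i, Measurable (X i))
    (hXY : ∀ i ω, |X i ω| ≤ |Y i ω|) : LpBdd k P X := by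
  obtain ⟨-, C, hC⟩ := h
  refine ⟨hX, C, fun i => le_trans (lintegral_mono fun ω => ?_) (hC i)⟩
  exact pow_le_pow_left₀ (by simp) (by
    rw [Real.enorm_eq_ofReal_abs, Real.enorm_eq_ofReal_abs]
    exact ENNReal.ofReal_le_ofReal (hXY i ω)) k

theorem enorm_add_pow_le (a b : ℝ≥0∞) (k : ℕ) : (a + b) ^ k ≤ 2 ^ k * (a ^ k + b ^ k) := by
  rcases le_total a b with h | h
  · calc (a + b) ^ k ≤ (2 * b) ^ k := by rw [two_mul]; gcongr
      _ = 2 ^ k * b ^ k := mul_pow _ _ _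
      _ ≤ _ := by gcongr; exact le_add_self
  · calc (a + b) ^ k ≤ (2 * a) ^ k := by rw [two_mul]; gcongr
      _ = 2 ^ k * a ^ k := mul_pow _ _ _
      _ ≤ _ := by gcongr; exact le_self_add

theorem LpBdd.add (hX : LpBdd k P X) (hY : LpBdd k P Y) :
    LpBdd k P (fun i ω => X i ω + Y i ω) := by
  obtain ⟨hXm, C, hC⟩ := hX
  obtain ⟨hYm, D, hD⟩ := hY
  refine ⟨fun i => (hXm i).add (hYm i), 2 ^ k * (C + D), fun i => ?_⟩
  calc ∫⁻ ω, ‖X i ω + Y i ω‖ₑ ^ k ∂(P i)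
      ≤ ∫⁻ ω, 2 ^ k * (‖X i ω‖ₑ ^ k + ‖Y i ω‖ₑ ^ k) ∂(P i) := by
        refine lintegral_mono fun ω => le_trans ?_ (enorm_add_pow_le _ _ k)
        exact pow_le_pow_left₀ (by simp) (enorm_add_le _ _) k
    _ = 2 ^ k * (∫⁻ ω, ‖X i ω‖ₑ ^ k ∂(P i) + ∫⁻ ω, ‖Y i ω‖ₑ ^ k ∂(P i)) := by
        rw [lintegral_const_mul' _ _ (by simp), lintegral_add_left ((hXm i).enorm.pow_const k)]
    _ ≤ _ := by
        push_cast
        gcongr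
        · exact hC i
        · exact hD i

theorem enorm_mul_le_sq (a b : ℝ≥0∞) : a * b ≤ a ^ 2 + b ^ 2 := by
  rcases le_total a b with h | h
  · calc a * b ≤ b * b := by gcongr
      _ = b ^ 2 := (sq b).symm
      _ ≤ _ := le_add_self
  · calc a * b ≤ a * a := by gcongr
      _ = a ^ 2 := (sq a).symm
      _ ≤ _ := le_self_add

theorem LpBdd.mul (hX : LpBdd (k * 2) P X) (hY : LpBdd (k * 2) P Y) :
    LpBdd k P (fun i ω => X i ω * Y i ω) := by
  obtain ⟨hXm, C, hC⟩ := hX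
  obtain ⟨hYm, D, hD⟩ := hY
  refine ⟨fun i => (hXm i).mul (hYm i), C + D, fun i => ?_⟩
  calc ∫⁻ ω, ‖X i ω * Y i ω‖ₑ ^ k ∂(P i)
      ≤ ∫⁻ ω, (‖X i ω‖ₑ ^ (k * 2) + ‖Y i ω‖ₑ ^ (k * 2)) ∂(P i) := by
        refine lintegral_mono fun ω => ?_
        rw [enorm_mul, mul_pow, pow_mul, pow_mul]
        exact enorm_mul_le_sq _ _
    _ = ∫⁻ ω, ‖X i ω‖ₑ ^ (k * 2) ∂(P i) + ∫⁻ ω, ‖Y i ω‖ₑ ^ (k * 2) ∂(P i) :=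
        lintegral_add_left ((hXm i).enorm.pow_const _) _
    _ ≤ _ := by
        push_cast
        exact add_le_add (hC i) (hD i)

theorem LpBdd.of_bound [∀ i, IsProbabilityMeasure (P i)] (hX : ∀ i, Measurable (X i)) (c : ℝ)
    (h : ∀ i ω, |X i ω| ≤ c) : LpBdd k P X := by
  refine ⟨hX, c.toNNReal ^ k, fun i => ?_⟩
  calc ∫⁻ ω, ‖X i ω‖ₑ ^ k ∂(P i) ≤ ∫⁻ _, (c.toNNReal : ℝ≥0∞) ^ k ∂(P i) := by
        refine lintegral_mono fun ω => pow_le_pow_left₀ (by simp) ?_ k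
        rw [Real.enorm_eq_ofReal_abs]
        exact ENNReal.ofReal_le_ofReal (h i ω)
    _ = _ := by simp

theorem LpBdd.integrable (hX : LpBdd 1 P X) (i : ι) : Integrable (X i) (P i) := by
  obtain ⟨hXm, C, hC⟩ := hX
  refine ⟨(hXm i).aestronglyMeasurable, ?_⟩
  have := hC i
  simp only [pow_one] at this
  exact this.trans_lt ENNReal.coe_lt_top

theorem LpBdd.abs_integral_le (hX : LpBdd 1 P X) :
    ∃ C : ℝ, 0 ≤ C ∧ ∀ i, |∫ ω, X i ω ∂(P i)| ≤ C := by
  obtain ⟨hXm, C, hC⟩ := hX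
  refine ⟨C, C.2, fun i => ?_⟩
  have h := (enorm_integral_le_lintegral_enorm (μ := P i) (X i)).trans (by simpa using hC i)
  rw [enorm_eq_nnnorm] at h
  exact_mod_cast h

theorem MomentBdd.mono (h : MomentBdd P Y) (hX : ∀ i, Measurable (X i))
    (hXY : ∀ i ω, |X i ω| ≤ |Y i ω|) : MomentBdd P X := fun k => (h k).mono hX hXY

theorem MomentBdd.add (hX : MomentBdd P X) (hY : MomentBdd P Y) :
    MomentBdd P (fun i ω => X i ω + Y i ω) := fun k => (hX k).add (hY k)

theorem MomentBdd.mul (hX : MomentBdd P X) (hY : MomentBdd P Y) :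
    MomentBdd P (fun i ω => X i ω * Y i ω) := fun _ => (hX _).mul (hY _)

theorem MomentBdd.of_bound [∀ i, IsProbabilityMeasure (P i)] (hX : ∀ i, Measurable (X i)) (c : ℝ)
    (h : ∀ i ω, |X i ω| ≤ c) : MomentBdd P X :=
  fun k => LpBdd.of_bound (k := k) hX c h

theorem MomentBdd.const [∀ i, IsProbabilityMeasure (P i)] (c : ℝ) :
    MomentBdd P (fun _ _ => c) := MomentBdd.of_bound (fun _ => measurable_const) |c| (by simp)

theorem MomentBdd.const_mul [∀ i, IsProbabilityMeasure (P i)] (hX : MomentBdd P X) (c : ℝ) :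
    MomentBdd P (fun i ω => c * X i ω) := (MomentBdd.const c).mul hX

theorem MomentBdd.pow [∀ i, IsProbabilityMeasure (P i)] (hX : MomentBdd P X) (j : ℕ) :
    MomentBdd P (fun i ω => X i ω ^ j) := by
  induction j with
  | zero => simpa using MomentBdd.const 1
  | succ j ih => simpa only [pow_succ] using ih.mul hX

theorem MomentBdd.mul_lpBdd_two (hX : MomentBdd P X) (hZ : LpBdd 2 P Z) :
    LpBdd 1 P (fun i ω => X i ω * Z i ω) := LpBdd.mul (k := 1) (hX 2) hZ

theorem LpBdd.comp_fst [∀ i, SFinite (P i)] [∀ i, IsProbabilityMeasure (P' i)] (hX : LpBdd k P X) :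
    LpBdd k (fun i => (P i).prod (P' i)) (fun i (ω : Ω i × Ω' i) => X i ω.1) := by
  obtain ⟨hXm, C, hC⟩ := hX
  refine ⟨fun i => (hXm i).comp measurable_fst, C, fun i => ?_⟩
  rw [(measurePreserving_fst (μ := P i) (ν := P' i)).lintegral_comp ((hXm i).enorm.pow_const k)]
  exact hC i

theorem LpBdd.comp_snd [∀ i, IsProbabilityMeasure (P' i)] [∀ i, SFinite (P i)] (hX : LpBdd k P X) :
    LpBdd k (fun i => (P' i).prod (P i)) (fun i (ω : Ω' i × Ω i) => X i ω.2) := by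
  obtain ⟨hXm, C, hC⟩ := hX
  refine ⟨fun i => (hXm i).comp measurable_snd, C, fun i => ?_⟩
  rw [(measurePreserving_snd (μ := P' i) (ν := P i)).lintegral_comp ((hXm i).enorm.pow_const k)]
  exact hC i

theorem MomentBdd.comp_fst [∀ i, SFinite (P i)] [∀ i, IsProbabilityMeasure (P' i)]
    (hX : MomentBdd P X) :
    MomentBdd (fun i => (P i).prod (P' i)) (fun i (ω : Ω i × Ω' i) => X i ω.1) :=
  fun k => (hX k).comp_fst

theorem MomentBdd.comp_snd [∀ i, IsProbabilityMeasure (P' i)] [∀ i, SFinite (P i)]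
    (hX : MomentBdd P X) :
    MomentBdd (fun i => (P' i).prod (P i)) (fun i (ω : Ω' i × Ω i) => X i ω.2) :=
  fun k => (hX k).comp_snd

/-- A function of two independent variables has bounded moments as soon as its conditional moments
given the second variable are controlled by a variable with bounded moments. -/
theorem MomentBdd.of_conditional [∀ i, SFinite (P' i)] [∀ i, SFinite (P i)]
    {X : ∀ i, Ω' i × Ω i → ℝ} {H : ∀ i, Ω i → ℝ} (hX : ∀ i, Measurable (X i))
    (hH : MomentBdd P H)
    (h : ∀ k : ℕ, ∃ C : ℝ≥0, ∀ i ω, ∫⁻ ω', ‖X i (ω', ω)‖ₑ ^ k ∂(P' i) ≤ C * ‖H i ω‖ₑ ^ k) :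
    MomentBdd (fun i => (P' i).prod (P i)) X := by
  intro k
  obtain ⟨C, hC⟩ := h k
  obtain ⟨-, D, hD⟩ := hH k
  refine ⟨hX, C * D, fun i => ?_⟩
  rw [lintegral_prod_symm _ ((hX i).enorm.pow_const k).aemeasurable]
  calc ∫⁻ ω, ∫⁻ ω', ‖X i (ω', ω)‖ₑ ^ k ∂(P' i) ∂(P i) ≤ ∫⁻ ω, C * ‖H i ω‖ₑ ^ k ∂(P i) :=
        lintegral_mono fun ω => hC i ω
    _ = C * ∫⁻ ω, ‖H i ω‖ₑ ^ k ∂(P i) := lintegral_const_mul' _ _ (by simp)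
    _ ≤ _ := by push_cast; gcongr; exact hD i

end Moments

/-! ### The Efron–Stein inequality -/

section EfronStein

theorem integrable_of_abs_le {Ω : Type*} [MeasurableSpace Ω] {μ : Measure Ω} [IsFiniteMeasure μ]
    {f : Ω → ℝ} (hf : Measurable f) (M : ℝ) (h : ∀ x, |f x| ≤ M) : Integrable f μ :=
  Integrable.of_bound hf.aestronglyMeasurable M (Eventually.of_forall h)

theorem integral_sub_const_sq {Ω : Type*} [MeasurableSpace Ω] {μ : Measure Ω}
    [IsProbabilityMeasure μ] {f : Ω → ℝ} (hf : Measurable f) (M : ℝ) (h : ∀ x, |f x| ≤ M) (c : ℝ) :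
    ∫ x, (f x - c) ^ 2 ∂μ = ∫ x, (f x - ∫ y, f y ∂μ) ^ 2 ∂μ + (∫ y, f y ∂μ - c) ^ 2 := by
  have h1 : Integrable f μ := integrable_of_abs_le hf M h
  have h2 : Integrable (fun x => f x ^ 2) μ := by
    refine integrable_of_abs_le (hf.pow_const 2) (M ^ 2) fun x => ?_
    rw [abs_pow]
    exact pow_le_pow_left₀ (abs_nonneg _) (h x) 2
  have h3 : ∀ c : ℝ, ∫ x, (f x - c) ^ 2 ∂μ = ∫ x, f x ^ 2 ∂μ - 2 * c * ∫ x, f x ∂μ + c ^ 2 := by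
    intro c
    have e : ∀ x, (f x - c) ^ 2 = f x ^ 2 - 2 * c * f x + c ^ 2 := fun x => by ring
    simp_rw [e]
    rw [integral_add (f := fun x => f x ^ 2 - 2 * c * f x) (h2.sub (h1.const_mul _))
      (integrable_const _),
      integral_sub h2 (h1.const_mul _), integral_const_mul]
    simp
  rw [h3, h3]
  ring

theorem sq_integral_sub_le {Ω : Type*} [MeasurableSpace Ω] {μ : Measure Ω}
    [IsProbabilityMeasure μ] {f : Ω → ℝ} (hf : Measurable f) (M : ℝ) (h : ∀ x, |f x| ≤ M) (c : ℝ) :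
    (∫ y, f y ∂μ - c) ^ 2 ≤ ∫ x, (f x - c) ^ 2 ∂μ := by
  rw [integral_sub_const_sq hf M h c]
  have : 0 ≤ ∫ x, (f x - ∫ y, f y ∂μ) ^ 2 ∂μ := integral_nonneg fun x => sq_nonneg _
  linarith

variable {V : Type} [MeasurableSpace V] (ν : Measure V) [IsProbabilityMeasure ν]

theorem integral_pi_insertNth {n : ℕ} (i : Fin (n + 1)) {f : (Fin (n + 1) → V) → ℝ} :
    ∫ z, f z ∂(Measure.pi fun _ : Fin (n + 1) => ν) =
      ∫ q, f (i.insertNth (α := fun _ => V) q.1 q.2)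
        ∂(ν.prod (Measure.pi fun _ : Fin n => ν)) := by
  have h := (measurePreserving_piFinSuccAbove (fun _ : Fin (n + 1) => ν) i).symm
  rw [← h.integral_comp' f]
  rfl

theorem measurable_insertNth {n : ℕ} (i : Fin (n + 1)) :
    Measurable fun q : V × (Fin n → V) => (i.insertNth (α := fun _ => V) q.1 q.2) :=
  (MeasurableEquiv.piFinSuccAbove (fun _ => V) i).symm.measurable

/-- The Efron–Stein inequality for a bounded function of independent variables. -/
theorem efronStein {n : ℕ} (f : (Fin n → V) → ℝ) (hf : Measurable f) (M : ℝ) (hfM : ∀ z, |f z| ≤ M)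
    (g : Fin n → (Fin n → V) → ℝ) (hg : ∀ i, Measurable (g i)) (hgM : ∀ i z, |g i z| ≤ M)
    (hgi : ∀ i z x, g i (Function.update z i x) = g i z) :
    ∫ z, (f z - ∫ w, f w ∂(Measure.pi fun _ => ν)) ^ 2 ∂(Measure.pi fun _ => ν) ≤
      ∑ i, ∫ z, (f z - g i z) ^ 2 ∂(Measure.pi fun _ => ν) := by
  induction n with
  | zero =>
    rw [Measure.pi_of_empty (fun _ : Fin 0 => ν)]
    simp
  | succ n ih =>
    set μ := Measure.pi fun _ : Fin n => ν with hμ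
    have hcons := measurable_insertNth (V := V) (0 : Fin (n + 1))
    have hbd : ∀ a b : ℝ, |a| ≤ M → |b| ≤ M → |(a - b) ^ 2| ≤ (M + M) ^ 2 := by
      intro a b ha hb
      rw [abs_pow]
      exact pow_le_pow_left₀ (abs_nonneg _) ((abs_sub _ _).trans (add_le_add ha hb)) 2
    -- iterated integrals of bounded functions
    have hiter : ∀ h : (Fin (n + 1) → V) → ℝ, Measurable h → ∀ B, (∀ z, |h z| ≤ B) →
        ∫ z, h z ∂(Measure.pi fun _ => ν) =
          ∫ x, ∫ y, h ((0 : Fin (n + 1)).insertNth (α := fun _ => V) x y) ∂μ ∂ν := by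
      intro h hh B hB
      rw [integral_pi_insertNth ν 0, integral_prod]
      exact integrable_of_abs_le (hh.comp hcons) B fun q => hB _
    have hsec : ∀ h : (Fin (n + 1) → V) → ℝ, Measurable h → ∀ x,
        Measurable fun y : Fin n → V => h ((0 : Fin (n + 1)).insertNth (α := fun _ => V) x y) :=
      fun h hh x => hh.comp (hcons.comp measurable_prodMk_left)
    have hmarg : ∀ h : (Fin (n + 1) → V) → ℝ, Measurable h →
        Measurable fun x => ∫ y, h ((0 : Fin (n + 1)).insertNth (α := fun _ => V) x y) ∂μ := by
      intro h hh
      exact ((hh.comp hcons).stronglyMeasurable.integral_prod_right').measurable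
    have hmargM : ∀ h : (Fin (n + 1) → V) → ℝ, ∀ B, (∀ z, |h z| ≤ B) → ∀ x,
        |∫ y, h ((0 : Fin (n + 1)).insertNth (α := fun _ => V) x y) ∂μ| ≤ B := by
      intro h B hB x
      have := norm_integral_le_of_norm_le_const (μ := μ) (C := B)
        (f := fun y => h ((0 : Fin (n + 1)).insertNth (α := fun _ => V) x y))
        (Eventually.of_forall fun y => hB _)
      simpa using this
    set c := ∫ w, f w ∂(Measure.pi fun _ : Fin (n + 1) => ν) with hc
    set F : V → ℝ := fun x => ∫ y, f ((0 : Fin (n + 1)).insertNth (α := fun _ => V) x y) ∂μ with hF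
    have hcF : c = ∫ x, F x ∂ν := hiter f hf M hfM
    have hcM : |c| ≤ M := by
      have := norm_integral_le_of_norm_le_const (μ := ν) (C := M) (f := F)
        (Eventually.of_forall fun x => hmargM f M hfM x)
      rw [hcF]; simpa using this
    obtain ⟨x₀⟩ : Nonempty V := nonempty_of_isProbabilityMeasure ν
    set c₀ := ∫ y, g 0 ((0 : Fin (n + 1)).insertNth (α := fun _ => V) x₀ y) ∂μ with hc₀
    have hc₀x : ∀ x, c₀ = ∫ y, g 0 ((0 : Fin (n + 1)).insertNth (α := fun _ => V) x y) ∂μ := by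
      intro x
      refine integral_congr_ae (Eventually.of_forall fun y => ?_)
      have := hgi 0 ((0 : Fin (n + 1)).insertNth (α := fun _ => V) x y) x₀
      rw [Fin.insertNth_zero', Fin.update_cons_zero] at this
      simp only [Fin.insertNth_zero']
      exact this
    have hmeas2 : ∀ i, Measurable fun z => (f z - g i z) ^ 2 := fun i => (hf.sub (hg i)).pow_const 2
    have hA : ∫ x, (F x - c) ^ 2 ∂ν ≤ ∫ z, (f z - g 0 z) ^ 2 ∂(Measure.pi fun _ => ν) := by
      have h1 : ∫ x, (F x - c) ^ 2 ∂ν ≤ ∫ x, (F x - c₀) ^ 2 ∂ν := by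
        rw [integral_sub_const_sq (hmarg f hf) M (hmargM f M hfM) c₀, ← hcF]
        linarith [sq_nonneg (c - c₀)]
      refine h1.trans ?_
      rw [hiter _ (hmeas2 0) ((M + M) ^ 2) fun z => hbd _ _ (hfM z) (hgM 0 z)]
      have hc₀M : |c₀| ≤ M := hmargM _ M (hgM 0) x₀
      refine integral_mono ?_ ?_ fun x => ?_
      · exact integrable_of_abs_le (((hmarg f hf).sub_const _).pow_const 2) ((M + M) ^ 2)
          fun x => hbd _ _ (hmargM f M hfM x) hc₀M
      · exact integrable_of_abs_le (hmarg _ (hmeas2 0)) ((M + M) ^ 2)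
          (hmargM _ _ fun z => hbd _ _ (hfM z) (hgM 0 z))
      · have e : F x - c₀ = ∫ y, (f ((0 : Fin (n + 1)).insertNth (α := fun _ => V) x y) -
            g 0 ((0 : Fin (n + 1)).insertNth (α := fun _ => V) x y)) ∂μ - 0 := by
          rw [hc₀x x, sub_zero, integral_sub]
          · exact integrable_of_abs_le (hsec f hf x) M fun y => hfM _
          · exact integrable_of_abs_le (hsec _ (hg 0) x) M fun y => hgM 0 _
        have h2 := sq_integral_sub_le (μ := μ) ((hsec f hf x).sub (hsec _ (hg 0) x)) (M + M)
          (fun y => (abs_sub _ _).trans (add_le_add (hfM _) (hgM 0 _))) 0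
        simp only [e]
        simpa using h2
    have hB : ∀ i : Fin n, ∫ z, (f z - g i.succ z) ^ 2 ∂(Measure.pi fun _ => ν) =
        ∫ x, ∫ y, (f ((0 : Fin (n + 1)).insertNth (α := fun _ => V) x y) -
          g i.succ ((0 : Fin (n + 1)).insertNth (α := fun _ => V) x y)) ^ 2 ∂μ ∂ν := fun i =>
      hiter _ (hmeas2 _) ((M + M) ^ 2) fun z => hbd _ _ (hfM z) (hgM _ z)
    have hfc : Measurable fun z => (f z - c) ^ 2 := (hf.sub_const c).pow_const 2
    have hvx : ∀ x, ∫ y, (f ((0 : Fin (n + 1)).insertNth (α := fun _ => V) x y) - F x) ^ 2 ∂μ ≤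
        ∑ i : Fin n, ∫ y, (f ((0 : Fin (n + 1)).insertNth (α := fun _ => V) x y) -
          g i.succ ((0 : Fin (n + 1)).insertNth (α := fun _ => V) x y)) ^ 2 ∂μ := by
      intro x
      refine ih (fun y => f ((0 : Fin (n + 1)).insertNth (α := fun _ => V) x y)) (hsec f hf x)
        (fun y => hfM _) (fun i y => g i.succ ((0 : Fin (n + 1)).insertNth (α := fun _ => V) x y))
        (fun i => hsec _ (hg _) x) (fun i y => hgM _ _) fun i y w => ?_
      have := hgi i.succ ((0 : Fin (n + 1)).insertNth (α := fun _ => V) x y) w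
      simp only [Fin.insertNth_zero'] at this ⊢
      rw [← this, Fin.cons_update]
    have hsum_int : ∀ i : Fin n, Integrable (fun x =>
        ∫ y, (f ((0 : Fin (n + 1)).insertNth (α := fun _ => V) x y) -
          g i.succ ((0 : Fin (n + 1)).insertNth (α := fun _ => V) x y)) ^ 2 ∂μ) ν := fun i =>
      integrable_of_abs_le (hmarg _ (hmeas2 i.succ)) ((M + M) ^ 2)
        (hmargM _ _ fun z => hbd _ _ (hfM z) (hgM _ z))
    rw [hiter _ hfc ((M + M) ^ 2) fun z => hbd _ _ (hfM z) hcM, Fin.sum_univ_succ]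
    simp_rw [hB]
    rw [← integral_finsetSum _ fun i _ => hsum_int i]
    have hFi : Integrable (fun x => (F x - c) ^ 2) ν :=
      integrable_of_abs_le (((hmarg f hf).sub_const _).pow_const 2) ((M + M) ^ 2)
        fun x => hbd _ _ (hmargM f M hfM x) hcM
    calc ∫ x, ∫ y, (f ((0 : Fin (n + 1)).insertNth (α := fun _ => V) x y) - c) ^ 2 ∂μ ∂ν
        ≤ ∫ x, ((F x - c) ^ 2 + ∑ i : Fin n,
          ∫ y, (f ((0 : Fin (n + 1)).insertNth (α := fun _ => V) x y) -
            g i.succ ((0 : Fin (n + 1)).insertNth (α := fun _ => V) x y)) ^ 2 ∂μ) ∂ν := by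
          refine integral_mono ?_ (hFi.add (integrable_finsetSum _ fun i _ => hsum_int i))
            fun x => ?_
          · exact integrable_of_abs_le (hmarg _ hfc) ((M + M) ^ 2)
              (hmargM _ _ fun z => hbd _ _ (hfM z) hcM)
          · simp only
            rw [integral_sub_const_sq (hsec f hf x) M (fun y => hfM _) c, add_comm]
            exact add_le_add le_rfl (hvx x)
      _ = ∫ x, (F x - c) ^ 2 ∂ν + ∫ x, ∑ i : Fin n,
          ∫ y, (f ((0 : Fin (n + 1)).insertNth (α := fun _ => V) x y) -
            g i.succ ((0 : Fin (n + 1)).insertNth (α := fun _ => V) x y)) ^ 2 ∂μ ∂ν :=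
          integral_add hFi (integrable_finsetSum _ fun i _ => hsum_int i)
      _ ≤ _ := add_le_add hA le_rfl

/-- The Efron–Stein inequality for an exchangeable function, compared with a function of one
variable less. -/
theorem efronStein_exchangeable {n : ℕ} (f : (Fin (n + 1) → V) → ℝ) (hf : Measurable f)
    (f' : (Fin n → V) → ℝ) (hf' : Measurable f') (M : ℝ) (hfM : ∀ z, |f z| ≤ M)
    (hfM' : ∀ z, |f' z| ≤ M) (h : V × (Fin n → V) → ℝ)
    (hfh : ∀ (i : Fin (n + 1)) q, f (i.insertNth (α := fun _ => V) q.1 q.2) = h q) :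
    ∫ z, (f z - ∫ w, f w ∂(Measure.pi fun _ => ν)) ^ 2 ∂(Measure.pi fun _ => ν) ≤
      (n + 1) * ∫ q, (h q - f' q.2) ^ 2 ∂(ν.prod (Measure.pi fun _ => ν)) := by
  have hrm : ∀ i : Fin (n + 1), Measurable fun z : Fin (n + 1) → V =>
      i.removeNth (α := fun _ => V) z := fun i =>
    measurable_pi_lambda _ fun j => measurable_pi_apply _
  refine (efronStein ν f hf M hfM (fun i z => f' (i.removeNth (α := fun _ => V) z))
    (fun i => hf'.comp (hrm i)) (fun i z => hfM' _) fun i z x => ?_).trans (le_of_eq ?_)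
  · congr 1
    exact Fin.removeNth_update _ _ _
  · have e : ∀ i : Fin (n + 1), ∫ z, (f z - f' (i.removeNth (α := fun _ => V) z)) ^ 2
        ∂(Measure.pi fun _ => ν) =
        ∫ q, (h q - f' q.2) ^ 2 ∂(ν.prod (Measure.pi fun _ => ν)) := by
      intro i
      rw [integral_pi_insertNth ν i]
      refine integral_congr_ae (Eventually.of_forall fun q => ?_)
      simp only [hfh, Fin.removeNth_insertNth]
    simp_rw [e]
    simp

end EfronStein
end RandomFeatures

namespace RandomFeatures

/-! ### Sample covariance resolvents -/

section Gram

variable {τ : Type*}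

/-- The Gram-type matrix `∑ i, yᵢ yᵢᵀ` of a finite family of vectors. -/
def gram {n : ℕ} (Y : Fin n → τ → ℝ) : Matrix τ τ ℝ := ∑ i, Matrix.vecMulVec (Y i) (Y i)

theorem gram_insertNth {n : ℕ} (i : Fin (n + 1)) (y : τ → ℝ) (Y : Fin n → τ → ℝ) :
    gram (i.insertNth (α := fun _ => τ → ℝ) y Y) = Matrix.vecMulVec y y + gram Y := by
  simp [gram, Fin.sum_univ_succAbove _ i]

variable [Fintype τ]

theorem gram_posSemidef {n : ℕ} (Y : Fin n → τ → ℝ) : (gram Y).PosSemidef :=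
  Matrix.posSemidef_sum _ fun i _ => vecMulVec_posSemidef (Y i)

theorem dot_gram_mulVec {n : ℕ} (Y : Fin n → τ → ℝ) (x z : τ → ℝ) :
    x ⬝ᵥ gram Y *ᵥ z = ∑ i, (x ⬝ᵥ Y i) * (Y i ⬝ᵥ z) := by
  rw [gram, Matrix.sum_mulVec, dotProduct_sum]
  exact Finset.sum_congr rfl fun i _ => dot_vecMulVec_mulVec _ _ _

/-- The empirical mean of a family of vectors. -/
noncomputable def empMean {n : ℕ} (Y : Fin n → τ → ℝ) : τ → ℝ := (n : ℝ)⁻¹ • ∑ i, Y i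

/-- `1 + n |ȳ - m|²`, where `ȳ` is the empirical mean: the random factor in the bounds on the
resolvent in the direction `m`. -/
noncomputable def meanDev {n : ℕ} (m : τ → ℝ) (Y : Fin n → τ → ℝ) : ℝ :=
  1 + n * ((empMean Y - m) ⬝ᵥ (empMean Y - m))

theorem one_le_meanDev {n : ℕ} (m : τ → ℝ) (Y : Fin n → τ → ℝ) : 1 ≤ meanDev m Y := by
  have := dot_self_nonneg (empMean Y - m)
  unfold meanDev
  nlinarith [mul_nonneg (Nat.cast_nonneg n : (0 : ℝ) ≤ n) this]

theorem sandwich_posSemidef {Q A : Matrix τ τ ℝ} (hQ : Q.PosSemidef) (hA : A.PosSemidef) :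
    (Q * A * Q).PosSemidef := by
  have h := hA.conjTranspose_mul_mul_same Q
  rwa [Matrix.conjTranspose_eq_transpose_of_trivial, PSD.symm hQ] at h

theorem dot_sandwich {Q : Matrix τ τ ℝ} (hQ : Qᵀ = Q) (A : Matrix τ τ ℝ) (x y : τ → ℝ) :
    x ⬝ᵥ (Q * A * Q) *ᵥ y = (Q *ᵥ x) ⬝ᵥ A *ᵥ (Q *ᵥ y) := by
  rw [← Matrix.mulVec_mulVec, ← Matrix.mulVec_mulVec, dot_mulVec_comm hQ]

variable [DecidableEq τ] {γ : ℝ}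

/-- Since `∑ yᵢ yᵢᵀ ≥ n ȳ ȳᵀ`, the form of the resolvent at the empirical mean is at most `1 / n`. -/
theorem empMean_quad_le (hγ : 0 < γ) {n : ℕ} (hn : 1 ≤ n) (Y : Fin n → τ → ℝ) :
    n * (empMean Y ⬝ᵥ regInv γ (gram Y) *ᵥ empMean Y) ≤ 1 := by
  have hn0 : (0 : ℝ) < n := by exact_mod_cast hn
  have h1 := regInv_quad hγ (gram_posSemidef Y) (empMean Y)
  set z := regInv γ (gram Y) *ᵥ empMean Y with hz
  set t := empMean Y ⬝ᵥ z with ht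
  have h2 : z ⬝ᵥ gram Y *ᵥ z = ∑ i, (Y i ⬝ᵥ z) ^ 2 := by
    rw [dot_gram_mulVec]
    refine Finset.sum_congr rfl fun i _ => ?_
    rw [dotProduct_comm z, sq]
  have h3 : n * t = ∑ i, Y i ⬝ᵥ z := by
    rw [ht, empMean, smul_dotProduct, smul_eq_mul, ← mul_assoc, mul_inv_cancel₀ hn0.ne', one_mul,
      sum_dotProduct]
  have h4 : (∑ i, Y i ⬝ᵥ z) ^ 2 ≤ n * ∑ i, (Y i ⬝ᵥ z) ^ 2 := by
    simpa using sq_sum_le_card_mul_sum_sq (s := Finset.univ) (f := fun i => Y i ⬝ᵥ z)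
  have h5 := mul_nonneg hγ.le (dot_self_nonneg z)
  rw [← h3, ← h2] at h4
  by_contra hlt
  push Not at hlt
  have h6 : z ⬝ᵥ gram Y *ᵥ z ≤ t := by linarith
  nlinarith [mul_le_mul_of_nonneg_left h6 hn0.le]

/-- The form of the resolvent at the mean `m` is `O(1 / n)`, since `m` is close to the empirical mean:
the rank-one part `n m mᵀ` of the second moments is harmless between two resolvents. -/
theorem mean_quad_le (hγ : 0 < γ) {n : ℕ} (hn : 1 ≤ n) (m : τ → ℝ) (Y : Fin n → τ → ℝ) :
    n * (m ⬝ᵥ regInv γ (gram Y) *ᵥ m) ≤ (2 + 2 * γ⁻¹) * meanDev m Y := by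
  have hn0 : (0 : ℝ) < n := by exact_mod_cast hn
  have hγ' : 0 < γ⁻¹ := by positivity
  have h1 := empMean_quad_le hγ hn Y
  have h2 := regInv_quad_le hγ (gram_posSemidef Y) (m - empMean Y)
  have h3 := PSD.add_quad_le (regInv_posSemidef hγ (gram_posSemidef Y)) (empMean Y) (m - empMean Y)
  rw [add_sub_cancel] at h3
  have e : (m - empMean Y) ⬝ᵥ (m - empMean Y) = (empMean Y - m) ⬝ᵥ (empMean Y - m) := by
    rw [← neg_sub (empMean Y) m, neg_dotProduct_neg]
  rw [e] at h2
  have h4 := dot_self_nonneg (empMean Y - m)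
  unfold meanDev
  nlinarith [mul_le_mul_of_nonneg_left h3 hn0.le, mul_le_mul_of_nonneg_left h2 hn0.le,
    mul_nonneg hn0.le h4]

/-- Positive semidefinite matrices `A ≤ K (1 + n m mᵀ)`. This class contains the bounded matrices,
and also the second moment matrix `Φ`, whose norm may be of order `n` in the direction `m`. -/
structure SpikeBdd (K : ℝ) (n : ℕ) (m : τ → ℝ) (A : Matrix τ τ ℝ) : Prop where
  psd : A.PosSemidef
  le : ∀ x : τ → ℝ, x ⬝ᵥ A *ᵥ x ≤ K * (x ⬝ᵥ x + n * (m ⬝ᵥ x) ^ 2)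

/-- A constant for the deterministic bounds in `SpikeBdd.bounds`. -/
noncomputable def spikeConst (γ K : ℝ) : ℝ :=
  let M := 2 + 2 * γ⁻¹
  let B := K * ((γ⁻¹) ^ 2 + M * γ⁻¹)
  M * γ⁻¹ + B + K * (M * γ⁻¹ + M ^ 2) * B

/-- Deterministic bounds for a sample resolvent `Q` and a matrix `A ≤ K (1 + n m mᵀ)`: although `A`
may be large in the direction `m`, the matrix `Q A Q` is bounded, and `Q` and `Q A Q` are of order
`n ^ (-1/2)` in the direction `m`, up to powers of `1 + n |ȳ - m|²`. -/
theorem SpikeBdd.bounds (hγ : 0 < γ) {K : ℝ} (hK : 0 ≤ K) {n : ℕ} (hn : 1 ≤ n) {m : τ → ℝ}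
    {A : Matrix τ τ ℝ} (hA : SpikeBdd K n m A) (Y : Fin n → τ → ℝ) (x : τ → ℝ) :
    n * (m ⬝ᵥ regInv γ (gram Y) *ᵥ x) ^ 2 ≤ spikeConst γ K * meanDev m Y ^ 3 * (x ⬝ᵥ x) ∧
    x ⬝ᵥ (regInv γ (gram Y) * A * regInv γ (gram Y)) *ᵥ x ≤
      spikeConst γ K * meanDev m Y ^ 3 * (x ⬝ᵥ x) ∧
    n * (m ⬝ᵥ (regInv γ (gram Y) * A * regInv γ (gram Y)) *ᵥ x) ^ 2 ≤
      spikeConst γ K * meanDev m Y ^ 3 * (x ⬝ᵥ x) := by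
  have hn0 : (0 : ℝ) < n := by exact_mod_cast hn
  have hg : 0 < γ⁻¹ := by positivity
  have hQ := regInv_posSemidef hγ (gram_posSemidef Y)
  have hκ := one_le_meanDev m Y
  have hmq := mean_quad_le hγ hn m Y
  set Q := regInv γ (gram Y) with hQd
  set κ := meanDev m Y
  set M := 2 + 2 * γ⁻¹ with hM
  have hM0 : 0 < M := by positivity
  set B := K * ((γ⁻¹) ^ 2 + M * γ⁻¹) with hB
  have hB0 : 0 ≤ B := by positivity
  have hC : spikeConst γ K = M * γ⁻¹ + B + K * (M * γ⁻¹ + M ^ 2) * B := rfl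
  have hκ2 : 1 ≤ κ ^ 2 := one_le_pow₀ hκ
  have hκ3 : κ ≤ κ ^ 3 := by nlinarith
  -- bound for the mean direction, for an arbitrary vector
  have h1 : ∀ z : τ → ℝ, n * (m ⬝ᵥ Q *ᵥ z) ^ 2 ≤ M * γ⁻¹ * κ * (z ⬝ᵥ z) := by
    intro z
    have e1 := PSD.cauchy hQ m z
    have e2 := regInv_quad_le hγ (gram_posSemidef Y) z
    have e3 := PSD.nonneg hQ z
    calc n * (m ⬝ᵥ Q *ᵥ z) ^ 2 ≤ n * ((m ⬝ᵥ Q *ᵥ m) * (z ⬝ᵥ Q *ᵥ z)) := by gcongr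
      _ = (n * (m ⬝ᵥ Q *ᵥ m)) * (z ⬝ᵥ Q *ᵥ z) := by ring
      _ ≤ (M * κ) * (γ⁻¹ * (z ⬝ᵥ z)) := by
        apply mul_le_mul hmq e2 e3; positivity
      _ = _ := by ring
  have h2 : ∀ z : τ → ℝ, z ⬝ᵥ (Q * A * Q) *ᵥ z ≤ B * κ * (z ⬝ᵥ z) := by
    intro z
    have e1 := hA.le (Q *ᵥ z)
    have e2 := regInv_norm_le' hγ (gram_posSemidef Y) z
    have hz := dot_self_nonneg z
    rw [dot_sandwich (PSD.symm hQ)]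
    calc _ ≤ K * ((γ⁻¹) ^ 2 * (z ⬝ᵥ z) + M * γ⁻¹ * κ * (z ⬝ᵥ z)) :=
          e1.trans (mul_le_mul_of_nonneg_left (add_le_add e2 (h1 z)) hK)
      _ ≤ K * ((γ⁻¹) ^ 2 * κ * (z ⬝ᵥ z) + M * γ⁻¹ * κ * (z ⬝ᵥ z)) := by
          gcongr
          nlinarith [sq_nonneg (γ⁻¹)]
      _ = _ := by rw [hB]; ring
  have h3 : n * (m ⬝ᵥ (Q * A * Q) *ᵥ m) ≤ K * (M * γ⁻¹ + M ^ 2) * κ ^ 2 := by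
    have e1 := hA.le (Q *ᵥ m)
    have e2 := regInv_quad_ge hγ (gram_posSemidef Y) m
    have e3 := PSD.nonneg hQ m
    rw [dot_sandwich (PSD.symm hQ)]
    have e4 : n * ((Q *ᵥ m) ⬝ᵥ (Q *ᵥ m)) ≤ M * γ⁻¹ * κ := by
      have : (Q *ᵥ m) ⬝ᵥ (Q *ᵥ m) ≤ γ⁻¹ * (m ⬝ᵥ Q *ᵥ m) := by
        rw [inv_mul_eq_div, le_div_iff₀ hγ]; linarith
      nlinarith [mul_le_mul_of_nonneg_left this hn0.le]
    have e5 : (n * (m ⬝ᵥ Q *ᵥ m)) ^ 2 ≤ (M * κ) ^ 2 :=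
      pow_le_pow_left₀ (by positivity) hmq 2
    calc _ ≤ n * (K * ((Q *ᵥ m) ⬝ᵥ (Q *ᵥ m) + n * (m ⬝ᵥ Q *ᵥ m) ^ 2)) := by gcongr
      _ = K * (n * ((Q *ᵥ m) ⬝ᵥ (Q *ᵥ m)) + (n * (m ⬝ᵥ Q *ᵥ m)) ^ 2) := by ring
      _ ≤ K * (M * γ⁻¹ * κ ^ 2 + (M * κ) ^ 2) := by
          refine mul_le_mul_of_nonneg_left (add_le_add (e4.trans ?_) e5) hK
          have : κ ≤ κ ^ 2 := by nlinarith
          gcongr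
      _ = _ := by ring
  have hz := dot_self_nonneg x
  have hMg : 0 ≤ M * γ⁻¹ := by positivity
  have hKM : 0 ≤ K * (M * γ⁻¹ + M ^ 2) := by positivity
  have hCa : M * γ⁻¹ ≤ spikeConst γ K := by
    rw [hC]; nlinarith [mul_nonneg hKM hB0]
  have hCb : B ≤ spikeConst γ K := by
    rw [hC]; nlinarith [mul_nonneg hKM hB0]
  have hCc : K * (M * γ⁻¹ + M ^ 2) * B ≤ spikeConst γ K := by
    rw [hC]; nlinarith
  have hC0 : 0 ≤ spikeConst γ K := hB0.trans hCb
  refine ⟨?_, ?_, ?_⟩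
  · refine (h1 x).trans ?_
    gcongr
  · refine (h2 x).trans ?_
    gcongr
  · have hQA := sandwich_posSemidef hQ hA.psd
    calc n * (m ⬝ᵥ (Q * A * Q) *ᵥ x) ^ 2
        ≤ n * ((m ⬝ᵥ (Q * A * Q) *ᵥ m) * (x ⬝ᵥ (Q * A * Q) *ᵥ x)) := by
          gcongr; exact PSD.cauchy hQA m x
      _ = (n * (m ⬝ᵥ (Q * A * Q) *ᵥ m)) * (x ⬝ᵥ (Q * A * Q) *ᵥ x) := by ring
      _ ≤ (K * (M * γ⁻¹ + M ^ 2) * κ ^ 2) * (B * κ * (x ⬝ᵥ x)) := by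
          apply mul_le_mul h3 (h2 x) (PSD.nonneg hQA x); positivity
      _ = (K * (M * γ⁻¹ + M ^ 2) * B) * κ ^ 3 * (x ⬝ᵥ x) := by ring
      _ ≤ _ := by gcongr

theorem spikeConst_nonneg (hγ : 0 < γ) {K : ℝ} (hK : 0 ≤ K) : 0 ≤ spikeConst γ K := by
  unfold spikeConst
  positivity

/-- The Sherman–Morrison formula for a sandwich `Q A Q`. -/
theorem sandwich_add_vecMulVec_mulVec (hγ : 0 < γ) {S : Matrix τ τ ℝ} (hS : S.PosSemidef) (A : Matrix τ τ ℝ)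
    (y b : τ → ℝ) :
    let Q := regInv γ S
    let D := y ⬝ᵥ Q *ᵥ y
    let t := (y ⬝ᵥ Q *ᵥ b) / (1 + D)
    (regInv γ (Matrix.vecMulVec y y + S) * A * regInv γ (Matrix.vecMulVec y y + S)) *ᵥ b =
      (Q * A * Q) *ᵥ b - t • ((Q * A * Q) *ᵥ y) -
        ((y ⬝ᵥ (Q * A * Q) *ᵥ b - t * (y ⬝ᵥ (Q * A * Q) *ᵥ y)) / (1 + D)) • (Q *ᵥ y) := by
  intro Q D t
  have e : ∀ R : Matrix τ τ ℝ, (R * A * R) *ᵥ b = R *ᵥ (A *ᵥ (R *ᵥ b)) := fun R => by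
    rw [← Matrix.mulVec_mulVec, ← Matrix.mulVec_mulVec]
  have e' : ∀ z, (Q * A * Q) *ᵥ z = Q *ᵥ (A *ᵥ (Q *ᵥ z)) := fun z => by
    rw [← Matrix.mulVec_mulVec, ← Matrix.mulVec_mulVec]
  rw [e, regInv_add_vecMulVec_mulVec hγ hS y (A *ᵥ _), regInv_add_vecMulVec_mulVec hγ hS y b, e',
    e']
  simp only [Matrix.mulVec_sub, Matrix.mulVec_smul, dotProduct_sub, dotProduct_smul, smul_eq_mul]
  rfl

end Gram
end RandomFeatures

namespace RandomFeatures

/-! ### Measurability of matrix-valued functions -/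

section Measurability

variable {τ : Type*} {Ω : Type*} [MeasurableSpace Ω]

/-- Entrywise measurability of a matrix-valued function. -/
def MatMeasurable (M : Ω → Matrix τ τ ℝ) : Prop := ∀ j l, Measurable fun ω => M ω j l

theorem MatMeasurable.const (M : Matrix τ τ ℝ) : MatMeasurable fun _ : Ω => M :=
  fun _ _ => measurable_const

theorem MatMeasurable.comp {Ω' : Type*} [MeasurableSpace Ω'] {M : Ω → Matrix τ τ ℝ}
    (hM : MatMeasurable M) {f : Ω' → Ω} (hf : Measurable f) : MatMeasurable fun ω => M (f ω) :=
  fun j l => (hM j l).comp hf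

variable [Fintype τ]

theorem MatMeasurable.mulVec {M : Ω → Matrix τ τ ℝ} (hM : MatMeasurable M) {h : Ω → τ → ℝ}
    (hh : Measurable h) : Measurable fun ω => M ω *ᵥ h ω := by
  refine measurable_pi_lambda _ fun j => ?_
  simp only [Matrix.mulVec, dotProduct]
  exact Finset.measurable_sum _ fun l _ => (hM j l).mul ((measurable_pi_apply l).comp hh)

theorem measurable_dot {g h : Ω → τ → ℝ} (hg : Measurable g) (hh : Measurable h) :
    Measurable fun ω => g ω ⬝ᵥ h ω := by
  simp only [dotProduct]
  exact Finset.measurable_sum _ fun l _ =>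
    ((measurable_pi_apply l).comp hg).mul ((measurable_pi_apply l).comp hh)

theorem MatMeasurable.mul {M M' : Ω → Matrix τ τ ℝ} (hM : MatMeasurable M)
    (hM' : MatMeasurable M') : MatMeasurable fun ω => M ω * M' ω := by
  intro j l
  simp only [Matrix.mul_apply]
  exact Finset.measurable_sum _ fun k _ => (hM j k).mul (hM' k l)

theorem MatMeasurable.trace {M : Ω → Matrix τ τ ℝ} (hM : MatMeasurable M) :
    Measurable fun ω => (M ω).trace := by
  simp only [Matrix.trace, Matrix.diag]
  exact Finset.measurable_sum _ fun k _ => hM k k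

theorem matMeasurable_regInv_gram [DecidableEq τ] (γ : ℝ) (n : ℕ) :
    MatMeasurable fun Y : Fin n → τ → ℝ => regInv γ (gram Y) := by
  have hc : Continuous fun Y : Fin n → τ → ℝ => gram Y + γ • (1 : Matrix τ τ ℝ) := by
    refine Continuous.add ?_ continuous_const
    unfold gram
    refine continuous_finsetSum _ fun i _ => ?_
    exact Continuous.matrix_vecMulVec (by fun_prop) (by fun_prop)
  intro j l
  unfold regInv
  simp only [Matrix.inv_def, Ring.inverse_eq_inv', Matrix.smul_apply, smul_eq_mul]
  refine Measurable.mul ?_ ?_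
  · exact (hc.matrix_det.measurable).inv
  · exact (hc.matrix_adjugate.matrix_elem j l).measurable

end Measurability

/-! ### First and second moments of a random vector -/

section SecondMoment

variable {τ : Type*}

/-- The mean of a law on `ℝ^τ`. -/
noncomputable def meanVec (ν : Measure (τ → ℝ)) : τ → ℝ := fun j => ∫ y, y j ∂ν

/-- The matrix of (uncentred) second moments of a law on `ℝ^τ`. -/
noncomputable def secondMoment (ν : Measure (τ → ℝ)) : Matrix τ τ ℝ :=
  Matrix.of fun j l => ∫ y, y j * y l ∂ν

variable {ν : Measure (τ → ℝ)}

theorem secondMoment_symm : (secondMoment ν)ᵀ = secondMoment ν := by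
  ext j l
  simp [secondMoment, mul_comm]

variable [Fintype τ]

theorem integrable_coord_mul (h : Integrable (fun y : τ → ℝ => y ⬝ᵥ y) ν) (j l : τ) :
    Integrable (fun y : τ → ℝ => y j * y l) ν := by
  refine h.mono' (by fun_prop) (Eventually.of_forall fun y => ?_)
  have hj : y j * y j ≤ y ⬝ᵥ y :=
    Finset.single_le_sum (f := fun i => y i * y i) (fun i _ => mul_self_nonneg _)
      (Finset.mem_univ j)
  have hl : y l * y l ≤ y ⬝ᵥ y :=
    Finset.single_le_sum (f := fun i => y i * y i) (fun i _ => mul_self_nonneg _)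
      (Finset.mem_univ l)
  rw [Real.norm_eq_abs, abs_le]
  constructor <;> nlinarith [sq_nonneg (y j - y l), sq_nonneg (y j + y l)]

theorem integrable_quad (h : Integrable (fun y : τ → ℝ => y ⬝ᵥ y) ν) (B : Matrix τ τ ℝ) :
    Integrable (fun y : τ → ℝ => y ⬝ᵥ B *ᵥ y) ν := by
  simp only [dotProduct, Matrix.mulVec, Finset.mul_sum]
  refine integrable_finsetSum _ fun j _ => integrable_finsetSum _ fun l _ => ?_
  have := (integrable_coord_mul h j l).mul_const (B j l)
  refine this.congr (Eventually.of_forall fun y => ?_)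
  simp only; ring

theorem integral_quad (h : Integrable (fun y : τ → ℝ => y ⬝ᵥ y) ν) (B : Matrix τ τ ℝ) :
    ∫ y, y ⬝ᵥ B *ᵥ y ∂ν = (secondMoment ν * B).trace := by
  have e : ∀ y : τ → ℝ, y ⬝ᵥ B *ᵥ y = ∑ j, ∑ l, (y l * y j) * B j l := by
    intro y
    simp only [dotProduct, Matrix.mulVec, Finset.mul_sum]
    exact Finset.sum_congr rfl fun j _ => Finset.sum_congr rfl fun l _ => by ring
  simp_rw [e]
  have h1 : ∀ j l, Integrable (fun y : τ → ℝ => y l * y j * B j l) ν := fun j l =>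
    (integrable_coord_mul h l j).mul_const _
  rw [integral_finsetSum Finset.univ (f := fun j (y : τ → ℝ) => ∑ l, y l * y j * B j l)
    fun j _ => integrable_finsetSum _ fun l _ => h1 j l]
  simp only [Matrix.trace, Matrix.diag, Matrix.mul_apply]
  rw [Finset.sum_comm]
  refine Finset.sum_congr rfl fun j _ => ?_
  rw [integral_finsetSum Finset.univ (f := fun l (y : τ → ℝ) => y l * y j * B j l)
    fun l _ => h1 j l]
  exact Finset.sum_congr rfl fun l _ => integral_mul_const _ _

theorem dot_mul_dot_eq (y a b : τ → ℝ) :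
    (y ⬝ᵥ a) * (y ⬝ᵥ b) = y ⬝ᵥ Matrix.vecMulVec a b *ᵥ y := by
  rw [Matrix.vecMulVec_mulVec, dotProduct_smul, dotProduct_comm b y]
  simp

theorem integrable_dot_mul_dot (h : Integrable (fun y : τ → ℝ => y ⬝ᵥ y) ν) (a b : τ → ℝ) :
    Integrable (fun y : τ → ℝ => (y ⬝ᵥ a) * (y ⬝ᵥ b)) ν := by
  simp_rw [dot_mul_dot_eq]
  exact integrable_quad h _

theorem integral_dot_mul_dot (h : Integrable (fun y : τ → ℝ => y ⬝ᵥ y) ν) (a b : τ → ℝ) :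
    ∫ y, (y ⬝ᵥ a) * (y ⬝ᵥ b) ∂ν = a ⬝ᵥ secondMoment ν *ᵥ b := by
  simp_rw [dot_mul_dot_eq]
  rw [integral_quad h, Matrix.mul_vecMulVec, Matrix.trace_vecMulVec, dotProduct_comm,
    dot_mulVec_swap secondMoment_symm, dot_mulVec_comm secondMoment_symm, dotProduct_comm,
    dot_mulVec_swap secondMoment_symm]

theorem secondMoment_posSemidef (h : Integrable (fun y : τ → ℝ => y ⬝ᵥ y) ν) :
    (secondMoment ν).PosSemidef := by
  rw [posSemidef_iff_quad]
  refine ⟨secondMoment_symm, fun x => ?_⟩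
  rw [← integral_dot_mul_dot h]
  exact integral_nonneg fun y => mul_self_nonneg _

theorem trace_secondMoment (h : Integrable (fun y : τ → ℝ => y ⬝ᵥ y) ν) :
    (secondMoment ν).trace = ∫ y, y ⬝ᵥ y ∂ν := by
  classical
  have := integral_quad h 1
  simpa using this.symm

variable [IsProbabilityMeasure ν]

theorem integrable_coord (h : Integrable (fun y : τ → ℝ => y ⬝ᵥ y) ν) (j : τ) :
    Integrable (fun y : τ → ℝ => y j) ν := by
  refine ((integrable_coord_mul h j j).add (integrable_const 1)).mono'
    (measurable_pi_apply j).aestronglyMeasurable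
    (Eventually.of_forall fun y => ?_)
  rw [Real.norm_eq_abs, abs_le]
  simp only [Pi.add_apply]
  constructor <;> nlinarith [sq_nonneg (y j - 1), sq_nonneg (y j + 1)]

theorem integrable_dot (h : Integrable (fun y : τ → ℝ => y ⬝ᵥ y) ν) (a : τ → ℝ) :
    Integrable (fun y : τ → ℝ => y ⬝ᵥ a) ν :=
  integrable_finsetSum _ fun j _ => (integrable_coord h j).mul_const _

theorem integral_dot (h : Integrable (fun y : τ → ℝ => y ⬝ᵥ y) ν) (a : τ → ℝ) :
    ∫ y, y ⬝ᵥ a ∂ν = meanVec ν ⬝ᵥ a := by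
  simp only [dotProduct, meanVec]
  rw [integral_finsetSum _ fun j _ => (integrable_coord h j).mul_const _]
  exact Finset.sum_congr rfl fun j _ => integral_mul_const _ _

theorem integral_dot_sub_sq (h : Integrable (fun y : τ → ℝ => y ⬝ᵥ y) ν) (a : τ → ℝ) :
    ∫ y, (y ⬝ᵥ a - meanVec ν ⬝ᵥ a) ^ 2 ∂ν =
      a ⬝ᵥ secondMoment ν *ᵥ a - (meanVec ν ⬝ᵥ a) ^ 2 := by
  have e : ∀ y : τ → ℝ, (y ⬝ᵥ a - meanVec ν ⬝ᵥ a) ^ 2 =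
      (y ⬝ᵥ a) * (y ⬝ᵥ a) - 2 * (meanVec ν ⬝ᵥ a) * (y ⬝ᵥ a) + (meanVec ν ⬝ᵥ a) ^ 2 :=
    fun y => by ring
  simp_rw [e]
  rw [integral_add (f := fun y => (y ⬝ᵥ a) * (y ⬝ᵥ a) - 2 * (meanVec ν ⬝ᵥ a) * (y ⬝ᵥ a))
      ((integrable_dot_mul_dot h a a).sub ((integrable_dot h a).const_mul _)) (integrable_const _),
    integral_sub (integrable_dot_mul_dot h a a) ((integrable_dot h a).const_mul _),
    integral_const_mul, integral_dot h, integral_dot_mul_dot h]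
  simp
  ring

theorem integrable_dot_sub_sq (h : Integrable (fun y : τ → ℝ => y ⬝ᵥ y) ν) (a : τ → ℝ) :
    Integrable (fun y => (y ⬝ᵥ a - meanVec ν ⬝ᵥ a) ^ 2) ν := by
  have e : ∀ y : τ → ℝ, (y ⬝ᵥ a - meanVec ν ⬝ᵥ a) ^ 2 =
      (y ⬝ᵥ a) * (y ⬝ᵥ a) - 2 * (meanVec ν ⬝ᵥ a) * (y ⬝ᵥ a) + (meanVec ν ⬝ᵥ a) ^ 2 :=
    fun y => by ring
  simp_rw [e]
  exact ((integrable_dot_mul_dot h a a).sub ((integrable_dot h a).const_mul _)).add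
    (integrable_const _)

theorem mean_dot_sq_le (h : Integrable (fun y : τ → ℝ => y ⬝ᵥ y) ν) (a : τ → ℝ) :
    (meanVec ν ⬝ᵥ a) ^ 2 ≤ a ⬝ᵥ secondMoment ν *ᵥ a := by
  have h1 := integral_dot_sub_sq h a
  have h2 : 0 ≤ ∫ y, (y ⬝ᵥ a - meanVec ν ⬝ᵥ a) ^ 2 ∂ν := integral_nonneg fun y => sq_nonneg _
  linarith

theorem lintegral_enorm_sq {Ω : Type*} [MeasurableSpace Ω] {μ : Measure Ω} {f : Ω → ℝ}
    (hf : Integrable (fun x => f x ^ 2) μ) :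
    ∫⁻ x, ‖f x‖ₑ ^ 2 ∂μ = ENNReal.ofReal (∫ x, f x ^ 2 ∂μ) := by
  rw [ofReal_integral_eq_lintegral_ofReal hf (Eventually.of_forall fun x => sq_nonneg _)]
  refine lintegral_congr fun x => ?_
  rw [Real.enorm_eq_ofReal_abs, ← ENNReal.ofReal_pow (abs_nonneg _), sq_abs]

end SecondMoment

/-! ### Families of row laws -/

/-- A family of models of sample covariance type: for each index, `N + 1` independent rows in `ℝ^T`
with common law `ν`. The rows are normalised so that their squared length has bounded moments, while
linear functionals and square roots of quadratic forms fluctuate by `N ^ (-1/2)`, with constants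
uniform over the family. -/
structure RowModel (ι : Type) where
  /-- The number of rows, less one. -/
  N : ι → ℕ
  /-- The dimension of the rows. -/
  T : ι → ℕ
  /-- The law of a row. -/
  ν : ∀ i, Measure (Fin (T i) → ℝ)
  prob : ∀ i, IsProbabilityMeasure (ν i)
  one_le : ∀ i, 1 ≤ N i
  moment : MomentBdd ν fun _ y => y ⬝ᵥ y
  linear : ∀ k : ℕ, ∃ C : ℝ≥0, ∀ i (h : Fin (T i) → ℝ) (H : ℝ), h ⬝ᵥ h ≤ H ^ 2 →
    ∫⁻ y, ‖Real.sqrt (N i) * (y ⬝ᵥ h - meanVec (ν i) ⬝ᵥ h)‖ₑ ^ k ∂(ν i) ≤ C * ‖H‖ₑ ^ k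
  quad : ∀ k : ℕ, ∃ C : ℝ≥0, ∀ i (B : Matrix (Fin (T i)) (Fin (T i)) ℝ) (β : ℝ), B.PosSemidef →
    (∀ x : Fin (T i) → ℝ, x ⬝ᵥ B *ᵥ x ≤ β * (x ⬝ᵥ x)) →
    ∫⁻ y, ‖Real.sqrt (N i) * (y ⬝ᵥ B *ᵥ y - (secondMoment (ν i) * B).trace)‖ₑ ^ k ∂(ν i) ≤
      C * ‖β‖ₑ ^ k
  mean : MomentBdd (fun i => Measure.pi fun _ : Fin (N i) => ν i)
    fun i Y => meanDev (meanVec (ν i)) Y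

namespace RowModel

variable {ι : Type} (M : RowModel ι)

instance (i : ι) : IsProbabilityMeasure (M.ν i) := M.prob i

/-- Restriction of a family along a map of index types. -/
def comp {κ : Type} (g : κ → ι) : RowModel κ where
  N j := M.N (g j)
  T j := M.T (g j)
  ν j := M.ν (g j)
  prob j := M.prob (g j)
  one_le j := M.one_le (g j)
  moment k := ⟨fun j => (M.moment k).1 (g j), by
    obtain ⟨C, hC⟩ := (M.moment k).2
    exact ⟨C, fun j => hC (g j)⟩⟩
  linear k := by
    obtain ⟨C, hC⟩ := M.linear k
    exact ⟨C, fun j => hC (g j)⟩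
  quad k := by
    obtain ⟨C, hC⟩ := M.quad k
    exact ⟨C, fun j => hC (g j)⟩
  mean k := ⟨fun j => (M.mean k).1 (g j), by
    obtain ⟨C, hC⟩ := (M.mean k).2
    exact ⟨C, fun j => hC (g j)⟩⟩

/-- The joint law of `N` rows. -/
noncomputable abbrev rows (i : ι) : Measure (Fin (M.N i) → Fin (M.T i) → ℝ) := Measure.pi fun _ => M.ν i

/-- The joint law of one row and `N` further rows. -/
noncomputable abbrev P (i : ι) : Measure ((Fin (M.T i) → ℝ) × (Fin (M.N i) → Fin (M.T i) → ℝ)) :=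
  (M.ν i).prod (M.rows i)

/-- The mean of a row. -/
noncomputable abbrev m (i : ι) : Fin (M.T i) → ℝ := meanVec (M.ν i)

/-- The second moment matrix of a row. -/
noncomputable abbrev F (i : ι) : Matrix (Fin (M.T i)) (Fin (M.T i)) ℝ := secondMoment (M.ν i)

theorem N_pos (i : ι) : (0 : ℝ) < M.N i := by exact_mod_cast M.one_le i

theorem integrable_sq (i : ι) : Integrable (fun y : Fin (M.T i) → ℝ => y ⬝ᵥ y) (M.ν i) :=
  LpBdd.integrable (M.moment 1) i

theorem F_psd (i : ι) : (M.F i).PosSemidef := secondMoment_posSemidef (M.integrable_sq i)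

theorem exists_trace_le : ∃ C : ℝ, 0 ≤ C ∧ ∀ i, (M.F i).trace ≤ C := by
  obtain ⟨C, hC0, hC⟩ := LpBdd.abs_integral_le (M.moment 1)
  refine ⟨C, hC0, fun i => ?_⟩
  rw [trace_secondMoment (M.integrable_sq i)]
  exact (le_abs_self _).trans (hC i)

/-- The second moment matrix is the sum of the rank-one matrix `m mᵀ` and of a covariance matrix of
norm `O(1 / N)`. -/
theorem exists_spikeBdd_F :
    ∃ K : ℝ, 0 ≤ K ∧ ∀ i, SpikeBdd K (M.N i) (M.m i) ((M.N i : ℝ) • M.F i) := by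
  obtain ⟨C, hC⟩ := M.linear 2
  refine ⟨C + 1, by positivity, fun i => ⟨(M.F_psd i).smul (M.N_pos i).le, fun x => ?_⟩⟩
  have hN := M.N_pos i
  have hx := dot_self_nonneg x
  have h1 := hC i x (Real.sqrt (x ⬝ᵥ x)) (by rw [Real.sq_sqrt hx])
  have hi := integrable_dot_sub_sq (M.integrable_sq i) x
  have e : (fun y : Fin (M.T i) → ℝ =>
      (Real.sqrt (M.N i) * (y ⬝ᵥ x - M.m i ⬝ᵥ x)) ^ 2) =
      fun y => (M.N i : ℝ) * (y ⬝ᵥ x - M.m i ⬝ᵥ x) ^ 2 := by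
    funext y
    rw [mul_pow, Real.sq_sqrt hN.le]
  rw [lintegral_enorm_sq (by rw [e]; exact hi.const_mul _)] at h1
  simp only [e] at h1
  rw [integral_const_mul, integral_dot_sub_sq (M.integrable_sq i), Real.enorm_eq_ofReal_abs,
    ← ENNReal.ofReal_pow (abs_nonneg _), sq_abs, Real.sq_sqrt hx, ← ENNReal.ofReal_coe_nnreal,
    ← ENNReal.ofReal_mul (NNReal.coe_nonneg C),
    ENNReal.ofReal_le_ofReal_iff (mul_nonneg (NNReal.coe_nonneg C) hx)] at h1
  rw [Matrix.smul_mulVec, dotProduct_smul, smul_eq_mul]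
  have h2 : 0 ≤ C * ((M.N i : ℝ) * (M.m i ⬝ᵥ x) ^ 2) := by positivity
  nlinarith

end RowModel
end RandomFeatures

namespace RandomFeatures

section MomentAux

variable {ι : Type*} {Ω : ι → Type*} [∀ i, MeasurableSpace (Ω i)] {P : ∀ i, Measure (Ω i)}
  [∀ i, IsProbabilityMeasure (P i)] {X Z : ∀ i, Ω i → ℝ}

theorem abs_le_abs_one_add {x z : ℝ} (h : x ^ 2 ≤ z) : |x| ≤ |1 + z| := by
  have hz : 0 ≤ z := (sq_nonneg x).trans h
  rw [abs_of_nonneg (by linarith : 0 ≤ 1 + z), abs_le]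
  constructor <;> nlinarith [sq_nonneg (x - 1), sq_nonneg (x + 1)]

theorem MomentBdd.of_sq_le (hZ : MomentBdd P Z) (hX : ∀ i, Measurable (X i))
    (h : ∀ i ω, X i ω ^ 2 ≤ Z i ω) : MomentBdd P X :=
  ((MomentBdd.const 1).add hZ).mono hX fun i ω => abs_le_abs_one_add (h i ω)

end MomentAux

/-- A bound for the vector `Ψ Q̄ a`, tested against `x`. -/
theorem dot_psi_detRes_sq_le {τ : Type*} [Fintype τ] [DecidableEq τ] {γ n : ℝ} {F : Matrix τ τ ℝ}
    (hγ : 0 < γ) (hn : 0 ≤ n) (hF : F.PosSemidef) {d : ℝ} (hd : 0 ≤ d) (x a : τ → ℝ) :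
    (x ⬝ᵥ ((n / (1 + d)) • F) *ᵥ (detRes γ n F d *ᵥ a)) ^ 2 ≤
      γ⁻¹ * (a ⬝ᵥ a) * (n * (x ⬝ᵥ F *ᵥ x)) := by
  have hd1 : 0 < 1 + d := by linarith
  have hΨ : ((n / (1 + d)) • F).PosSemidef := hF.smul (div_nonneg hn hd1.le)
  have h1 := PSD.cauchy hΨ x (detRes γ n F d *ᵥ a)
  have h2 := (regInv_sandwich_le hγ hΨ a).trans (regInv_quad_le hγ hΨ a)
  have h3 : x ⬝ᵥ ((n / (1 + d)) • F) *ᵥ x ≤ n * (x ⬝ᵥ F *ᵥ x) := by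
    rw [Matrix.smul_mulVec, dotProduct_smul, smul_eq_mul]
    refine mul_le_mul_of_nonneg_right ?_ (PSD.nonneg hF x)
    exact div_le_self hn (by linarith)
  have h4 := PSD.nonneg hΨ (detRes γ n F d *ᵥ a)
  have h5 : 0 ≤ n * (x ⬝ᵥ F *ᵥ x) := mul_nonneg hn (PSD.nonneg hF x)
  calc _ ≤ _ := h1
    _ ≤ (n * (x ⬝ᵥ F *ᵥ x)) * (γ⁻¹ * (a ⬝ᵥ a)) := mul_le_mul h3 h2 h4 h5
    _ = _ := mul_comm _ _

namespace RowModel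

variable {ι : Type} (M : RowModel ι) {γ K : ℝ} {A : ∀ i, Matrix (Fin (M.T i)) (Fin (M.T i)) ℝ}

/-! ### Moment bounds for one row tested against the resolvent of the others -/

theorem bdd_snd {X : ∀ i, (Fin (M.N i) → Fin (M.T i) → ℝ) → ℝ} (hX : MomentBdd M.rows X) :
    MomentBdd M.P (fun i ω => X i ω.2) :=
  MomentBdd.comp_snd (P := M.rows) (P' := M.ν) hX

theorem bdd_len : MomentBdd M.P (fun _ ω => ω.1 ⬝ᵥ ω.1) :=
  MomentBdd.comp_fst (P := M.ν) (P' := M.rows) (X := fun _ y => y ⬝ᵥ y) M.moment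

/-- The random factor in the deterministic bounds for the resolvent of `N` rows. -/
noncomputable def G (γ K : ℝ) (i : ι) (Y : Fin (M.N i) → Fin (M.T i) → ℝ) : ℝ :=
  spikeConst γ K * meanDev (M.m i) Y ^ 3

theorem G_nonneg (hγ : 0 < γ) (hK : 0 ≤ K) (i : ι) (Y : Fin (M.N i) → Fin (M.T i) → ℝ) :
    0 ≤ M.G γ K i Y := by
  have h1 := one_le_meanDev (M.m i) Y
  have h2 := spikeConst_nonneg hγ hK
  unfold G
  positivity

theorem bdd_G (γ K : ℝ) : MomentBdd M.rows (M.G γ K) := (M.mean.pow 3).const_mul _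

/-- A linear functional `y ⬝ h`, with `h` independent of the row `y`, is of order `N ^ (-1/2)` if `h`
is bounded and of order `N ^ (-1/2)` in the mean direction. -/
theorem bdd_linear {h : ∀ i, (Fin (M.N i) → Fin (M.T i) → ℝ) → Fin (M.T i) → ℝ}
    (hh : ∀ i, Measurable (h i)) {H : ∀ i, (Fin (M.N i) → Fin (M.T i) → ℝ) → ℝ}
    (hH : MomentBdd M.rows H) (h1 : ∀ i Y, h i Y ⬝ᵥ h i Y ≤ H i Y)
    (h2 : ∀ i Y, M.N i * (M.m i ⬝ᵥ h i Y) ^ 2 ≤ H i Y) :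
    MomentBdd M.P (fun i ω => Real.sqrt (M.N i) * (ω.1 ⬝ᵥ h i ω.2)) := by
  have hmeas : ∀ i, Measurable fun ω : (Fin (M.T i) → ℝ) × (Fin (M.N i) → Fin (M.T i) → ℝ) =>
      ω.1 ⬝ᵥ h i ω.2 := fun i => measurable_dot measurable_fst ((hh i).comp measurable_snd)
  have hmeas2 : ∀ i, Measurable fun Y : Fin (M.N i) → Fin (M.T i) → ℝ => M.m i ⬝ᵥ h i Y := fun i =>
    measurable_dot measurable_const (hh i)
  have hH0 : ∀ i Y, 0 ≤ H i Y := fun i Y => (dot_self_nonneg _).trans (h1 i Y)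
  have ha : MomentBdd M.P (fun i ω =>
      Real.sqrt (M.N i) * (ω.1 ⬝ᵥ h i ω.2 - M.m i ⬝ᵥ h i ω.2)) := by
    refine MomentBdd.of_conditional (P := M.rows) (P' := M.ν) (H := fun i Y => 1 + H i Y)
      (fun i => ((hmeas i).sub ((hmeas2 i).comp measurable_snd)).const_mul _)
      ((MomentBdd.const 1).add hH) fun k => ?_
    obtain ⟨C, hC⟩ := M.linear k
    refine ⟨C, fun i Y => hC i (h i Y) (1 + H i Y) ?_⟩
    nlinarith [h1 i Y, hH0 i Y]
  have hb : MomentBdd M.rows (fun i Y => Real.sqrt (M.N i) * (M.m i ⬝ᵥ h i Y)) := by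
    refine hH.of_sq_le (fun i => (hmeas2 i).const_mul _) fun i Y => ?_
    rw [mul_pow, Real.sq_sqrt (M.N_pos i).le]
    exact h2 i Y
  refine (ha.add (M.bdd_snd hb)).mono (fun i => (hmeas i).const_mul _) fun i ω => le_of_eq ?_
  congr 1
  ring

/-- A quadratic form of a row, with coefficients independent of the row, differs from its conditional
mean by `O(N ^ (-1/2))`. -/
theorem bdd_quad_sub {B : ∀ i, (Fin (M.N i) → Fin (M.T i) → ℝ) → Matrix (Fin (M.T i)) (Fin (M.T i)) ℝ}
    (hB : ∀ i, MatMeasurable (B i)) (hBp : ∀ i Y, (B i Y).PosSemidef)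
    {H : ∀ i, (Fin (M.N i) → Fin (M.T i) → ℝ) → ℝ} (hH : MomentBdd M.rows H)
    (h : ∀ i Y x, x ⬝ᵥ B i Y *ᵥ x ≤ H i Y * (x ⬝ᵥ x)) :
    MomentBdd M.P (fun i ω =>
      Real.sqrt (M.N i) * (ω.1 ⬝ᵥ B i ω.2 *ᵥ ω.1 - (M.F i * B i ω.2).trace)) := by
  refine MomentBdd.of_conditional (P := M.rows) (P' := M.ν) (H := H) (fun i => ?_) hH fun k => ?_
  · refine Measurable.const_mul (Measurable.sub ?_ ?_) _
    · exact measurable_dot measurable_fst (((hB i).comp measurable_snd).mulVec measurable_fst)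
    · exact ((MatMeasurable.const _).mul ((hB i).comp measurable_snd)).trace
  · obtain ⟨C, hC⟩ := M.quad k
    exact ⟨C, fun i Y => hC i (B i Y) (H i Y) (hBp i Y) (h i Y)⟩

/-- The resolvent `Q` of the sample matrix of `N` rows. -/
noncomputable abbrev Q (γ : ℝ) (i : ι) (Y : Fin (M.N i) → Fin (M.T i) → ℝ) :
    Matrix (Fin (M.T i)) (Fin (M.T i)) ℝ := regInv γ (gram Y)

/-- The matrix `Q A Q`. -/
noncomputable abbrev B (γ : ℝ) (A : ∀ i, Matrix (Fin (M.T i)) (Fin (M.T i)) ℝ) (i : ι)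
    (Y : Fin (M.N i) → Fin (M.T i) → ℝ) : Matrix (Fin (M.T i)) (Fin (M.T i)) ℝ :=
  M.Q γ i Y * A i * M.Q γ i Y

theorem matMeasurable_Q (γ : ℝ) (i : ι) : MatMeasurable (M.Q γ i) := matMeasurable_regInv_gram _ _

theorem matMeasurable_B (γ : ℝ) (A : ∀ i, Matrix (Fin (M.T i)) (Fin (M.T i)) ℝ) (i : ι) :
    MatMeasurable (M.B γ A i) :=
  ((matMeasurable_regInv_gram _ _).mul (MatMeasurable.const _)).mul (matMeasurable_regInv_gram _ _)

theorem Q_psd (hγ : 0 < γ) (i : ι) (Y : Fin (M.N i) → Fin (M.T i) → ℝ) : (M.Q γ i Y).PosSemidef :=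
  regInv_posSemidef hγ (gram_posSemidef Y)

theorem B_psd (hγ : 0 < γ) (hA : ∀ i, (A i).PosSemidef) (i : ι)
    (Y : Fin (M.N i) → Fin (M.T i) → ℝ) : (M.B γ A i Y).PosSemidef :=
  sandwich_posSemidef (M.Q_psd hγ i Y) (hA i)

/-- A form in one row and in the resolvent of the others is measurable. -/
theorem measurable_dot_snd {i : ι}
    {B : (Fin (M.N i) → Fin (M.T i) → ℝ) → Matrix (Fin (M.T i)) (Fin (M.T i)) ℝ}
    (hB : MatMeasurable B)
    {g h : (Fin (M.T i) → ℝ) × (Fin (M.N i) → Fin (M.T i) → ℝ) → Fin (M.T i) → ℝ}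
    (hg : Measurable g) (hh : Measurable h) : Measurable fun ω => g ω ⬝ᵥ B ω.2 *ᵥ h ω :=
  measurable_dot hg ((hB.comp measurable_snd).mulVec hh)

theorem bdd_Q_linear (hγ : 0 < γ) {b : ∀ i, Fin (M.T i) → ℝ} {R : ℝ} (hb : ∀ i, b i ⬝ᵥ b i ≤ R) :
    MomentBdd M.P (fun i ω => Real.sqrt (M.N i) * (ω.1 ⬝ᵥ M.Q γ i ω.2 *ᵥ b i)) := by
  obtain ⟨K, hK, hF⟩ := M.exists_spikeBdd_F
  refine M.bdd_linear (h := fun i Y => M.Q γ i Y *ᵥ b i)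
    (H := fun i Y => (γ⁻¹) ^ 2 * R + R * M.G γ K i Y)
    (fun i => (M.matMeasurable_Q γ i).mulVec measurable_const)
    ((MomentBdd.const _).add ((M.bdd_G γ K).const_mul _)) (fun i Y => ?_) fun i Y => ?_
  · have h1 := regInv_norm_le' hγ (gram_posSemidef Y) (b i)
    have h2 := M.G_nonneg hγ hK i Y
    have h3 := dot_self_nonneg (b i)
    have h4 := hb i
    have h5 : (γ⁻¹) ^ 2 * (b i ⬝ᵥ b i) ≤ (γ⁻¹) ^ 2 * R := by gcongr
    nlinarith [mul_nonneg (h3.trans h4) h2]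
  · have h1 := ((hF i).bounds hγ hK (M.one_le i) Y (b i)).1
    have h2 := M.G_nonneg hγ hK i Y
    have h4 : M.G γ K i Y * (b i ⬝ᵥ b i) ≤ M.G γ K i Y * R := by gcongr; exact hb i
    have h5 : 0 ≤ (γ⁻¹) ^ 2 * R := mul_nonneg (sq_nonneg _) ((dot_self_nonneg _).trans (hb i))
    simp only [G] at h2 h4 ⊢
    linarith

theorem B_norm_le (hγ : 0 < γ) (hK : 0 ≤ K) (hA : ∀ i, SpikeBdd K (M.N i) (M.m i) (A i)) (i : ι)
    (Y : Fin (M.N i) → Fin (M.T i) → ℝ) (x : Fin (M.T i) → ℝ) :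
    (M.B γ A i Y *ᵥ x) ⬝ᵥ (M.B γ A i Y *ᵥ x) ≤ M.G γ K i Y ^ 2 * (x ⬝ᵥ x) :=
  PSD.norm_le (M.B_psd hγ (fun i => (hA i).psd) i Y)
    (fun x => ((hA i).bounds hγ hK (M.one_le i) Y x).2.1) x

theorem bdd_B_linear (hγ : 0 < γ) (hK : 0 ≤ K) (hA : ∀ i, SpikeBdd K (M.N i) (M.m i) (A i))
    {b : ∀ i, Fin (M.T i) → ℝ} {R : ℝ} (hb : ∀ i, b i ⬝ᵥ b i ≤ R) :
    MomentBdd M.P (fun i ω => Real.sqrt (M.N i) * (ω.1 ⬝ᵥ M.B γ A i ω.2 *ᵥ b i)) := by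
  refine M.bdd_linear (h := fun i Y => M.B γ A i Y *ᵥ b i)
    (H := fun i Y => R * M.G γ K i Y ^ 2 + R * M.G γ K i Y)
    (fun i => (M.matMeasurable_B γ A i).mulVec measurable_const)
    ((((M.bdd_G γ K).pow 2).const_mul _).add ((M.bdd_G γ K).const_mul _))
    (fun i Y => ?_) fun i Y => ?_
  · have h1 := M.B_norm_le hγ hK hA i Y (b i)
    have h2 := M.G_nonneg hγ hK i Y
    have h3 := (dot_self_nonneg (b i)).trans (hb i)
    have h4 : M.G γ K i Y ^ 2 * (b i ⬝ᵥ b i) ≤ M.G γ K i Y ^ 2 * R := by gcongr; exact hb i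
    nlinarith [mul_nonneg h3 h2]
  · have h1 := ((hA i).bounds hγ hK (M.one_le i) Y (b i)).2.2
    have h2 := M.G_nonneg hγ hK i Y
    have h3 := (dot_self_nonneg (b i)).trans (hb i)
    have h4 : M.G γ K i Y * (b i ⬝ᵥ b i) ≤ M.G γ K i Y * R := by gcongr; exact hb i
    have h5 : 0 ≤ R * M.G γ K i Y ^ 2 := by positivity
    simp only [G] at h2 h4 h5 ⊢
    linarith

/-- Fixed linear functionals `y ⬝ Q̄ a` are of order `N ^ (-1/2)`. -/
theorem bdd_detRes_linear (hγ : 0 < γ) {d : ι → ℝ} (hd : ∀ i, 0 ≤ d i) {D : ℝ} (hD : ∀ i, d i ≤ D)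
    {a : ∀ i, Fin (M.T i) → ℝ} {R : ℝ} (ha : ∀ i, a i ⬝ᵥ a i ≤ R) :
    MomentBdd M.P (fun i ω =>
      Real.sqrt (M.N i) * (ω.1 ⬝ᵥ detRes γ (M.N i + 1) (M.F i) (d i) *ᵥ a i)) := by
  refine M.bdd_linear (h := fun i _ => detRes γ (M.N i + 1) (M.F i) (d i) *ᵥ a i)
    (H := fun i Y => (γ⁻¹) ^ 2 * R + γ⁻¹ * R * (1 + D))
    (fun i => measurable_const) (MomentBdd.const _) (fun i Y => ?_) fun i Y => ?_
  all_goals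
    have hN := M.N_pos i
    have hR := (dot_self_nonneg (a i)).trans (ha i)
    have hd1 : 0 < 1 + d i := by linarith [hd i]
    have hD1 : 0 ≤ 1 + D := by linarith [hd i, hD i]
    have hγ' : 0 < γ⁻¹ := by positivity
    have hΨ : (((M.N i + 1 : ℝ) / (1 + d i)) • M.F i).PosSemidef :=
      (M.F_psd i).smul (by positivity)
    have hp1 : 0 ≤ (γ⁻¹) ^ 2 * R := by positivity
    have hp2 : 0 ≤ γ⁻¹ * R * (1 + D) := by positivity
  · have h1 := regInv_norm_le' hγ hΨ (a i)
    have h2 : (γ⁻¹) ^ 2 * (a i ⬝ᵥ a i) ≤ (γ⁻¹) ^ 2 * R := by gcongr; exact ha i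
    exact (h1.trans h2).trans (by linarith)
  · have h1 := (regInv_sandwich_le hγ hΨ (a i)).trans (regInv_quad_le hγ hΨ (a i))
    set z := detRes γ (M.N i + 1) (M.F i) (d i) *ᵥ a i with hz
    have h2 := mean_dot_sq_le (M.integrable_sq i) z
    have h3 : ((M.N i + 1 : ℝ) / (1 + d i)) * (z ⬝ᵥ M.F i *ᵥ z) ≤ γ⁻¹ * R := by
      have e : z ⬝ᵥ (((M.N i + 1 : ℝ) / (1 + d i)) • M.F i) *ᵥ z =
          ((M.N i + 1 : ℝ) / (1 + d i)) * (z ⬝ᵥ M.F i *ᵥ z) := by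
        rw [Matrix.smul_mulVec, dotProduct_smul, smul_eq_mul]
      rw [← e]
      exact h1.trans (by gcongr; exact ha i)
    have h4 : (M.N i + 1 : ℝ) * (z ⬝ᵥ M.F i *ᵥ z) ≤ γ⁻¹ * R * (1 + d i) := by
      rw [div_mul_eq_mul_div, div_le_iff₀ hd1] at h3
      exact h3
    have h5 : γ⁻¹ * R * (1 + d i) ≤ γ⁻¹ * R * (1 + D) := by gcongr; exact hD i
    have h6 := PSD.nonneg (M.F_psd i) z
    have h7 : (M.N i : ℝ) * (M.m i ⬝ᵥ z) ^ 2 ≤ M.N i * (z ⬝ᵥ M.F i *ᵥ z) := by gcongr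
    linarith

/-- `y ⬝ Q y` differs from its conditional mean `tr (F Q)` by `O(N ^ (-1/2))`. -/
theorem bdd_Q_quad_sub (hγ : 0 < γ) : MomentBdd M.P (fun i ω =>
    Real.sqrt (M.N i) * (ω.1 ⬝ᵥ M.Q γ i ω.2 *ᵥ ω.1 - (M.F i * M.Q γ i ω.2).trace)) :=
  M.bdd_quad_sub (M.matMeasurable_Q γ) (M.Q_psd hγ) (MomentBdd.const γ⁻¹)
    fun _ Y x => regInv_quad_le hγ (gram_posSemidef Y) x

theorem bdd_B_quad_sub (hγ : 0 < γ) (hK : 0 ≤ K) (hA : ∀ i, SpikeBdd K (M.N i) (M.m i) (A i)) :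
    MomentBdd M.P (fun i ω =>
      Real.sqrt (M.N i) * (ω.1 ⬝ᵥ M.B γ A i ω.2 *ᵥ ω.1 - (M.F i * M.B γ A i ω.2).trace)) :=
  M.bdd_quad_sub (M.matMeasurable_B γ A) (M.B_psd hγ fun i => (hA i).psd) (M.bdd_G γ K)
    fun i Y x => ((hA i).bounds hγ hK (M.one_le i) Y x).2.1

theorem bdd_B_quad (hγ : 0 < γ) (hK : 0 ≤ K) (hA : ∀ i, SpikeBdd K (M.N i) (M.m i) (A i)) :
    MomentBdd M.P (fun i ω => ω.1 ⬝ᵥ M.B γ A i ω.2 *ᵥ ω.1) := by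
  refine ((M.bdd_snd (M.bdd_G γ K)).mul M.bdd_len).mono
    (fun i => M.measurable_dot_snd (M.matMeasurable_B γ A i) measurable_fst measurable_fst)
    fun i ω => ?_
  rw [abs_of_nonneg (PSD.nonneg (M.B_psd hγ (fun i => (hA i).psd) i ω.2) _)]
  exact (((hA i).bounds hγ hK (M.one_le i) ω.2 ω.1).2.1).trans (le_abs_self _)

/-- `(Q y) ⬝ F (Q y)` is of order `1 / N`. -/
theorem bdd_Q_F_Q (hγ : 0 < γ) : MomentBdd M.P (fun i ω =>
    M.N i * ((M.Q γ i ω.2 *ᵥ ω.1) ⬝ᵥ M.F i *ᵥ (M.Q γ i ω.2 *ᵥ ω.1))) := by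
  obtain ⟨K, hK, hF⟩ := M.exists_spikeBdd_F
  have h := M.bdd_B_quad hγ hK hF
  refine h.mono (fun i => ?_) fun i ω => le_of_eq ?_
  · have h1 := ((M.matMeasurable_Q γ i).comp measurable_snd).mulVec
      (measurable_fst (α := Fin (M.T i) → ℝ) (β := Fin (M.N i) → Fin (M.T i) → ℝ))
    exact (measurable_dot h1 ((MatMeasurable.const _).mulVec h1)).const_mul _
  · rw [dot_sandwich (PSD.symm (M.Q_psd hγ i ω.2)), Matrix.smul_mulVec, dotProduct_smul,
      smul_eq_mul]

/-- `(Q A Q y) ⬝ F (Q A Q y)` is of order `1 / N`. -/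
theorem bdd_B_F_B (hγ : 0 < γ) (hK : 0 ≤ K) (hA : ∀ i, SpikeBdd K (M.N i) (M.m i) (A i)) :
    MomentBdd M.P (fun i ω =>
      M.N i * ((M.B γ A i ω.2 *ᵥ ω.1) ⬝ᵥ M.F i *ᵥ (M.B γ A i ω.2 *ᵥ ω.1))) := by
  obtain ⟨C, hC, hF⟩ := M.exists_spikeBdd_F
  have h1 : MomentBdd M.P (fun i ω =>
      C * (M.G γ K i ω.2 ^ 2 * (ω.1 ⬝ᵥ ω.1) + M.G γ K i ω.2 * (ω.1 ⬝ᵥ ω.1))) :=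
    ((((M.bdd_snd (M.bdd_G γ K)).pow 2).mul M.bdd_len).add
      ((M.bdd_snd (M.bdd_G γ K)).mul M.bdd_len)).const_mul C
  refine h1.mono (fun i => ?_) fun i ω => ?_
  · have h1 := ((M.matMeasurable_B γ A i).comp measurable_snd).mulVec
      (measurable_fst (α := Fin (M.T i) → ℝ) (β := Fin (M.N i) → Fin (M.T i) → ℝ))
    exact (measurable_dot h1 ((MatMeasurable.const _).mulVec h1)).const_mul _
  · have h2 := (hF i).le (M.B γ A i ω.2 *ᵥ ω.1)
    have h3 := ((hA i).bounds hγ hK (M.one_le i) ω.2 ω.1).2.2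
    have h4 := M.B_norm_le hγ hK hA i ω.2 ω.1
    rw [Matrix.smul_mulVec, dotProduct_smul, smul_eq_mul] at h2
    rw [abs_of_nonneg (mul_nonneg (M.N_pos i).le (PSD.nonneg (M.F_psd i) _))]
    exact (h2.trans (mul_le_mul_of_nonneg_left (add_le_add h4 h3) hC)).trans (le_abs_self _)

/-- The vector `Ψ Q̄ a`. -/
noncomputable def psiVec (γ : ℝ) (d : ι → ℝ) (a : ∀ i, Fin (M.T i) → ℝ) (i : ι) :
    Fin (M.T i) → ℝ :=
  (((M.N i + 1 : ℝ) / (1 + d i)) • M.F i) *ᵥ (detRes γ (M.N i + 1) (M.F i) (d i) *ᵥ a i)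

theorem psiVec_sq_le (hγ : 0 < γ) {d : ι → ℝ} (hd : ∀ i, 0 ≤ d i)
    {a : ∀ i, Fin (M.T i) → ℝ} {R : ℝ} (ha : ∀ i, a i ⬝ᵥ a i ≤ R) (i : ι) (x : Fin (M.T i) → ℝ) :
    (x ⬝ᵥ M.psiVec γ d a i) ^ 2 ≤ 2 * (γ⁻¹ * R) * (M.N i * (x ⬝ᵥ M.F i *ᵥ x)) := by
  have h1 := dot_psi_detRes_sq_le hγ (by positivity : (0 : ℝ) ≤ M.N i + 1) (M.F_psd i) (hd i) x (a i)
  have hN : (1 : ℝ) ≤ M.N i := by exact_mod_cast M.one_le i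
  have hF := PSD.nonneg (M.F_psd i) x
  have hR := (dot_self_nonneg (a i)).trans (ha i)
  refine h1.trans ?_
  calc γ⁻¹ * (a i ⬝ᵥ a i) * ((M.N i + 1) * (x ⬝ᵥ M.F i *ᵥ x))
      ≤ γ⁻¹ * R * ((M.N i + M.N i) * (x ⬝ᵥ M.F i *ᵥ x)) := by gcongr; exact ha i
    _ = _ := by ring

theorem psiVec_norm_le (hγ : 0 < γ) {d : ι → ℝ} (hd : ∀ i, 0 ≤ d i)
    (a : ∀ i, Fin (M.T i) → ℝ) (i : ι) :
    M.psiVec γ d a i ⬝ᵥ M.psiVec γ d a i ≤ a i ⬝ᵥ a i :=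
  mulVec_regInv_norm_le hγ ((M.F_psd i).smul (div_nonneg (by positivity) (by linarith [hd i]))) _

theorem bdd_Q_psiVec (hγ : 0 < γ) {d : ι → ℝ} (hd : ∀ i, 0 ≤ d i)
    {a : ∀ i, Fin (M.T i) → ℝ} {R : ℝ} (ha : ∀ i, a i ⬝ᵥ a i ≤ R) :
    MomentBdd M.P (fun i ω => ω.1 ⬝ᵥ M.Q γ i ω.2 *ᵥ M.psiVec γ d a i) := by
  refine ((M.bdd_Q_F_Q hγ).const_mul (2 * (γ⁻¹ * R))).of_sq_le
    (fun i => M.measurable_dot_snd (M.matMeasurable_Q γ i) measurable_fst measurable_const)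
    fun i ω => ?_
  rw [dot_mulVec_comm (PSD.symm (M.Q_psd hγ i ω.2))]
  exact M.psiVec_sq_le hγ hd ha i _

theorem bdd_B_psiVec (hγ : 0 < γ) (hK : 0 ≤ K) (hA : ∀ i, SpikeBdd K (M.N i) (M.m i) (A i))
    {d : ι → ℝ} (hd : ∀ i, 0 ≤ d i) {a : ∀ i, Fin (M.T i) → ℝ} {R : ℝ}
    (ha : ∀ i, a i ⬝ᵥ a i ≤ R) :
    MomentBdd M.P (fun i ω => ω.1 ⬝ᵥ M.B γ A i ω.2 *ᵥ M.psiVec γ d a i) := by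
  refine ((M.bdd_B_F_B hγ hK hA).const_mul (2 * (γ⁻¹ * R))).of_sq_le
    (fun i => M.measurable_dot_snd (M.matMeasurable_B γ A i) measurable_fst measurable_const)
    fun i ω => ?_
  rw [dot_mulVec_comm (PSD.symm (M.B_psd hγ (fun i => (hA i).psd) i ω.2))]
  exact M.psiVec_sq_le hγ hd ha i _

end RowModel
end RandomFeatures

namespace RandomFeatures

/-! ### Concentration of traces -/

section TraceUpdate

variable {τ : Type*} [Fintype τ]

theorem trace_mul_vecMulVec (F : Matrix τ τ ℝ) (x y : τ → ℝ) :
    (F * Matrix.vecMulVec x y).trace = y ⬝ᵥ F *ᵥ x := by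
  rw [Matrix.mul_vecMulVec, Matrix.trace_vecMulVec, dotProduct_comm]

variable [DecidableEq τ] {γ : ℝ} {S F : Matrix τ τ ℝ}

theorem trace_regInv_add_vecMulVec (hγ : 0 < γ) (hS : S.PosSemidef) (F : Matrix τ τ ℝ)
    (y : τ → ℝ) :
    (F * regInv γ (Matrix.vecMulVec y y + S)).trace = (F * regInv γ S).trace -
      (1 + y ⬝ᵥ regInv γ S *ᵥ y)⁻¹ * ((regInv γ S *ᵥ y) ⬝ᵥ F *ᵥ (regInv γ S *ᵥ y)) := by
  rw [regInv_add_vecMulVec hγ hS, mul_sub, Matrix.mul_smul, Matrix.trace_sub, Matrix.trace_smul,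
    trace_mul_vecMulVec, smul_eq_mul]

theorem trace_sandwich_add_vecMulVec (hγ : 0 < γ) (hS : S.PosSemidef) (hF : Fᵀ = F)
    {A : Matrix τ τ ℝ} (hA : Aᵀ = A) (y : τ → ℝ) :
    (F * (regInv γ (Matrix.vecMulVec y y + S) * A *
      regInv γ (Matrix.vecMulVec y y + S))).trace =
      (F * (regInv γ S * A * regInv γ S)).trace -
      2 * (1 + y ⬝ᵥ regInv γ S *ᵥ y)⁻¹ *
        ((regInv γ S *ᵥ y) ⬝ᵥ F *ᵥ ((regInv γ S * A * regInv γ S) *ᵥ y)) +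
      ((1 + y ⬝ᵥ regInv γ S *ᵥ y)⁻¹) ^ 2 * (y ⬝ᵥ (regInv γ S * A * regInv γ S) *ᵥ y) *
        ((regInv γ S *ᵥ y) ⬝ᵥ F *ᵥ (regInv γ S *ᵥ y)) := by
  have hQ := regInv_symm hγ hS
  rw [regInv_add_vecMulVec hγ hS, dot_sandwich hQ A y y]
  set s := (1 + y ⬝ᵥ regInv γ S *ᵥ y)⁻¹
  have hBy : (regInv γ S * A * regInv γ S) *ᵥ y = (regInv γ S * A) *ᵥ (regInv γ S *ᵥ y) := by
    rw [Matrix.mulVec_mulVec]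
  rw [hBy]
  set Q := regInv γ S
  set q := Q *ᵥ y
  have e1 : Q * A * Matrix.vecMulVec q q = Matrix.vecMulVec ((Q * A) *ᵥ q) q :=
    Matrix.mul_vecMulVec _ _ _
  have e2 : Matrix.vecMulVec q q * A * Q = Matrix.vecMulVec q ((Q * A) *ᵥ q) := by
    rw [mul_assoc, Matrix.vecMulVec_mul, ← Matrix.mulVec_transpose, Matrix.transpose_mul, hQ, hA]
  have e3 : Matrix.vecMulVec q q * A * Matrix.vecMulVec q q =
      (q ⬝ᵥ A *ᵥ q) • Matrix.vecMulVec q q := by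
    rw [mul_assoc, Matrix.mul_vecMulVec, Matrix.vecMulVec_mul_vecMulVec]
    ext j l
    simp [Matrix.vecMulVec_apply]
    ring
  have e4 : (Q - s • Matrix.vecMulVec q q) * A * (Q - s • Matrix.vecMulVec q q) =
      Q * A * Q - s • (Q * A * Matrix.vecMulVec q q) - s • (Matrix.vecMulVec q q * A * Q) +
        (s ^ 2) • (Matrix.vecMulVec q q * A * Matrix.vecMulVec q q) := by
    simp only [sub_mul, mul_sub, Matrix.smul_mul, Matrix.mul_smul, smul_smul, sq]
    abel
  rw [e4, e1, e2, e3]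
  simp only [mul_add, mul_sub, Matrix.mul_smul, Matrix.trace_add, Matrix.trace_sub,
    Matrix.trace_smul, trace_mul_vecMulVec, smul_eq_mul]
  rw [dot_mulVec_swap hF ((Q * A) *ᵥ q) q]
  ring

end TraceUpdate

namespace RowModel

variable {ι : Type} (M : RowModel ι) {γ K : ℝ} {A : ∀ i, Matrix (Fin (M.T i)) (Fin (M.T i)) ℝ}

/-- An exchangeable function of `N + 1` rows that changes by `O(1 / N)` when a row is left out
fluctuates by `O(N ^ (-1/2))`. -/
theorem lpBdd_of_leave_one_out {f : ∀ i, (Fin (M.N i + 1) → Fin (M.T i) → ℝ) → ℝ}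
    {f' : ∀ i, (Fin (M.N i) → Fin (M.T i) → ℝ) → ℝ}
    {h : ∀ i, (Fin (M.T i) → ℝ) × (Fin (M.N i) → Fin (M.T i) → ℝ) → ℝ}
    (hf : ∀ i, Measurable (f i)) (hf' : ∀ i, Measurable (f' i))
    (hbd : ∀ i, ∃ C, (∀ z, |f i z| ≤ C) ∧ ∀ z, |f' i z| ≤ C)
    (hfh : ∀ i (j : Fin (M.N i + 1)) q,
      f i (j.insertNth (α := fun _ => Fin (M.T i) → ℝ) q.1 q.2) = h i q)
    (hd : LpBdd 2 M.P (fun i ω => M.N i * (h i ω - f' i ω.2))) :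
    LpBdd 2 M.rows (fun i Y => Real.sqrt (M.N i) * (f' i Y - ∫ Z, f' i Z ∂(M.rows i))) ∧
    ∃ C, 0 ≤ C ∧ ∀ i, |∫ z, f i z ∂(Measure.pi fun _ : Fin (M.N i + 1) => M.ν i) -
      ∫ Z, f' i Z ∂(M.rows i)| ≤ C / Real.sqrt (M.N i) := by
  obtain ⟨hdm, C, hC⟩ := hd
  have key : ∀ i, M.N i * ∫ Y, (f' i Y - ∫ Z, f' i Z ∂(M.rows i)) ^ 2 ∂(M.rows i) ≤ 6 * C ∧
      M.N i * (∫ z, f i z ∂(Measure.pi fun _ : Fin (M.N i + 1) => M.ν i) -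
        ∫ Z, f' i Z ∂(M.rows i)) ^ 2 ≤ C := by
    intro i
    obtain ⟨B, hB, hB'⟩ := hbd i
    have hN1 : (1 : ℝ) ≤ M.N i := by exact_mod_cast M.one_le i
    have hins := measurable_insertNth (V := Fin (M.T i) → ℝ) (0 : Fin (M.N i + 1))
    have hhe : h i = fun q => f i ((0 : Fin (M.N i + 1)).insertNth
        (α := fun _ => Fin (M.T i) → ℝ) q.1 q.2) := funext fun q => (hfh i 0 q).symm
    have hhm : Measurable (h i) := by rw [hhe]; exact (hf i).comp hins
    have hhB : ∀ q, |h i q| ≤ B := fun q => by rw [hhe]; exact hB _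
    have hfm2 : Measurable fun ω : (Fin (M.T i) → ℝ) × (Fin (M.N i) → Fin (M.T i) → ℝ) =>
      f' i ω.2 := (hf' i).comp measurable_snd
    set c := ∫ z, f i z ∂(Measure.pi fun _ : Fin (M.N i + 1) => M.ν i) with hc
    have hcB : |c| ≤ B := by
      have := norm_integral_le_of_norm_le_const
        (μ := Measure.pi fun _ : Fin (M.N i + 1) => M.ν i) (C := B) (f := f i)
        (Eventually.of_forall fun x => hB x)
      simpa using this
    have hbd2 : ∀ a b : ℝ, |a| ≤ B → |b| ≤ B → |(a - b) ^ 2| ≤ (B + B) ^ 2 := by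
      intro a b ha hb
      rw [abs_pow]
      exact pow_le_pow_left₀ (abs_nonneg _) ((abs_sub _ _).trans (add_le_add ha hb)) 2
    have hI1 : Integrable (fun ω => (h i ω - f' i ω.2) ^ 2) (M.P i) :=
      integrable_of_abs_le ((hhm.sub hfm2).pow_const 2) _ fun ω => hbd2 _ _ (hhB _) (hB' _)
    have hI2 : Integrable (fun ω => (h i ω - c) ^ 2) (M.P i) :=
      integrable_of_abs_le ((hhm.sub_const c).pow_const 2) _ fun ω => hbd2 _ _ (hhB _) hcB
    set E := ∫ ω, (h i ω - f' i ω.2) ^ 2 ∂(M.P i) with hE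
    have hE0 : 0 ≤ E := integral_nonneg fun ω => sq_nonneg _
    have hEC : (M.N i : ℝ) ^ 2 * E ≤ C := by
      have h1 := hC i
      have e : (fun ω => ((M.N i : ℝ) * (h i ω - f' i ω.2)) ^ 2) =
          fun ω => (M.N i : ℝ) ^ 2 * (h i ω - f' i ω.2) ^ 2 := funext fun ω => mul_pow _ _ _
      rw [lintegral_enorm_sq (by rw [e]; exact hI1.const_mul _), e, integral_const_mul,
        ← ENNReal.ofReal_coe_nnreal, ENNReal.ofReal_le_ofReal_iff (NNReal.coe_nonneg C)] at h1
      exact h1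
    have hV := efronStein_exchangeable (M.ν i) (f i) (hf i) (f' i) (hf' i) B hB hB' (h i) (hfh i)
    have hmean : ∫ ω, h i ω ∂(M.P i) = c := by
      rw [hc, integral_pi_insertNth (M.ν i) 0, hhe]
    have hVP : ∫ ω, (h i ω - c) ^ 2 ∂(M.P i) =
        ∫ z, (f i z - c) ^ 2 ∂(Measure.pi fun _ : Fin (M.N i + 1) => M.ν i) := by
      rw [integral_pi_insertNth (M.ν i) 0, hhe]
    have hsnd : ∀ g : (Fin (M.N i) → Fin (M.T i) → ℝ) → ℝ,
        ∫ ω, g ω.2 ∂(M.P i) = ∫ Y, g Y ∂(M.rows i) := by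
      intro g
      have := integral_fun_snd (μ := M.ν i) (ν := M.rows i) g
      simpa using this
    constructor
    · have h1 : ∫ Y, (f' i Y - ∫ Z, f' i Z ∂(M.rows i)) ^ 2 ∂(M.rows i) ≤
          ∫ Y, (f' i Y - c) ^ 2 ∂(M.rows i) := by
        rw [integral_sub_const_sq (hf' i) B hB' c]
        linarith [sq_nonneg (∫ Z, f' i Z ∂(M.rows i) - c)]
      have h2 : ∫ Y, (f' i Y - c) ^ 2 ∂(M.rows i) ≤
          2 * E + 2 * ∫ ω, (h i ω - c) ^ 2 ∂(M.P i) := by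
        rw [← hsnd fun Y => (f' i Y - c) ^ 2, hE, ← integral_const_mul, ← integral_const_mul,
          ← integral_add (hI1.const_mul _) (hI2.const_mul _)]
        refine integral_mono ?_ ((hI1.const_mul _).add (hI2.const_mul _)) fun ω => ?_
        · exact integrable_of_abs_le ((hfm2.sub_const c).pow_const 2) _
            fun ω => hbd2 _ _ (hB' _) hcB
        · simp only
          nlinarith [sq_nonneg ((h i ω - f' i ω.2) + (h i ω - c))]
      rw [hVP] at h2
      have h3 : ∫ Y, (f' i Y - ∫ Z, f' i Z ∂(M.rows i)) ^ 2 ∂(M.rows i) ≤ 6 * (M.N i * E) := by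
        have h4 : ((M.N i : ℝ) + 1) * E ≤ 2 * (M.N i * E) := by nlinarith
        nlinarith
      nlinarith
    · have h1 : c - ∫ Z, f' i Z ∂(M.rows i) = ∫ ω, (h i ω - f' i ω.2) ∂(M.P i) - 0 := by
        rw [sub_zero, integral_sub, hmean, hsnd]
        · exact integrable_of_abs_le hhm B hhB
        · exact integrable_of_abs_le hfm2 B fun ω => hB' _
      rw [h1]
      have h2 := sq_integral_sub_le (μ := M.P i) (hhm.sub hfm2) (B + B)
        (fun ω => (abs_sub _ _).trans (add_le_add (hhB _) (hB' _))) 0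
      have h3 : (∫ ω, (h i ω - f' i ω.2) ∂(M.P i) - 0) ^ 2 ≤ E := by simpa [hE] using h2
      nlinarith
  refine ⟨⟨fun i => ((hf' i).sub_const _).const_mul _, 6 * C, fun i => ?_⟩, Real.sqrt C,
    Real.sqrt_nonneg _, fun i => ?_⟩
  · have e : (fun Y => (Real.sqrt (M.N i) * (f' i Y - ∫ Z, f' i Z ∂(M.rows i))) ^ 2) =
        fun Y => (M.N i : ℝ) * (f' i Y - ∫ Z, f' i Z ∂(M.rows i)) ^ 2 := funext fun Y => by
      rw [mul_pow, Real.sq_sqrt (M.N_pos i).le]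
    obtain ⟨B, -, hB'⟩ := hbd i
    have hi : Integrable (fun Y => (f' i Y - ∫ Z, f' i Z ∂(M.rows i)) ^ 2) (M.rows i) := by
      refine integrable_of_abs_le (((hf' i).sub_const _).pow_const 2)
        ((B + |∫ Z, f' i Z ∂(M.rows i)|) ^ 2) fun Y => ?_
      rw [abs_pow]
      exact pow_le_pow_left₀ (abs_nonneg _) ((abs_sub _ _).trans (add_le_add (hB' _) le_rfl)) 2
    rw [lintegral_enorm_sq (by rw [e]; exact hi.const_mul _), e, integral_const_mul,
      ← ENNReal.ofReal_coe_nnreal]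
    refine ENNReal.ofReal_le_ofReal ?_
    push_cast
    exact (key i).1
  · have hN := Real.sqrt_pos.2 (M.N_pos i)
    rw [le_div_iff₀ hN]
    refine Real.le_sqrt_of_sq_le ?_
    rw [mul_pow, sq_abs, Real.sq_sqrt (M.N_pos i).le, mul_comm]
    exact (key i).2

theorem trace_mul_regInv_le (hγ : 0 < γ) (i : ι) (n : ℕ) (z : Fin n → Fin (M.T i) → ℝ) :
    |(M.F i * regInv γ (gram z)).trace| ≤ γ⁻¹ * (M.F i).trace := by
  refine abs_trace_mul_le (M.F_psd i) fun x => ?_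
  rw [abs_of_nonneg (PSD.nonneg (regInv_posSemidef hγ (gram_posSemidef z)) x)]
  exact regInv_quad_le hγ (gram_posSemidef z) x

/-- A crude bound, not uniform in the family, which serves to prove integrability. -/
theorem SpikeBdd.le_norm {τ : Type*} [Fintype τ] {K : ℝ} (hK : 0 ≤ K) {n : ℕ} {m : τ → ℝ}
    {A : Matrix τ τ ℝ} (hA : SpikeBdd K n m A) (x : τ → ℝ) :
    x ⬝ᵥ A *ᵥ x ≤ K * (1 + n * (m ⬝ᵥ m)) * (x ⬝ᵥ x) := by
  have h1 := hA.le x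
  have h2 := dot_sq_le m x
  have h3 : (n : ℝ) * (m ⬝ᵥ x) ^ 2 ≤ n * ((m ⬝ᵥ m) * (x ⬝ᵥ x)) := by gcongr
  have h4 : K * (x ⬝ᵥ x + n * (m ⬝ᵥ x) ^ 2) ≤ K * (x ⬝ᵥ x + n * ((m ⬝ᵥ m) * (x ⬝ᵥ x))) := by gcongr
  calc _ ≤ _ := h1.trans h4
    _ = _ := by ring

theorem sandwich_quad_le (hγ : 0 < γ) (hK : 0 ≤ K)
    (hA : ∀ i, SpikeBdd K (M.N i) (M.m i) (A i)) (i : ι) (n : ℕ)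
    (Y : Fin n → Fin (M.T i) → ℝ) (x : Fin (M.T i) → ℝ) :
    x ⬝ᵥ (regInv γ (gram Y) * A i * regInv γ (gram Y)) *ᵥ x ≤
      K * (1 + M.N i * (M.m i ⬝ᵥ M.m i)) * (γ⁻¹) ^ 2 * (x ⬝ᵥ x) := by
  have hc : 0 ≤ K * (1 + M.N i * (M.m i ⬝ᵥ M.m i)) :=
    mul_nonneg hK (add_nonneg zero_le_one (mul_nonneg (M.N_pos i).le (dot_self_nonneg _)))
  rw [dot_sandwich (regInv_symm hγ (gram_posSemidef Y)), mul_assoc]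
  refine (SpikeBdd.le_norm hK (hA i) _).trans ?_
  exact mul_le_mul_of_nonneg_left (regInv_norm_le' hγ (gram_posSemidef Y) x) hc

theorem exists_trace_B_le (hγ : 0 < γ) (hK : 0 ≤ K)
    (hA : ∀ i, SpikeBdd K (M.N i) (M.m i) (A i)) (i : ι) :
    ∃ C, ∀ (n : ℕ) (Y : Fin n → Fin (M.T i) → ℝ),
      |(M.F i * (regInv γ (gram Y) * A i * regInv γ (gram Y))).trace| ≤ C := by
  refine ⟨K * (1 + M.N i * (M.m i ⬝ᵥ M.m i)) * (γ⁻¹) ^ 2 * (M.F i).trace,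
    fun n Y => abs_trace_mul_le (M.F_psd i) fun x => ?_⟩
  rw [abs_of_nonneg (PSD.nonneg (sandwich_posSemidef
    (regInv_posSemidef hγ (gram_posSemidef Y)) (hA i).psd) x)]
  exact M.sandwich_quad_le hγ hK hA i n Y x

theorem inv_one_add_mem (hγ : 0 < γ) (i : ι)
    (ω : (Fin (M.T i) → ℝ) × (Fin (M.N i) → Fin (M.T i) → ℝ)) :
    0 ≤ (1 + ω.1 ⬝ᵥ M.Q γ i ω.2 *ᵥ ω.1)⁻¹ ∧ (1 + ω.1 ⬝ᵥ M.Q γ i ω.2 *ᵥ ω.1)⁻¹ ≤ 1 := by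
  have h := PSD.nonneg (M.Q_psd hγ i ω.2) ω.1
  exact ⟨by positivity, inv_le_one_of_one_le₀ (by linarith)⟩

/-- `tr (F Q)` fluctuates by `O(N ^ (-1/2))`, and its mean changes by as little when a row is added. -/
theorem trace_Q_fluct (hγ : 0 < γ) :
    LpBdd 2 M.rows (fun i Y => Real.sqrt (M.N i) * ((M.F i * M.Q γ i Y).trace -
      ∫ Z, (M.F i * M.Q γ i Z).trace ∂(M.rows i))) ∧
    ∃ C, 0 ≤ C ∧ ∀ i, |∫ z, (M.F i * regInv γ (gram z)).trace
      ∂(Measure.pi fun _ : Fin (M.N i + 1) => M.ν i) -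
      ∫ Z, (M.F i * M.Q γ i Z).trace ∂(M.rows i)| ≤ C / Real.sqrt (M.N i) := by
  refine M.lpBdd_of_leave_one_out
    (h := fun i q => (M.F i * regInv γ (Matrix.vecMulVec q.1 q.1 + gram q.2)).trace)
    (fun i => ((MatMeasurable.const _).mul (matMeasurable_regInv_gram _ _)).trace)
    (fun i => ((MatMeasurable.const _).mul (M.matMeasurable_Q γ i)).trace)
    (fun i => ?_) (fun i j q => by rw [gram_insertNth]) ?_
  · exact ⟨_, M.trace_mul_regInv_le hγ i _, M.trace_mul_regInv_le hγ i _⟩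
  · refine (M.bdd_Q_F_Q hγ 2).mono (fun i => ?_) fun i ω => ?_
    · have h1 : Measurable fun q : (Fin (M.T i) → ℝ) × (Fin (M.N i) → Fin (M.T i) → ℝ) =>
          (M.F i * regInv γ (Matrix.vecMulVec q.1 q.1 + gram q.2)).trace := by
        have := ((MatMeasurable.const (M.F i)).mul (matMeasurable_regInv_gram γ (M.N i + 1))).trace.comp
          (measurable_insertNth (V := Fin (M.T i) → ℝ) (0 : Fin (M.N i + 1)))
        simpa only [Function.comp_def, gram_insertNth] using this
      exact (h1.sub ((((MatMeasurable.const _).mul (M.matMeasurable_Q γ i)).trace).comp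
        measurable_snd)).const_mul _
    · rw [trace_regInv_add_vecMulVec hγ (gram_posSemidef _)]
      obtain ⟨h0, h1⟩ := M.inv_one_add_mem hγ i ω
      rw [abs_mul, abs_mul]
      refine mul_le_mul_of_nonneg_left ?_ (abs_nonneg _)
      rw [sub_sub_cancel_left, abs_neg, abs_mul, abs_of_nonneg h0]
      exact mul_le_of_le_one_left (abs_nonneg _) h1

/-- `tr (F Q A Q)` fluctuates by `O(N ^ (-1/2))`, and its mean changes by as little when a row is
added. -/
theorem trace_B_fluct (hγ : 0 < γ) (hK : 0 ≤ K)
    (hA : ∀ i, SpikeBdd K (M.N i) (M.m i) (A i)) :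
    LpBdd 2 M.rows (fun i Y => Real.sqrt (M.N i) * ((M.F i * M.B γ A i Y).trace -
      ∫ Z, (M.F i * M.B γ A i Z).trace ∂(M.rows i))) ∧
    ∃ C, 0 ≤ C ∧ ∀ i, |∫ z, (M.F i * (regInv γ (gram z) * A i * regInv γ (gram z))).trace
      ∂(Measure.pi fun _ : Fin (M.N i + 1) => M.ν i) -
      ∫ Z, (M.F i * M.B γ A i Z).trace ∂(M.rows i)| ≤ C / Real.sqrt (M.N i) := by
  refine M.lpBdd_of_leave_one_out
    (h := fun i q => (M.F i * (regInv γ (Matrix.vecMulVec q.1 q.1 + gram q.2) * A i *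
      regInv γ (Matrix.vecMulVec q.1 q.1 + gram q.2))).trace)
    (fun i => ((MatMeasurable.const _).mul (((matMeasurable_regInv_gram _ _).mul
      (MatMeasurable.const _)).mul (matMeasurable_regInv_gram _ _))).trace)
    (fun i => ((MatMeasurable.const _).mul (M.matMeasurable_B γ A i)).trace)
    (fun i => ?_) (fun i j q => by rw [gram_insertNth]) ?_
  · obtain ⟨C, hC⟩ := M.exists_trace_B_le hγ hK hA i
    exact ⟨C, hC _, hC _⟩
  · have hb : MomentBdd M.P (fun i ω =>
        M.N i * ((M.Q γ i ω.2 *ᵥ ω.1) ⬝ᵥ M.F i *ᵥ (M.Q γ i ω.2 *ᵥ ω.1)) +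
        M.N i * ((M.B γ A i ω.2 *ᵥ ω.1) ⬝ᵥ M.F i *ᵥ (M.B γ A i ω.2 *ᵥ ω.1)) +
        (ω.1 ⬝ᵥ M.B γ A i ω.2 *ᵥ ω.1) *
          (M.N i * ((M.Q γ i ω.2 *ᵥ ω.1) ⬝ᵥ M.F i *ᵥ (M.Q γ i ω.2 *ᵥ ω.1)))) :=
      ((M.bdd_Q_F_Q hγ).add (M.bdd_B_F_B hγ hK hA)).add
        ((M.bdd_B_quad hγ hK hA).mul (M.bdd_Q_F_Q hγ))
    refine (hb 2).mono (fun i => ?_) fun i ω => ?_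
    · have h1 : Measurable fun q : (Fin (M.T i) → ℝ) × (Fin (M.N i) → Fin (M.T i) → ℝ) =>
          (M.F i * (regInv γ (Matrix.vecMulVec q.1 q.1 + gram q.2) * A i *
            regInv γ (Matrix.vecMulVec q.1 q.1 + gram q.2))).trace := by
        have := ((MatMeasurable.const (M.F i)).mul (((matMeasurable_regInv_gram γ (M.N i + 1)).mul
          (MatMeasurable.const (A i))).mul (matMeasurable_regInv_gram γ (M.N i + 1)))).trace.comp
          (measurable_insertNth (V := Fin (M.T i) → ℝ) (0 : Fin (M.N i + 1)))
        simpa only [Function.comp_def, gram_insertNth] using this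
      exact (h1.sub ((((MatMeasurable.const _).mul (M.matMeasurable_B γ A i)).trace).comp
        measurable_snd)).const_mul _
    · rw [trace_sandwich_add_vecMulVec hγ (gram_posSemidef _) (PSD.symm (M.F_psd i))
        (PSD.symm (hA i).psd)]
      obtain ⟨h0, h1⟩ := M.inv_one_add_mem hγ i ω
      have hq := PSD.nonneg (M.F_psd i) (M.Q γ i ω.2 *ᵥ ω.1)
      have hq2 := PSD.nonneg (M.F_psd i) (M.B γ A i ω.2 *ᵥ ω.1)
      have hx := PSD.two_mul_le (M.F_psd i) (M.Q γ i ω.2 *ᵥ ω.1) (M.B γ A i ω.2 *ᵥ ω.1)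
      have hB := PSD.nonneg (M.B_psd hγ (fun i => (hA i).psd) i ω.2) ω.1
      have hN := (M.N_pos i).le
      set s := (1 + ω.1 ⬝ᵥ M.Q γ i ω.2 *ᵥ ω.1)⁻¹
      set x := (M.Q γ i ω.2 *ᵥ ω.1) ⬝ᵥ M.F i *ᵥ (M.B γ A i ω.2 *ᵥ ω.1)
      set q := (M.Q γ i ω.2 *ᵥ ω.1) ⬝ᵥ M.F i *ᵥ (M.Q γ i ω.2 *ᵥ ω.1)
      set q2 := (M.B γ A i ω.2 *ᵥ ω.1) ⬝ᵥ M.F i *ᵥ (M.B γ A i ω.2 *ᵥ ω.1)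
      set dA := ω.1 ⬝ᵥ M.B γ A i ω.2 *ᵥ ω.1
      have e : ∀ t : ℝ, t - 2 * s * x + s ^ 2 * dA * q - t = -(2 * s * x) + s ^ 2 * dA * q :=
        fun t => by ring
      have hs2 : s ^ 2 ≤ 1 := pow_le_one₀ h0 h1
      rw [e, abs_mul, abs_of_nonneg hN]
      refine le_trans ?_ (le_abs_self _)
      calc (M.N i : ℝ) * |-(2 * s * x) + s ^ 2 * dA * q|
          ≤ M.N i * (|-(2 * s * x)| + |s ^ 2 * dA * q|) := by gcongr; exact abs_add_le _ _
        _ = M.N i * (s * (2 * |x|) + s ^ 2 * (dA * q)) := by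
            rw [abs_neg, abs_mul, abs_mul, abs_of_nonneg h0, abs_two,
              abs_of_nonneg (by positivity : 0 ≤ s ^ 2 * dA * q)]
            ring
        _ ≤ M.N i * (1 * (q + q2) + 1 * (dA * q)) := by gcongr
        _ = _ := by ring

end RowModel
end RandomFeatures

namespace RandomFeatures

/-! ### Expansion of the resolvent around its deterministic equivalent -/

section Exchangeable

variable {V : Type} [MeasurableSpace V] (ν : Measure V) [IsProbabilityMeasure ν]

theorem integrable_pi_insertNth {n : ℕ} (j : Fin (n + 1)) {f : (Fin (n + 1) → V) → ℝ}
    (h : Integrable (fun q : V × (Fin n → V) => f (j.insertNth (α := fun _ => V) q.1 q.2))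
      (ν.prod (Measure.pi fun _ : Fin n => ν))) :
    Integrable f (Measure.pi fun _ : Fin (n + 1) => ν) :=
  ((measurePreserving_piFinSuccAbove (fun _ : Fin (n + 1) => ν) j).symm.integrable_comp_emb
    (MeasurableEquiv.measurableEmbedding _)).1 h

end Exchangeable

section Expansion

theorem abs_dot_le {τ : Type*} [Fintype τ] (x y : τ → ℝ) : |x ⬝ᵥ y| ≤ x ⬝ᵥ x + y ⬝ᵥ y := by
  have h := dot_sq_le x y
  have hx := dot_self_nonneg x
  have hy := dot_self_nonneg y
  refine abs_le_of_sq_le_sq ?_ (by positivity)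
  nlinarith [mul_nonneg hx hy]

variable {τ : Type} [Fintype τ] {ν : Measure (τ → ℝ)} [IsProbabilityMeasure ν]

/-- By exchangeability, each of the terms `yⱼ yⱼᵀ` of the sample matrix gives the same contribution
to the mean of `w ⬝ (∑ⱼ yⱼ yⱼᵀ) c`. -/
theorem integral_sub_gram {n : ℕ} {c : (Fin (n + 1) → τ → ℝ) → τ → ℝ}
    {c' : (τ → ℝ) × (Fin n → τ → ℝ) → τ → ℝ} (w w' : τ → ℝ)
    (hc : ∀ (j : Fin (n + 1)) q, c (j.insertNth (α := fun _ => τ → ℝ) q.1 q.2) = c' q)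
    (h1 : Integrable (fun q => w' ⬝ᵥ c' q) (ν.prod (Measure.pi fun _ : Fin n => ν)))
    (h2 : Integrable (fun q => (q.1 ⬝ᵥ w) * (q.1 ⬝ᵥ c' q))
      (ν.prod (Measure.pi fun _ : Fin n => ν))) :
    ∫ z, (w' ⬝ᵥ c z - w ⬝ᵥ gram z *ᵥ c z) ∂(Measure.pi fun _ : Fin (n + 1) => ν) =
      ∫ q, (w' ⬝ᵥ c' q - (n + 1) * ((q.1 ⬝ᵥ w) * (q.1 ⬝ᵥ c' q)))
        ∂(ν.prod (Measure.pi fun _ : Fin n => ν)) := by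
  have i1 : Integrable (fun z => w' ⬝ᵥ c z) (Measure.pi fun _ : Fin (n + 1) => ν) :=
    integrable_pi_insertNth ν 0 (by simpa only [hc] using h1)
  have e2 : ∀ (j : Fin (n + 1)) (q : (τ → ℝ) × (Fin n → τ → ℝ)),
      (w ⬝ᵥ (j.insertNth (α := fun _ => τ → ℝ) q.1 q.2) j) *
        ((j.insertNth (α := fun _ => τ → ℝ) q.1 q.2) j ⬝ᵥ
          c (j.insertNth (α := fun _ => τ → ℝ) q.1 q.2)) = (q.1 ⬝ᵥ w) * (q.1 ⬝ᵥ c' q) := by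
    intro j q
    rw [hc, Fin.insertNth_apply_same, dotProduct_comm w]
  have i2 : ∀ j : Fin (n + 1), Integrable (fun z => (w ⬝ᵥ z j) * (z j ⬝ᵥ c z))
      (Measure.pi fun _ : Fin (n + 1) => ν) := fun j =>
    integrable_pi_insertNth ν j (by simpa only [e2] using h2)
  simp only [dot_gram_mulVec]
  rw [integral_sub i1 (integrable_finsetSum _ fun j _ => i2 j), integral_finsetSum _ fun j _ => i2 j,
    integral_sub h1 (h2.const_mul _), integral_const_mul, integral_pi_insertNth ν 0]
  have e3 : ∀ j : Fin (n + 1), ∫ z, (w ⬝ᵥ z j) * (z j ⬝ᵥ c z)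
      ∂(Measure.pi fun _ : Fin (n + 1) => ν) = ∫ q, (q.1 ⬝ᵥ w) * (q.1 ⬝ᵥ c' q)
        ∂(ν.prod (Measure.pi fun _ : Fin n => ν)) := fun j => by
    rw [integral_pi_insertNth ν j]
    simp only [e2]
  simp only [e3, hc, Finset.sum_const, Finset.card_univ, Fintype.card_fin, nsmul_eq_mul]
  push_cast
  rfl

/-- The difference of two resolvents, tested against vectors. -/
theorem dot_regInv_sub [DecidableEq τ] {γ : ℝ} (hγ : 0 < γ) {S Ψ : Matrix τ τ ℝ} (hS : S.PosSemidef)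
    (hΨ : Ψ.PosSemidef) (a x : τ → ℝ) :
    a ⬝ᵥ regInv γ S *ᵥ x - a ⬝ᵥ regInv γ Ψ *ᵥ x =
      (Ψ *ᵥ (regInv γ Ψ *ᵥ a)) ⬝ᵥ (regInv γ S *ᵥ x) -
        (regInv γ Ψ *ᵥ a) ⬝ᵥ S *ᵥ (regInv γ S *ᵥ x) := by
  rw [← dotProduct_sub, ← Matrix.sub_mulVec, regInv_sub hγ hS hΨ, ← Matrix.mulVec_mulVec,
    ← Matrix.mulVec_mulVec, dot_mulVec_comm (regInv_symm hγ hΨ), Matrix.sub_mulVec, dotProduct_sub,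
    dot_mulVec_comm (PSD.symm hΨ)]

end Expansion

namespace RowModel

variable {ι : Type} (M : RowModel ι) {γ K : ℝ} {A : ∀ i, Matrix (Fin (M.T i)) (Fin (M.T i)) ℝ}

theorem bdd_of_sqrt_mul {X : ∀ i, (Fin (M.T i) → ℝ) × (Fin (M.N i) → Fin (M.T i) → ℝ) → ℝ}
    (hXm : ∀ i, Measurable (X i)) (hX : MomentBdd M.P fun i ω => Real.sqrt (M.N i) * X i ω) :
    MomentBdd M.P X := by
  refine hX.mono hXm fun i ω => ?_
  rw [abs_mul, abs_of_nonneg (Real.sqrt_nonneg _)]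
  refine le_mul_of_one_le_left (abs_nonneg _) (Real.one_le_sqrt.2 ?_)
  exact_mod_cast M.one_le i

theorem abs_integral_le_div_sqrt
    {X : ∀ i, (Fin (M.T i) → ℝ) × (Fin (M.N i) → Fin (M.T i) → ℝ) → ℝ}
    (hX : LpBdd 1 M.P fun i ω => Real.sqrt (M.N i) * X i ω) :
    ∃ C, 0 ≤ C ∧ ∀ i, |∫ ω, X i ω ∂(M.P i)| ≤ C / Real.sqrt (M.N i) := by
  obtain ⟨C, hC, h⟩ := hX.abs_integral_le
  refine ⟨C, hC, fun i => ?_⟩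
  have hN := Real.sqrt_pos.2 (M.N_pos i)
  rw [le_div_iff₀ hN]
  have h1 := h i
  rw [integral_const_mul, abs_mul, abs_of_pos hN] at h1
  linarith

/-- If the row `y` is independent of the vector `H`, then
`E[(Ψ Q̄ a) ⬝ H] = (n / (1 + d)) E[(y ⬝ Q̄ a) (y ⬝ H)]`. -/
theorem integral_psiVec_dot {d : ι → ℝ} {a : ∀ i, Fin (M.T i) → ℝ} (i : ι)
    {H : (Fin (M.N i) → Fin (M.T i) → ℝ) → Fin (M.T i) → ℝ}
    (h : Integrable (fun ω => (ω.1 ⬝ᵥ detRes γ (M.N i + 1) (M.F i) (d i) *ᵥ a i) *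
      (ω.1 ⬝ᵥ H ω.2)) (M.P i)) :
    ∫ Y, M.psiVec γ d a i ⬝ᵥ H Y ∂(M.rows i) = ((M.N i + 1 : ℝ) / (1 + d i)) *
      ∫ ω, (ω.1 ⬝ᵥ detRes γ (M.N i + 1) (M.F i) (d i) *ᵥ a i) * (ω.1 ⬝ᵥ H ω.2) ∂(M.P i) := by
  rw [integral_prod_symm _ h, ← integral_const_mul]
  congr 1
  funext Y
  simp only
  rw [integral_dot_mul_dot (M.integrable_sq i), dot_mulVec_comm secondMoment_symm, psiVec,
    Matrix.smul_mulVec, smul_dotProduct, smul_eq_mul]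

theorem integral_snd (i : ι) (g : (Fin (M.N i) → Fin (M.T i) → ℝ) → ℝ) :
    ∫ ω, g ω.2 ∂(M.P i) = ∫ Y, g Y ∂(M.rows i) := by
  simpa using integral_fun_snd (μ := M.ν i) (ν := M.rows i) g

/-- The mean difference of the resolvent of `N + 1` rows and of its deterministic equivalent, tested
against a fixed vector `a` and a random vector `g`, in terms of the last row and of the others. -/
theorem integral_regInv_sub_detRes (hγ : 0 < γ) {d : ι → ℝ} (hd : ∀ i, 0 ≤ d i)
    (a : ∀ i, Fin (M.T i) → ℝ) (i : ι)
    {g : (Fin (M.N i + 1) → Fin (M.T i) → ℝ) → Fin (M.T i) → ℝ}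
    {c : (Fin (M.T i) → ℝ) × (Fin (M.N i) → Fin (M.T i) → ℝ) → Fin (M.T i) → ℝ}
    (hc : ∀ (j : Fin (M.N i + 1)) (q : (Fin (M.T i) → ℝ) × (Fin (M.N i) → Fin (M.T i) → ℝ)),
      regInv γ (gram (j.insertNth (α := fun _ => Fin (M.T i) → ℝ) q.1 q.2)) *ᵥ
        g (j.insertNth (α := fun _ => Fin (M.T i) → ℝ) q.1 q.2) = c q)
    (h1 : Integrable (fun q => M.psiVec γ d a i ⬝ᵥ c q) (M.P i))
    (h2 : Integrable (fun q => (q.1 ⬝ᵥ detRes γ (M.N i + 1) (M.F i) (d i) *ᵥ a i) *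
      (q.1 ⬝ᵥ c q)) (M.P i))
    (h3 : Integrable (fun z => a i ⬝ᵥ regInv γ (gram z) *ᵥ g z)
      (Measure.pi fun _ : Fin (M.N i + 1) => M.ν i))
    (h4 : Integrable (fun z => a i ⬝ᵥ detRes γ (M.N i + 1) (M.F i) (d i) *ᵥ g z)
      (Measure.pi fun _ : Fin (M.N i + 1) => M.ν i)) :
    ∫ z, a i ⬝ᵥ regInv γ (gram z) *ᵥ g z ∂(Measure.pi fun _ : Fin (M.N i + 1) => M.ν i) -
      ∫ z, a i ⬝ᵥ detRes γ (M.N i + 1) (M.F i) (d i) *ᵥ g z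
        ∂(Measure.pi fun _ : Fin (M.N i + 1) => M.ν i) =
    ∫ q, (M.psiVec γ d a i ⬝ᵥ c q - (M.N i + 1) *
      ((q.1 ⬝ᵥ detRes γ (M.N i + 1) (M.F i) (d i) *ᵥ a i) * (q.1 ⬝ᵥ c q))) ∂(M.P i) := by
  have hd1 : 0 < 1 + d i := by linarith [hd i]
  have hΨ : (((M.N i + 1 : ℝ) / (1 + d i)) • M.F i).PosSemidef :=
    (M.F_psd i).smul (by positivity)
  rw [← integral_sub_gram (c := fun z => regInv γ (gram z) *ᵥ g z) _ _ hc h1 h2,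
    ← integral_sub h3 h4]
  exact integral_congr_ae (Eventually.of_forall fun z =>
    dot_regInv_sub hγ (gram_posSemidef z) hΨ (a i) (g z))

end RowModel
end RandomFeatures

namespace RandomFeatures

theorem integral_sub_sub_add {Ω : Type*} [MeasurableSpace Ω] {μ : Measure Ω} {f g h k : Ω → ℝ}
    (hf : Integrable f μ) (hg : Integrable g μ) (hh : Integrable h μ) (hk : Integrable k μ) :
    ∫ x, (f x - g x - h x + k x) ∂μ =
      ∫ x, f x ∂μ - ∫ x, g x ∂μ - ∫ x, h x ∂μ + ∫ x, k x ∂μ := by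
  have h1 := integral_add ((hf.sub hg).sub hh) hk
  have h2 := integral_sub (hf.sub hg) hh
  have h3 := integral_sub hf hg
  simp only [Pi.sub_apply] at h1 h2 h3
  rw [h1, h2, h3]

namespace RowModel

variable {ι : Type} (M : RowModel ι) {γ K : ℝ} {A : ∀ i, Matrix (Fin (M.T i)) (Fin (M.T i)) ℝ}

theorem bdd_Q_bilin (hγ : 0 < γ) {a b : ∀ i, Fin (M.T i) → ℝ} {R : ℝ}
    (ha : ∀ i, a i ⬝ᵥ a i ≤ R) (hb : ∀ i, b i ⬝ᵥ b i ≤ R) :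
    MomentBdd M.rows (fun i Y => a i ⬝ᵥ M.Q γ i Y *ᵥ b i) := by
  refine MomentBdd.of_bound (fun i => measurable_dot measurable_const
    ((M.matMeasurable_Q γ i).mulVec measurable_const)) (R + (γ⁻¹) ^ 2 * R) fun i Y => ?_
  refine (abs_dot_le _ _).trans (add_le_add (ha i) ?_)
  refine (regInv_norm_le' hγ (gram_posSemidef Y) (b i)).trans ?_
  gcongr
  exact hb i

theorem bdd_B_bilin (hγ : 0 < γ) (hK : 0 ≤ K) (hA : ∀ i, SpikeBdd K (M.N i) (M.m i) (A i))
    {a b : ∀ i, Fin (M.T i) → ℝ} {R : ℝ}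
    (ha : ∀ i, a i ⬝ᵥ a i ≤ R) (hb : ∀ i, b i ⬝ᵥ b i ≤ R) :
    MomentBdd M.rows (fun i Y => a i ⬝ᵥ M.B γ A i Y *ᵥ b i) := by
  refine ((MomentBdd.const R).add (((M.bdd_G γ K).pow 2).mul (MomentBdd.const R))).mono
    (fun i => measurable_dot measurable_const
    ((M.matMeasurable_B γ A i).mulVec measurable_const)) fun i Y => ?_
  refine ((abs_dot_le _ _).trans (add_le_add (ha i) ?_)).trans (le_abs_self _)
  refine (M.B_norm_le hγ hK hA i Y (b i)).trans ?_
  gcongr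
  exact hb i

/-- The bounded random variable `1 / (1 + y ⬝ Q y)`. -/
theorem bdd_inv_one_add (hγ : 0 < γ) :
    MomentBdd M.P (fun i ω => (1 + ω.1 ⬝ᵥ M.Q γ i ω.2 *ᵥ ω.1)⁻¹) := by
  refine MomentBdd.of_bound (fun i => ?_) 1 fun i ω => ?_
  · exact (measurable_const.add (M.measurable_dot_snd (M.matMeasurable_Q γ i) measurable_fst
      measurable_fst)).inv
  · obtain ⟨h0, h1⟩ := M.inv_one_add_mem hγ i ω
    rwa [abs_of_nonneg h0]

/-- If `y ⬝ Q y = d + O(N ^ (-1/2))`, then `1 / (1 + d) - 1 / (1 + y ⬝ Q y)` is of order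
`N ^ (-1/2)`. -/
theorem lpBdd_inv_sub (hγ : 0 < γ) {d : ι → ℝ} (hd : ∀ i, 0 ≤ d i)
    (hDd : LpBdd 2 M.P fun i ω => Real.sqrt (M.N i) * (ω.1 ⬝ᵥ M.Q γ i ω.2 *ᵥ ω.1 - d i)) :
    LpBdd 2 M.P fun i ω => Real.sqrt (M.N i) *
      ((1 + d i)⁻¹ - (1 + ω.1 ⬝ᵥ M.Q γ i ω.2 *ᵥ ω.1)⁻¹) := by
  refine hDd.mono (fun i => ((measurable_const).sub ((M.bdd_inv_one_add hγ 1).1 i)).const_mul _)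
    fun i ω => ?_
  have hD := PSD.nonneg (M.Q_psd hγ i ω.2) ω.1
  have h1 : (0 : ℝ) < 1 + d i := by linarith [hd i]
  have h2 : (0 : ℝ) < 1 + ω.1 ⬝ᵥ M.Q γ i ω.2 *ᵥ ω.1 := by linarith
  rw [abs_mul, abs_mul]
  refine mul_le_mul_of_nonneg_left ?_ (abs_nonneg _)
  rw [inv_sub_inv h1.ne' h2.ne', abs_div, abs_of_pos (mul_pos h1 h2),
    show 1 + ω.1 ⬝ᵥ M.Q γ i ω.2 *ᵥ ω.1 - (1 + d i) = ω.1 ⬝ᵥ M.Q γ i ω.2 *ᵥ ω.1 - d i by ring]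
  refine div_le_self (abs_nonneg _) ?_
  nlinarith [hd i]

/-- The ratio `(N + 1) / N`, as a bounded variable. -/
theorem bdd_ratio : MomentBdd M.P (fun i _ => ((M.N i + 1 : ℝ) / M.N i)) := by
  refine MomentBdd.of_bound (fun i => measurable_const) 2 fun i ω => ?_
  have hN := M.N_pos i
  have hN1 : (1 : ℝ) ≤ M.N i := by exact_mod_cast M.one_le i
  rw [abs_of_pos (by positivity), div_le_iff₀ hN]
  linarith

/-- The first-order expansion: `E[Q]` agrees with its deterministic equivalent up to
`O(N ^ (-1/2))`, and so does the mean resolvent of one row less, tested against `Ψ Q̄ a`. -/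
theorem first_order (hγ : 0 < γ) {d : ι → ℝ} (hd : ∀ i, 0 ≤ d i) {D : ℝ} (hD : ∀ i, d i ≤ D)
    (hDd : LpBdd 2 M.P fun i ω => Real.sqrt (M.N i) * (ω.1 ⬝ᵥ M.Q γ i ω.2 *ᵥ ω.1 - d i))
    {a b : ∀ i, Fin (M.T i) → ℝ} {R : ℝ}
    (ha : ∀ i, a i ⬝ᵥ a i ≤ R) (hb : ∀ i, b i ⬝ᵥ b i ≤ R) :
    (∃ C, 0 ≤ C ∧ ∀ i, |∫ z, a i ⬝ᵥ regInv γ (gram z) *ᵥ b i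
        ∂(Measure.pi fun _ : Fin (M.N i + 1) => M.ν i) -
      a i ⬝ᵥ detRes γ (M.N i + 1) (M.F i) (d i) *ᵥ b i| ≤ C / Real.sqrt (M.N i)) ∧
    ∃ C, 0 ≤ C ∧ ∀ i, |∫ z, M.psiVec γ d a i ⬝ᵥ regInv γ (gram z) *ᵥ b i
        ∂(Measure.pi fun _ : Fin (M.N i + 1) => M.ν i) -
      ∫ Y, M.psiVec γ d a i ⬝ᵥ M.Q γ i Y *ᵥ b i ∂(M.rows i)| ≤ C / Real.sqrt (M.N i) := by
  have bu := M.bdd_detRes_linear hγ hd hD ha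
  have bv := M.bdd_Q_linear hγ hb
  have bw := M.bdd_Q_psiVec hγ hd ha
  have bs := M.bdd_inv_one_add hγ
  have bsd := M.lpBdd_inv_sub hγ hd hDd
  have mu : ∀ i, Measurable fun ω : (Fin (M.T i) → ℝ) × (Fin (M.N i) → Fin (M.T i) → ℝ) =>
      ω.1 ⬝ᵥ detRes γ (M.N i + 1) (M.F i) (d i) *ᵥ a i := fun i =>
    measurable_dot measurable_fst measurable_const
  have mv : ∀ i, Measurable fun ω : (Fin (M.T i) → ℝ) × (Fin (M.N i) → Fin (M.T i) → ℝ) =>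
      ω.1 ⬝ᵥ M.Q γ i ω.2 *ᵥ b i := fun i =>
    M.measurable_dot_snd (M.matMeasurable_Q γ i) measurable_fst measurable_const
  have bu1 := M.bdd_of_sqrt_mul mu bu
  have bv1 := M.bdd_of_sqrt_mul mv bv
  have ba : ∀ i, M.psiVec γ d a i ⬝ᵥ M.psiVec γ d a i ≤ R := fun i =>
    (M.psiVec_norm_le hγ hd a i).trans (ha i)
  have bQ := M.bdd_Q_bilin hγ ba hb
  -- the vector `Q b` for `N + 1` rows, in terms of the last row and of the others
  have hc : ∀ i (j : Fin (M.N i + 1)) (q : (Fin (M.T i) → ℝ) × (Fin (M.N i) → Fin (M.T i) → ℝ)),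
      regInv γ (gram (j.insertNth (α := fun _ => Fin (M.T i) → ℝ) q.1 q.2)) *ᵥ b i =
      M.Q γ i q.2 *ᵥ b i - ((q.1 ⬝ᵥ M.Q γ i q.2 *ᵥ b i) / (1 + q.1 ⬝ᵥ M.Q γ i q.2 *ᵥ q.1)) •
        (M.Q γ i q.2 *ᵥ q.1) := fun i j q => by
    rw [gram_insertNth, regInv_add_vecMulVec_mulVec hγ (gram_posSemidef _)]
  have e1 : ∀ i (q : (Fin (M.T i) → ℝ) × (Fin (M.N i) → Fin (M.T i) → ℝ)),
      M.psiVec γ d a i ⬝ᵥ (M.Q γ i q.2 *ᵥ b i - ((q.1 ⬝ᵥ M.Q γ i q.2 *ᵥ b i) /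
        (1 + q.1 ⬝ᵥ M.Q γ i q.2 *ᵥ q.1)) • (M.Q γ i q.2 *ᵥ q.1)) =
      M.psiVec γ d a i ⬝ᵥ M.Q γ i q.2 *ᵥ b i - (q.1 ⬝ᵥ M.Q γ i q.2 *ᵥ M.psiVec γ d a i) *
        ((q.1 ⬝ᵥ M.Q γ i q.2 *ᵥ b i) * (1 + q.1 ⬝ᵥ M.Q γ i q.2 *ᵥ q.1)⁻¹) := fun i q => by
    rw [dotProduct_sub, dotProduct_smul, smul_eq_mul,
      dot_mulVec_swap (PSD.symm (M.Q_psd hγ i q.2)) q.1 (M.psiVec γ d a i), div_eq_mul_inv]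
    ring
  have e2 : ∀ i (q : (Fin (M.T i) → ℝ) × (Fin (M.N i) → Fin (M.T i) → ℝ)),
      q.1 ⬝ᵥ (M.Q γ i q.2 *ᵥ b i - ((q.1 ⬝ᵥ M.Q γ i q.2 *ᵥ b i) /
        (1 + q.1 ⬝ᵥ M.Q γ i q.2 *ᵥ q.1)) • (M.Q γ i q.2 *ᵥ q.1)) =
      (q.1 ⬝ᵥ M.Q γ i q.2 *ᵥ b i) * (1 + q.1 ⬝ᵥ M.Q γ i q.2 *ᵥ q.1)⁻¹ := fun i q => by
    have hD : 0 ≤ q.1 ⬝ᵥ M.Q γ i q.2 *ᵥ q.1 := PSD.nonneg (M.Q_psd hγ i q.2) q.1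
    rw [dotProduct_sub, dotProduct_smul, smul_eq_mul]
    field_simp
    ring
  have bX1 : LpBdd 1 M.P fun i q => Real.sqrt (M.N i) *
      ((q.1 ⬝ᵥ M.Q γ i q.2 *ᵥ M.psiVec γ d a i) *
        ((q.1 ⬝ᵥ M.Q γ i q.2 *ᵥ b i) * (1 + q.1 ⬝ᵥ M.Q γ i q.2 *ᵥ q.1)⁻¹)) := by
    have h := (bw.mul (bv.mul bs)) 1
    refine h.mono (fun i => ?_) fun i q => le_of_eq (by congr 1; ring)
    exact ((((bw 1).1 i).mul ((mv i).mul ((bs 1).1 i)))).const_mul _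
  have bX2 : LpBdd 1 M.P fun i q => Real.sqrt (M.N i) * ((M.N i + 1) *
      ((q.1 ⬝ᵥ detRes γ (M.N i + 1) (M.F i) (d i) *ᵥ a i) * (q.1 ⬝ᵥ M.Q γ i q.2 *ᵥ b i) *
        ((1 + d i)⁻¹ - (1 + q.1 ⬝ᵥ M.Q γ i q.2 *ᵥ q.1)⁻¹))) := by
    have h := ((M.bdd_ratio).mul (bu.mul bv)).mul_lpBdd_two bsd
    refine h.mono (fun i => ?_) fun i q => le_of_eq ?_
    · exact ((((mu i).mul (mv i)).mul (measurable_const.sub ((bs 1).1 i))).const_mul _).const_mul _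
    · have hN := M.N_pos i
      have hs := Real.mul_self_sqrt hN.le
      congr 1
      field_simp
      rw [sq, hs]
  have iX1 : ∀ i, Integrable _ (M.P i) := (bw.mul (bv1.mul bs) 1).integrable
  have iX2 : ∀ i, Integrable _ (M.P i) := (bu1.mul bv1 1).integrable
  have iX3 : ∀ i, Integrable _ (M.P i) := (bu1.mul (bv1.mul bs) 1).integrable
  have iQ : ∀ i, Integrable _ (M.P i) := (M.bdd_snd bQ 1).integrable
  have hIdiff : ∀ i, ∫ z, M.psiVec γ d a i ⬝ᵥ regInv γ (gram z) *ᵥ b i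
        ∂(Measure.pi fun _ : Fin (M.N i + 1) => M.ν i) -
      ∫ Y, M.psiVec γ d a i ⬝ᵥ M.Q γ i Y *ᵥ b i ∂(M.rows i) =
      - ∫ q, (q.1 ⬝ᵥ M.Q γ i q.2 *ᵥ M.psiVec γ d a i) *
        ((q.1 ⬝ᵥ M.Q γ i q.2 *ᵥ b i) * (1 + q.1 ⬝ᵥ M.Q γ i q.2 *ᵥ q.1)⁻¹) ∂(M.P i) := fun i => by
    rw [integral_pi_insertNth (M.ν i) 0]
    simp only [hc, e1]
    rw [integral_sub (iQ i) (iX1 i), M.integral_snd i fun Y => M.psiVec γ d a i ⬝ᵥ M.Q γ i Y *ᵥ b i]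
    ring
  obtain ⟨C1, hC1, h1⟩ := M.abs_integral_le_div_sqrt bX1
  obtain ⟨C2, hC2, h2⟩ := M.abs_integral_le_div_sqrt bX2
  refine ⟨⟨C1 + C2, by positivity, fun i => ?_⟩, C1, hC1, fun i => ?_⟩
  · have iR : Integrable (fun z : Fin (M.N i + 1) → Fin (M.T i) → ℝ =>
        a i ⬝ᵥ regInv γ (gram z) *ᵥ b i) (Measure.pi fun _ : Fin (M.N i + 1) => M.ν i) := by
      refine integrable_of_abs_le (measurable_dot measurable_const
        ((matMeasurable_regInv_gram γ _).mulVec measurable_const)) (R + (γ⁻¹) ^ 2 * R) fun z => ?_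
      refine (abs_dot_le _ _).trans (add_le_add (ha i) ?_)
      refine (regInv_norm_le' hγ (gram_posSemidef z) (b i)).trans ?_
      gcongr
      exact hb i
    have e3 := M.integral_regInv_sub_detRes hγ hd a i (g := fun _ => b i) (hc i)
      (by simp only [e1]; exact (iQ i).sub (iX1 i)) (by simp only [e2]; exact iX3 i) iR
      (integrable_const _)
    rw [integral_const, probReal_univ, one_smul] at e3
    have e4 : ∀ q : (Fin (M.T i) → ℝ) × (Fin (M.N i) → Fin (M.T i) → ℝ),
        M.psiVec γ d a i ⬝ᵥ (M.Q γ i q.2 *ᵥ b i - ((q.1 ⬝ᵥ M.Q γ i q.2 *ᵥ b i) /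
          (1 + q.1 ⬝ᵥ M.Q γ i q.2 *ᵥ q.1)) • (M.Q γ i q.2 *ᵥ q.1)) -
        (M.N i + 1) * ((q.1 ⬝ᵥ detRes γ (M.N i + 1) (M.F i) (d i) *ᵥ a i) *
          (q.1 ⬝ᵥ (M.Q γ i q.2 *ᵥ b i - ((q.1 ⬝ᵥ M.Q γ i q.2 *ᵥ b i) /
          (1 + q.1 ⬝ᵥ M.Q γ i q.2 *ᵥ q.1)) • (M.Q γ i q.2 *ᵥ q.1)))) =
        (M.psiVec γ d a i ⬝ᵥ M.Q γ i q.2 *ᵥ b i - ((M.N i + 1) / (1 + d i)) *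
          ((q.1 ⬝ᵥ detRes γ (M.N i + 1) (M.F i) (d i) *ᵥ a i) * (q.1 ⬝ᵥ M.Q γ i q.2 *ᵥ b i))) -
        (q.1 ⬝ᵥ M.Q γ i q.2 *ᵥ M.psiVec γ d a i) *
        ((q.1 ⬝ᵥ M.Q γ i q.2 *ᵥ b i) * (1 + q.1 ⬝ᵥ M.Q γ i q.2 *ᵥ q.1)⁻¹) +
        ((M.N i + 1) *
      ((q.1 ⬝ᵥ detRes γ (M.N i + 1) (M.F i) (d i) *ᵥ a i) * (q.1 ⬝ᵥ M.Q γ i q.2 *ᵥ b i) *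
        ((1 + d i)⁻¹ - (1 + q.1 ⬝ᵥ M.Q γ i q.2 *ᵥ q.1)⁻¹))) := fun q => by
      rw [e1, e2, div_eq_mul_inv]
      ring
    have iX4 : Integrable (fun q : (Fin (M.T i) → ℝ) × (Fin (M.N i) → Fin (M.T i) → ℝ) =>
        ((M.N i + 1 : ℝ) *
      ((q.1 ⬝ᵥ detRes γ (M.N i + 1) (M.F i) (d i) *ᵥ a i) * (q.1 ⬝ᵥ M.Q γ i q.2 *ᵥ b i) *
        ((1 + d i)⁻¹ - (1 + q.1 ⬝ᵥ M.Q γ i q.2 *ᵥ q.1)⁻¹)))) (M.P i) := by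
      refine (((iX2 i).mul_const (1 + d i)⁻¹).sub (iX3 i)).const_mul (M.N i + 1 : ℝ) |>.congr
        (Eventually.of_forall fun q => ?_)
      simp only [Pi.sub_apply]
      ring
    have i5 := (iX2 i).const_mul ((M.N i + 1 : ℝ) / (1 + d i))
    have e5 := integral_sub_sub_add (iQ i) i5 (iX1 i) iX4
    rw [e3, (integral_congr_ae (Eventually.of_forall e4)).trans e5, integral_const_mul,
      M.integral_snd i fun Y => M.psiVec γ d a i ⬝ᵥ M.Q γ i Y *ᵥ b i,
      M.integral_psiVec_dot (d := d) (a := a) i (H := fun Y => M.Q γ i Y *ᵥ b i) (iX2 i), sub_self, zero_sub, add_div]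
    refine (abs_add_le _ _).trans (add_le_add ?_ (h2 i))
    rw [abs_neg]
    exact h1 i
  · rw [hIdiff, abs_neg]
    exact h1 i

end RowModel
end RandomFeatures

namespace RandomFeatures
namespace RowModel

variable {ι : Type} (M : RowModel ι) {γ K : ℝ} {A : ∀ i, Matrix (Fin (M.T i)) (Fin (M.T i)) ℝ}

theorem integrable_dot_regInv (hγ : 0 < γ) (i : ι) (n : ℕ) (a b : Fin (M.T i) → ℝ) :
    Integrable (fun z : Fin n → Fin (M.T i) → ℝ => a ⬝ᵥ regInv γ (gram z) *ᵥ b)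
      (Measure.pi fun _ : Fin n => M.ν i) := by
  refine integrable_of_abs_le (measurable_dot measurable_const
    ((matMeasurable_regInv_gram γ _).mulVec measurable_const)) (a ⬝ᵥ a + (γ⁻¹) ^ 2 * (b ⬝ᵥ b))
    fun z => ?_
  exact (abs_dot_le _ _).trans (add_le_add le_rfl (regInv_norm_le' hγ (gram_posSemidef z) b))

theorem integrable_dot_sandwich (hγ : 0 < γ) (hK : 0 ≤ K)
    (hA : ∀ i, SpikeBdd K (M.N i) (M.m i) (A i)) (i : ι) (n : ℕ) (a b : Fin (M.T i) → ℝ) :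
    Integrable (fun z : Fin n → Fin (M.T i) → ℝ =>
      a ⬝ᵥ (regInv γ (gram z) * A i * regInv γ (gram z)) *ᵥ b)
      (Measure.pi fun _ : Fin n => M.ν i) := by
  refine integrable_of_abs_le (measurable_dot measurable_const
    ((((matMeasurable_regInv_gram γ _).mul (MatMeasurable.const _)).mul
      (matMeasurable_regInv_gram γ _)).mulVec measurable_const)) _
    fun z => (abs_dot_le _ _).trans (add_le_add le_rfl
      (PSD.norm_le (sandwich_posSemidef (regInv_posSemidef hγ (gram_posSemidef z)) (hA i).psd)
        (M.sandwich_quad_le hγ hK hA i n z) b))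

theorem bdd_trace_B (hγ : 0 < γ) (hK : 0 ≤ K) (hA : ∀ i, SpikeBdd K (M.N i) (M.m i) (A i)) :
    MomentBdd M.rows (fun i Y => (M.F i * M.B γ A i Y).trace) := by
  obtain ⟨C, hC, hF⟩ := M.exists_trace_le
  refine ((M.bdd_G γ K).mul (MomentBdd.const C)).mono
    (fun i => ((MatMeasurable.const _).mul (M.matMeasurable_B γ A i)).trace) fun i Y => ?_
  refine ((abs_trace_mul_le (M.F_psd i) fun x => ?_).trans
    (mul_le_mul_of_nonneg_left (hF i) (M.G_nonneg hγ hK i Y))).trans (le_abs_self _)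
  rw [abs_of_nonneg (PSD.nonneg (M.B_psd hγ (fun i => (hA i).psd) i Y) x)]
  exact ((hA i).bounds hγ hK (M.one_le i) Y x).2.1

/-- The mean of `tr (F Q A Q)` for `N` rows. -/
noncomputable def beta (γ : ℝ) (A : ∀ i, Matrix (Fin (M.T i)) (Fin (M.T i)) ℝ) (i : ι) : ℝ :=
  ∫ Y, (M.F i * M.B γ A i Y).trace ∂(M.rows i)

theorem exists_abs_beta_le (hγ : 0 < γ) (hK : 0 ≤ K)
    (hA : ∀ i, SpikeBdd K (M.N i) (M.m i) (A i)) : ∃ C, 0 ≤ C ∧ ∀ i, |M.beta γ A i| ≤ C :=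
  (M.bdd_trace_B hγ hK hA 1).abs_integral_le

/-- `y ⬝ Q A Q y` differs from the mean of `tr (F Q A Q)` by `O(N ^ (-1/2))`. -/
theorem lpBdd_B_quad_sub_beta (hγ : 0 < γ) (hK : 0 ≤ K)
    (hA : ∀ i, SpikeBdd K (M.N i) (M.m i) (A i)) :
    LpBdd 2 M.P (fun i ω =>
      Real.sqrt (M.N i) * (ω.1 ⬝ᵥ M.B γ A i ω.2 *ᵥ ω.1 - M.beta γ A i)) := by
  have h1 := (M.bdd_B_quad_sub hγ hK hA) 2
  have h2 : LpBdd 2 M.P (fun i ω => Real.sqrt (M.N i) *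
      ((M.F i * M.B γ A i ω.2).trace - M.beta γ A i)) :=
    LpBdd.comp_snd (P := M.rows) (P' := M.ν) (M.trace_B_fluct hγ hK hA).1
  refine (h1.add h2).mono (fun i => ?_) fun i ω => le_of_eq (by congr 1; ring)
  exact ((M.measurable_dot_snd (M.matMeasurable_B γ A i) measurable_fst
    measurable_fst).sub_const _).const_mul _

/-- The second-order expansion: `E[Q A Q]` is given by the mean of `Q̄ A Q` and by the mean resolvent
of one row less, the coefficient of the latter being the mean of `tr (F Q A Q)`. -/
theorem second_order (hγ : 0 < γ) (hK : 0 ≤ K) (hA : ∀ i, SpikeBdd K (M.N i) (M.m i) (A i))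
    {d : ι → ℝ} (hd : ∀ i, 0 ≤ d i) {D : ℝ} (hD : ∀ i, d i ≤ D)
    (hDd : LpBdd 2 M.P fun i ω => Real.sqrt (M.N i) * (ω.1 ⬝ᵥ M.Q γ i ω.2 *ᵥ ω.1 - d i))
    {a b : ∀ i, Fin (M.T i) → ℝ} {R : ℝ}
    (ha : ∀ i, a i ⬝ᵥ a i ≤ R) (hb : ∀ i, b i ⬝ᵥ b i ≤ R) :
    ∃ C, 0 ≤ C ∧ ∀ i,
      |∫ z, a i ⬝ᵥ (regInv γ (gram z) * A i * regInv γ (gram z)) *ᵥ b i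
          ∂(Measure.pi fun _ : Fin (M.N i + 1) => M.ν i) -
        ∫ z, (A i *ᵥ (detRes γ (M.N i + 1) (M.F i) (d i) *ᵥ a i)) ⬝ᵥ regInv γ (gram z) *ᵥ b i
          ∂(Measure.pi fun _ : Fin (M.N i + 1) => M.ν i) -
        M.beta γ A i / (1 + d i) *
          ∫ Y, M.psiVec γ d a i ⬝ᵥ M.Q γ i Y *ᵥ b i ∂(M.rows i)| ≤ C / Real.sqrt (M.N i) := by
  obtain ⟨Cβ, hCβ, hβ⟩ := M.exists_abs_beta_le hγ hK hA
  have hAp : ∀ i, (A i).PosSemidef := fun i => (hA i).psd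
  have ba : ∀ i, M.psiVec γ d a i ⬝ᵥ M.psiVec γ d a i ≤ R := fun i =>
    (M.psiVec_norm_le hγ hd a i).trans (ha i)
  -- the random variables of the expansion
  obtain ⟨u, hu⟩ : ∃ u : ∀ i, (Fin (M.T i) → ℝ) × (Fin (M.N i) → Fin (M.T i) → ℝ) → ℝ,
    u = fun i q => q.1 ⬝ᵥ detRes γ (M.N i + 1) (M.F i) (d i) *ᵥ a i := ⟨_, rfl⟩
  obtain ⟨v, hv⟩ : ∃ v : ∀ i, (Fin (M.T i) → ℝ) × (Fin (M.N i) → Fin (M.T i) → ℝ) → ℝ,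
    v = fun i q => q.1 ⬝ᵥ M.Q γ i q.2 *ᵥ b i := ⟨_, rfl⟩
  obtain ⟨r, hr⟩ : ∃ r : ∀ i, (Fin (M.T i) → ℝ) × (Fin (M.N i) → Fin (M.T i) → ℝ) → ℝ,
    r = fun i q => q.1 ⬝ᵥ M.B γ A i q.2 *ᵥ b i := ⟨_, rfl⟩
  obtain ⟨w, hw⟩ : ∃ w : ∀ i, (Fin (M.T i) → ℝ) × (Fin (M.N i) → Fin (M.T i) → ℝ) → ℝ,
    w = fun i q => q.1 ⬝ᵥ M.Q γ i q.2 *ᵥ M.psiVec γ d a i := ⟨_, rfl⟩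
  obtain ⟨w', hw'⟩ : ∃ w' : ∀ i, (Fin (M.T i) → ℝ) × (Fin (M.N i) → Fin (M.T i) → ℝ) → ℝ,
    w' = fun i q => q.1 ⬝ᵥ M.B γ A i q.2 *ᵥ M.psiVec γ d a i := ⟨_, rfl⟩
  obtain ⟨s, hs⟩ : ∃ s : ∀ i, (Fin (M.T i) → ℝ) × (Fin (M.N i) → Fin (M.T i) → ℝ) → ℝ,
    s = fun i q => (1 + q.1 ⬝ᵥ M.Q γ i q.2 *ᵥ q.1)⁻¹ := ⟨_, rfl⟩
  obtain ⟨x, hx⟩ : ∃ x : ∀ i, (Fin (M.T i) → ℝ) × (Fin (M.N i) → Fin (M.T i) → ℝ) → ℝ,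
    x = fun i q => q.1 ⬝ᵥ M.B γ A i q.2 *ᵥ q.1 := ⟨_, rfl⟩
  obtain ⟨f, hf⟩ : ∃ f : ∀ i, (Fin (M.T i) → ℝ) × (Fin (M.N i) → Fin (M.T i) → ℝ) → ℝ,
    f = fun i q => M.psiVec γ d a i ⬝ᵥ M.B γ A i q.2 *ᵥ b i := ⟨_, rfl⟩
  obtain ⟨e, he⟩ : ∃ e : ι → ℝ, e = fun i => (1 + d i)⁻¹ := ⟨_, rfl⟩
  have bu : MomentBdd M.P fun i q => Real.sqrt (M.N i) * u i q := by
    rw [hu]; exact M.bdd_detRes_linear hγ hd hD ha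
  have bv : MomentBdd M.P fun i q => Real.sqrt (M.N i) * v i q := by
    rw [hv]; exact M.bdd_Q_linear hγ hb
  have br : MomentBdd M.P fun i q => Real.sqrt (M.N i) * r i q := by
    rw [hr]; exact M.bdd_B_linear hγ hK hA hb
  have bw : MomentBdd M.P w := by rw [hw]; exact M.bdd_Q_psiVec hγ hd ha
  have bw' : MomentBdd M.P w' := by rw [hw']; exact M.bdd_B_psiVec hγ hK hA hd ha
  have bs : MomentBdd M.P s := by rw [hs]; exact M.bdd_inv_one_add hγ
  have bx : MomentBdd M.P x := by rw [hx]; exact M.bdd_B_quad hγ hK hA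
  have bf : MomentBdd M.P f := by rw [hf]; exact M.bdd_snd (M.bdd_B_bilin hγ hK hA ba hb)
  have bse : LpBdd 2 M.P fun i q => Real.sqrt (M.N i) * (e i - s i q) := by
    rw [he, hs]; exact M.lpBdd_inv_sub hγ hd hDd
  have bxβ : LpBdd 2 M.P fun i q => Real.sqrt (M.N i) * (x i q - M.beta γ A i) := by
    rw [hx]; exact M.lpBdd_B_quad_sub_beta hγ hK hA
  have be : MomentBdd M.P fun i _ => e i := by
    refine MomentBdd.of_bound (fun i => measurable_const) 1 fun i _ => ?_
    have := hd i
    rw [he, abs_of_nonneg (by positivity)]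
    exact inv_le_one_of_one_le₀ (by linarith)
  have bβ : MomentBdd M.P fun i _ => M.beta γ A i :=
    MomentBdd.of_bound (fun i => measurable_const) Cβ fun i _ => hβ i
  have mu : ∀ i, Measurable (u i) := fun i => by
    rw [hu]; exact measurable_dot measurable_fst measurable_const
  have mv : ∀ i, Measurable (v i) := fun i => by
    rw [hv]; exact M.measurable_dot_snd (M.matMeasurable_Q γ i) measurable_fst measurable_const
  have mr : ∀ i, Measurable (r i) := fun i => by
    rw [hr]; exact M.measurable_dot_snd (M.matMeasurable_B γ A i) measurable_fst measurable_const
  have mw := fun i => (bw 1).1 i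
  have mw' := fun i => (bw' 1).1 i
  have ms := fun i => (bs 1).1 i
  have mx := fun i => (bx 1).1 i
  have bu1 := M.bdd_of_sqrt_mul mu bu
  have bv1 := M.bdd_of_sqrt_mul mv bv
  have br1 := M.bdd_of_sqrt_mul mr br
  have key : ∀ i, ∃ c : (Fin (M.T i) → ℝ) × (Fin (M.N i) → Fin (M.T i) → ℝ) → Fin (M.T i) → ℝ,
      (∀ (j : Fin (M.N i + 1)) (q : (Fin (M.T i) → ℝ) × (Fin (M.N i) → Fin (M.T i) → ℝ)),
        regInv γ (gram (j.insertNth (α := fun _ => Fin (M.T i) → ℝ) q.1 q.2)) *ᵥ (A i *ᵥ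
          (regInv γ (gram (j.insertNth (α := fun _ => Fin (M.T i) → ℝ) q.1 q.2)) *ᵥ b i)) = c q) ∧
      (∀ q, M.psiVec γ d a i ⬝ᵥ c q =
        f i q - v i q * s i q * w' i q - (r i q - v i q * s i q * x i q) * s i q * w i q) ∧
      ∀ q, q.1 ⬝ᵥ c q = (r i q - v i q * s i q * x i q) * s i q := by
    intro i
    refine ⟨fun q => M.B γ A i q.2 *ᵥ b i -
      ((q.1 ⬝ᵥ M.Q γ i q.2 *ᵥ b i) / (1 + q.1 ⬝ᵥ M.Q γ i q.2 *ᵥ q.1)) • (M.B γ A i q.2 *ᵥ q.1) -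
      ((q.1 ⬝ᵥ M.B γ A i q.2 *ᵥ b i - ((q.1 ⬝ᵥ M.Q γ i q.2 *ᵥ b i) /
        (1 + q.1 ⬝ᵥ M.Q γ i q.2 *ᵥ q.1)) * (q.1 ⬝ᵥ M.B γ A i q.2 *ᵥ q.1)) /
        (1 + q.1 ⬝ᵥ M.Q γ i q.2 *ᵥ q.1)) • (M.Q γ i q.2 *ᵥ q.1), fun j q => ?_, fun q => ?_,
      fun q => ?_⟩
    · rw [Matrix.mulVec_mulVec, Matrix.mulVec_mulVec, gram_insertNth]
      exact sandwich_add_vecMulVec_mulVec hγ (gram_posSemidef _) (A i) q.1 (b i)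
    · simp only [hf, hv, hs, hw', hr, hx, hw]
      rw [dotProduct_sub, dotProduct_sub, dotProduct_smul, dotProduct_smul, smul_eq_mul, smul_eq_mul,
        dot_mulVec_swap (PSD.symm (M.Q_psd hγ i q.2)) q.1 (M.psiVec γ d a i),
        dot_mulVec_swap (PSD.symm (M.B_psd hγ hAp i q.2)) q.1 (M.psiVec γ d a i)]
      simp only [div_eq_mul_inv]
    · have hD : 0 ≤ q.1 ⬝ᵥ M.Q γ i q.2 *ᵥ q.1 := PSD.nonneg (M.Q_psd hγ i q.2) q.1
      simp only [hv, hs, hr, hx]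
      rw [dotProduct_sub, dotProduct_sub, dotProduct_smul, dotProduct_smul, smul_eq_mul, smul_eq_mul]
      generalize q.1 ⬝ᵥ M.Q γ i q.2 *ᵥ q.1 = D at hD ⊢
      field_simp
      ring
  choose c hc e1 e2 using key
  have bX1 : LpBdd 1 M.P fun i q => Real.sqrt (M.N i) * (v i q * s i q * w' i q +
      (r i q - v i q * s i q * x i q) * s i q * w i q) := by
    have h := (((bv.mul bs).mul bw').add
      (((br.add (((bv.mul bs).mul bx).const_mul (-1))).mul bs).mul bw)) 1
    refine h.mono (fun i => ?_) fun i q => le_of_eq (by congr 1; ring)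
    exact ((((mv i).mul (ms i)).mul (mw' i)).add ((((mr i).sub (((mv i).mul (ms i)).mul
      (mx i))).mul (ms i)).mul (mw i))).const_mul _
  have bX2 : LpBdd 1 M.P fun i q => Real.sqrt (M.N i) *
      ((M.N i + 1) * (u i q * r i q * (e i - s i q) +
        u i q * v i q * (s i q ^ 2 * x i q - M.beta γ A i * e i ^ 2))) := by
    have h1 := ((M.bdd_ratio).mul (bu.mul br)).mul_lpBdd_two bse
    have h2 := ((M.bdd_ratio).mul ((bu.mul bv).mul (bs.pow 2))).mul_lpBdd_two bxβ
    have h3 := ((((M.bdd_ratio).mul ((bu.mul bv).mul (bβ.mul (be.add bs))))).const_mul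
      (-1)).mul_lpBdd_two bse
    refine ((h1.add h2).add h3).mono (fun i => ?_) fun i q => le_of_eq ?_
    · exact (((((mu i).mul (mr i)).mul (measurable_const.sub (ms i))).add
        (((mu i).mul (mv i)).mul ((((ms i).pow_const 2).mul (mx i)).sub
          measurable_const))).const_mul _).const_mul _
    · have hN := M.N_pos i
      have hs := Real.mul_self_sqrt hN.le
      congr 1
      generalize M.beta γ A i = β
      have e5 : ((M.N i + 1 : ℝ) / M.N i) = (M.N i + 1 : ℝ) /
        (Real.sqrt (M.N i) * Real.sqrt (M.N i)) := by rw [hs]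
      rw [e5]
      have := (Real.sqrt_pos.2 hN).ne'
      field_simp
      ring
  have iof : ∀ {X : ∀ i, (Fin (M.T i) → ℝ) × (Fin (M.N i) → Fin (M.T i) → ℝ) → ℝ},
      LpBdd 1 M.P (fun i q => Real.sqrt (M.N i) * X i q) → ∀ i, Integrable (X i) (M.P i) := by
    intro X hX i
    have hN := (Real.sqrt_pos.2 (M.N_pos i)).ne'
    refine ((hX.integrable i).const_mul (Real.sqrt (M.N i))⁻¹).congr
      (Eventually.of_forall fun q => ?_)
    simp only
    rw [inv_mul_cancel_left₀ hN]
  have if0 : ∀ i, Integrable (f i) (M.P i) := (bf 1).integrable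
  have iur : ∀ i, Integrable (fun q => u i q * r i q) (M.P i) := (bu1.mul br1 1).integrable
  have iuv : ∀ i, Integrable (fun q => u i q * v i q) (M.P i) := (bu1.mul bv1 1).integrable
  have iX1 := iof bX1
  have iX2 := iof bX2
  have iX3 : ∀ i, Integrable (fun q => u i q * ((r i q - v i q * s i q * x i q) * s i q)) (M.P i) := by
    intro i
    refine ((bu1.mul ((br1.add (((bv1.mul bs).mul bx).const_mul (-1))).mul bs)) 1).integrable i
      |>.congr (Eventually.of_forall fun q => ?_)
    simp only
    ring
  obtain ⟨C1, hC1, h1⟩ := M.abs_integral_le_div_sqrt bX1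
  obtain ⟨C2, hC2, h2⟩ := M.abs_integral_le_div_sqrt bX2
  refine ⟨C1 + C2, by positivity, fun i => ?_⟩
  have hd1 : 0 < 1 + d i := by linarith [hd i]
  have esand : ∀ z : Fin (M.N i + 1) → Fin (M.T i) → ℝ,
      a i ⬝ᵥ regInv γ (gram z) *ᵥ (A i *ᵥ (regInv γ (gram z) *ᵥ b i)) =
      a i ⬝ᵥ (regInv γ (gram z) * A i * regInv γ (gram z)) *ᵥ b i := fun z => by
    rw [Matrix.mulVec_mulVec, Matrix.mulVec_mulVec, mul_assoc]
  have hR : (detRes γ (M.N i + 1) (M.F i) (d i))ᵀ = detRes γ (M.N i + 1) (M.F i) (d i) :=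
    PSD.symm (detRes_posSemidef hγ (by positivity) (M.F_psd i) (hd i))
  have edet : ∀ z : Fin (M.N i + 1) → Fin (M.T i) → ℝ,
      a i ⬝ᵥ detRes γ (M.N i + 1) (M.F i) (d i) *ᵥ (A i *ᵥ (regInv γ (gram z) *ᵥ b i)) =
      (A i *ᵥ (detRes γ (M.N i + 1) (M.F i) (d i) *ᵥ a i)) ⬝ᵥ regInv γ (gram z) *ᵥ b i := fun z => by
    rw [dot_mulVec_comm hR, dot_mulVec_comm (PSD.symm (hAp i))]
  have e3 := M.integral_regInv_sub_detRes hγ hd a i (g := fun z => A i *ᵥ (regInv γ (gram z) *ᵥ b i))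
    (c := c i) (hc i)
    (by simp only [e1]
        exact ((if0 i).sub (iX1 i)).congr (Eventually.of_forall fun q => by
          simp only [Pi.sub_apply]; ring))
    (by simp only [e2]
        have := iX3 i
        rw [hu] at this
        exact this)
    (by simp only [esand]; exact M.integrable_dot_sandwich hγ hK hA i _ _ _)
    (by simp only [edet]; exact M.integrable_dot_regInv hγ i _ _ _)
  simp only [esand, edet] at e3
  have e4 : ∀ q : (Fin (M.T i) → ℝ) × (Fin (M.N i) → Fin (M.T i) → ℝ),
      M.psiVec γ d a i ⬝ᵥ c i q - (M.N i + 1) *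
        ((q.1 ⬝ᵥ detRes γ (M.N i + 1) (M.F i) (d i) *ᵥ a i) * (q.1 ⬝ᵥ c i q)) =
      f i q - ((M.N i + 1 : ℝ) / (1 + d i)) * (u i q * r i q) -
        (v i q * s i q * w' i q + (r i q - v i q * s i q * x i q) * s i q * w i q) +
        ((M.beta γ A i / (1 + d i) * ((M.N i + 1 : ℝ) / (1 + d i))) * (u i q * v i q) +
          (M.N i + 1) * (u i q * r i q * (e i - s i q) +
            u i q * v i q * (s i q ^ 2 * x i q - M.beta γ A i * e i ^ 2))) := fun q => by
    have hu' : q.1 ⬝ᵥ detRes γ (M.N i + 1) (M.F i) (d i) *ᵥ a i = u i q := by rw [hu]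
    rw [e1, e2, hu']
    simp only [he, div_eq_mul_inv]
    ring
  have i5 := (iur i).const_mul ((M.N i + 1 : ℝ) / (1 + d i))
  have i6 := (iuv i).const_mul (M.beta γ A i / (1 + d i) * ((M.N i + 1 : ℝ) / (1 + d i)))
  have e5 := integral_sub_sub_add (if0 i) i5 (iX1 i) (i6.add (iX2 i))
  have e6 := integral_add i6 (iX2 i)
  have e7 : ∫ q, f i q ∂(M.P i) = ((M.N i + 1 : ℝ) / (1 + d i)) * ∫ q, u i q * r i q ∂(M.P i) := by
    have h := M.integral_psiVec_dot (γ := γ) (d := d) (a := a) i (H := fun Y => M.B γ A i Y *ᵥ b i)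
      (by have := iur i; rw [hu, hr] at this; exact this)
    rw [hf, M.integral_snd i fun Y => M.psiVec γ d a i ⬝ᵥ M.B γ A i Y *ᵥ b i, h, hu, hr]
  have e8 : ∫ Y, M.psiVec γ d a i ⬝ᵥ M.Q γ i Y *ᵥ b i ∂(M.rows i) =
      ((M.N i + 1 : ℝ) / (1 + d i)) * ∫ q, u i q * v i q ∂(M.P i) := by
    have h := M.integral_psiVec_dot (γ := γ) (d := d) (a := a) i (H := fun Y => M.Q γ i Y *ᵥ b i)
      (by have := iuv i; rw [hu, hv] at this; exact this)
    rw [h, hu, hv]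
  simp only [Pi.add_apply] at e5 e6
  rw [e3, (integral_congr_ae (Eventually.of_forall e4)).trans e5, e6, e7, e8, integral_const_mul,
    integral_const_mul]
  have h1 := h1 i
  have h2 := h2 i
  rw [add_div C1 C2]
  rw [abs_le] at h1 h2 ⊢
  constructor <;> linarith

end RowModel
end RandomFeatures

namespace RandomFeatures

/-! ### Deterministic equivalents for families of row laws -/

section MatIntegral

variable {τ : Type*} {Ω : Type*} [MeasurableSpace Ω]

/-- The entrywise integral of a matrix-valued function. -/
noncomputable def matIntegral (μ : Measure Ω) (M : Ω → Matrix τ τ ℝ) : Matrix τ τ ℝ :=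
  Matrix.of fun j l => ∫ ω, M ω j l ∂μ

variable [Fintype τ] {μ : Measure Ω} {M : Ω → Matrix τ τ ℝ}

theorem integrable_entry (h : ∀ a b : τ → ℝ, Integrable (fun ω => a ⬝ᵥ M ω *ᵥ b) μ) (j l : τ) :
    Integrable (fun ω => M ω j l) μ := by
  classical
  simpa using h (Pi.single j 1) (Pi.single l 1)

theorem dot_matIntegral_mulVec (h : ∀ a b : τ → ℝ, Integrable (fun ω => a ⬝ᵥ M ω *ᵥ b) μ)
    (a b : τ → ℝ) : a ⬝ᵥ matIntegral μ M *ᵥ b = ∫ ω, a ⬝ᵥ M ω *ᵥ b ∂μ := by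
  have h1 := integrable_entry h
  simp only [dotProduct, Matrix.mulVec, matIntegral, Matrix.of_apply]
  rw [integral_finsetSum _ fun j _ => (integrable_finsetSum _ fun l _ =>
    (h1 j l).mul_const _).const_mul _]
  refine Finset.sum_congr rfl fun j _ => ?_
  rw [integral_const_mul, integral_finsetSum _ fun l _ => (h1 j l).mul_const _]
  congr 1
  exact Finset.sum_congr rfl fun l _ => (integral_mul_const _ _).symm

theorem trace_mul_matIntegral (h : ∀ a b : τ → ℝ, Integrable (fun ω => a ⬝ᵥ M ω *ᵥ b) μ)
    (F : Matrix τ τ ℝ) : (F * matIntegral μ M).trace = ∫ ω, (F * M ω).trace ∂μ := by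
  have h1 := integrable_entry h
  simp only [Matrix.trace, Matrix.diag, Matrix.mul_apply, matIntegral, Matrix.of_apply]
  rw [integral_finsetSum Finset.univ (f := fun j ω => ∑ l, F j l * M ω l j)
    fun j _ => integrable_finsetSum _ fun l _ => (h1 l j).const_mul _]
  refine Finset.sum_congr rfl fun j _ => ?_
  rw [integral_finsetSum Finset.univ (f := fun l ω => F j l * M ω l j)
    fun l _ => (h1 l j).const_mul _]
  exact Finset.sum_congr rfl fun l _ => (integral_const_mul _ _).symm

theorem abs_quad_le_of_unit {B : Matrix τ τ ℝ} {c : ℝ}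
    (h : ∀ a : τ → ℝ, a ⬝ᵥ a ≤ 1 → |a ⬝ᵥ B *ᵥ a| ≤ c) (x : τ → ℝ) :
    |x ⬝ᵥ B *ᵥ x| ≤ c * (x ⬝ᵥ x) := by
  rcases (dot_self_nonneg x).eq_or_lt with h0 | h0
  · have hx : x = 0 := dotProduct_self_eq_zero.1 h0.symm
    simp [hx]
  · have hs : 0 < Real.sqrt (x ⬝ᵥ x) := Real.sqrt_pos.2 h0
    have hsq := Real.mul_self_sqrt h0.le
    set s := Real.sqrt (x ⬝ᵥ x)
    have h1 := h (s⁻¹ • x) (by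
      rw [smul_dotProduct, dotProduct_smul, smul_eq_mul, smul_eq_mul, ← hsq]
      field_simp
      exact le_rfl)
    rw [Matrix.mulVec_smul, smul_dotProduct, dotProduct_smul, smul_eq_mul, smul_eq_mul, ← mul_assoc,
      abs_mul, abs_of_pos (by positivity)] at h1
    rw [← hsq]
    have h2 := mul_le_mul_of_nonneg_left h1 (by positivity : 0 ≤ s * s)
    calc |x ⬝ᵥ B *ᵥ x| = s * s * (s⁻¹ * s⁻¹ * |x ⬝ᵥ B *ᵥ x|) := by field_simp
      _ ≤ _ := h2
      _ = _ := mul_comm _ _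

end MatIntegral

theorem LpBdd.reindex {ι κ : Type*} {Ω : ι → Type*} [∀ i, MeasurableSpace (Ω i)]
    {P : ∀ i, Measure (Ω i)} {X : ∀ i, Ω i → ℝ} {k : ℕ} (h : LpBdd k P X) (g : κ → ι) :
    LpBdd k (fun j => P (g j)) (fun j => X (g j)) := by
  obtain ⟨h1, C, h2⟩ := h
  exact ⟨fun j => h1 (g j), C, fun j => h2 (g j)⟩

namespace RowModel

variable {ι : Type} (M : RowModel ι) {γ K : ℝ} {A : ∀ i, Matrix (Fin (M.T i)) (Fin (M.T i)) ℝ}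

/-- The law of `N + 1` rows. -/
noncomputable abbrev rows' (i : ι) : Measure (Fin (M.N i + 1) → Fin (M.T i) → ℝ) :=
  Measure.pi fun _ => M.ν i

/-- Pairs of vectors of squared length at most `R`: reindexing a family by them makes the estimates
for fixed vectors uniform. -/
def BallPair (R : ℝ) : Type :=
  Σ i, {p : (Fin (M.T i) → ℝ) × (Fin (M.T i) → ℝ) // p.1 ⬝ᵥ p.1 ≤ R ∧ p.2 ⬝ᵥ p.2 ≤ R}

theorem first_order_uniform (hγ : 0 < γ) {d : ι → ℝ} (hd : ∀ i, 0 ≤ d i) {D : ℝ}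
    (hD : ∀ i, d i ≤ D)
    (hDd : LpBdd 2 M.P fun i ω => Real.sqrt (M.N i) * (ω.1 ⬝ᵥ M.Q γ i ω.2 *ᵥ ω.1 - d i)) (R : ℝ) :
    (∃ C, 0 ≤ C ∧ ∀ i (a b : Fin (M.T i) → ℝ), a ⬝ᵥ a ≤ R → b ⬝ᵥ b ≤ R →
      |∫ z, a ⬝ᵥ regInv γ (gram z) *ᵥ b ∂(M.rows' i) -
        a ⬝ᵥ detRes γ (M.N i + 1) (M.F i) (d i) *ᵥ b| ≤ C / Real.sqrt (M.N i)) ∧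
    ∃ C, 0 ≤ C ∧ ∀ i (a : ∀ i, Fin (M.T i) → ℝ) (b : Fin (M.T i) → ℝ), a i ⬝ᵥ a i ≤ R →
      b ⬝ᵥ b ≤ R → |∫ z, M.psiVec γ d a i ⬝ᵥ regInv γ (gram z) *ᵥ b ∂(M.rows' i) -
        ∫ Y, M.psiVec γ d a i ⬝ᵥ M.Q γ i Y *ᵥ b ∂(M.rows i)| ≤ C / Real.sqrt (M.N i) := by
  obtain ⟨⟨C1, hC1, h1⟩, C2, hC2, h2⟩ :=
    (M.comp (fun j : M.BallPair R => j.1)).first_order hγ (d := fun j => d j.1) (fun j => hd j.1)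
      (fun j => hD j.1) (hDd.reindex fun j : M.BallPair R => j.1) (a := fun j => j.2.1.1)
      (b := fun j => j.2.1.2) (fun j => j.2.2.1) (fun j => j.2.2.2)
  exact ⟨⟨C1, hC1, fun i a b ha hb => h1 ⟨i, (a, b), ha, hb⟩⟩, C2, hC2,
    fun i a b ha hb => h2 ⟨i, (a i, b), ha, hb⟩⟩

theorem second_order_uniform (hγ : 0 < γ) (hK : 0 ≤ K)
    (hA : ∀ i, SpikeBdd K (M.N i) (M.m i) (A i)) {d : ι → ℝ} (hd : ∀ i, 0 ≤ d i) {D : ℝ}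
    (hD : ∀ i, d i ≤ D)
    (hDd : LpBdd 2 M.P fun i ω => Real.sqrt (M.N i) * (ω.1 ⬝ᵥ M.Q γ i ω.2 *ᵥ ω.1 - d i)) (R : ℝ) :
    ∃ C, 0 ≤ C ∧ ∀ i (a : ∀ i, Fin (M.T i) → ℝ) (b : Fin (M.T i) → ℝ), a i ⬝ᵥ a i ≤ R →
      b ⬝ᵥ b ≤ R →
      |∫ z, a i ⬝ᵥ (regInv γ (gram z) * A i * regInv γ (gram z)) *ᵥ b ∂(M.rows' i) -
        ∫ z, (A i *ᵥ (detRes γ (M.N i + 1) (M.F i) (d i) *ᵥ a i)) ⬝ᵥ regInv γ (gram z) *ᵥ b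
          ∂(M.rows' i) -
        M.beta γ A i / (1 + d i) * ∫ Y, M.psiVec γ d a i ⬝ᵥ M.Q γ i Y *ᵥ b ∂(M.rows i)| ≤
      C / Real.sqrt (M.N i) := by
  obtain ⟨C, hC, h⟩ :=
    (M.comp (fun j : M.BallPair R => j.1)).second_order hγ hK (A := fun j => A j.1)
      (fun j => hA j.1) (d := fun j => d j.1) (fun j => hd j.1)
      (fun j => hD j.1) (hDd.reindex fun j : M.BallPair R => j.1) (a := fun j => j.2.1.1)
      (b := fun j => j.2.1.2) (fun j => j.2.2.1) (fun j => j.2.2.2)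
  exact ⟨C, hC, fun i a b ha hb => h ⟨i, (a i, b), ha, hb⟩⟩

/-- The mean of `tr (F Q)` for `N` rows. -/
noncomputable def alpha (γ : ℝ) (i : ι) : ℝ := ∫ Y, (M.F i * M.Q γ i Y).trace ∂(M.rows i)

theorem alpha_nonneg (hγ : 0 < γ) (i : ι) : 0 ≤ M.alpha γ i :=
  integral_nonneg fun Y => trace_mul_nonneg (M.F_psd i) (M.Q_psd hγ i Y)

theorem alpha_le (hγ : 0 < γ) (i : ι) : M.alpha γ i ≤ γ⁻¹ * (M.F i).trace := by
  have := norm_integral_le_of_norm_le_const (μ := M.rows i) (C := γ⁻¹ * (M.F i).trace)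
    (f := fun Y => (M.F i * M.Q γ i Y).trace)
    (Eventually.of_forall fun Y => M.trace_mul_regInv_le hγ i _ Y)
  exact (le_abs_self _).trans (by simpa [alpha] using this)

theorem lpBdd_Q_quad_sub_alpha (hγ : 0 < γ) : LpBdd 2 M.P (fun i ω =>
    Real.sqrt (M.N i) * (ω.1 ⬝ᵥ M.Q γ i ω.2 *ᵥ ω.1 - M.alpha γ i)) := by
  have h1 := (M.bdd_Q_quad_sub hγ) 2
  have h2 : LpBdd 2 M.P (fun i ω => Real.sqrt (M.N i) *
      ((M.F i * M.Q γ i ω.2).trace - M.alpha γ i)) :=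
    LpBdd.comp_snd (P := M.rows) (P' := M.ν) (M.trace_Q_fluct hγ).1
  refine (h1.add h2).mono (fun i => ?_) fun i ω => le_of_eq (by congr 1; ring)
  exact ((M.measurable_dot_snd (M.matMeasurable_Q γ i) measurable_fst
    measurable_fst).sub_const _).const_mul _

/-- The mean of `tr (F Q)` solves the fixed point equation for `δ` up to `O(N ^ (-1/2))`, and is
therefore close to `δ`. -/
theorem exists_abs_alpha_sub_le (hγ : 0 < γ) {δ : ι → ℝ} (hδ : ∀ i, 0 ≤ δ i)
    (hδe : ∀ i, δ i = (M.F i * detRes γ (M.N i + 1) (M.F i) (δ i)).trace) :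
    ∃ C, 0 ≤ C ∧ ∀ i, |M.alpha γ i - δ i| ≤ C / Real.sqrt (M.N i) := by
  obtain ⟨Ct, hCt, ht⟩ := M.exists_trace_le
  have hγ' : 0 < γ⁻¹ := by positivity
  have hα : ∀ i, M.alpha γ i ≤ γ⁻¹ * Ct := fun i =>
    (M.alpha_le hγ i).trans (mul_le_mul_of_nonneg_left (ht i) hγ'.le)
  have hδ' : ∀ i, δ i ≤ γ⁻¹ * Ct := fun i => by
    rw [hδe i]
    exact (trace_mul_detRes_le hγ (by positivity) (M.F_psd i) (hδ i)).trans
      (mul_le_mul_of_nonneg_left (ht i) hγ'.le)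
  obtain ⟨⟨C1, hC1, h1⟩, -⟩ := M.first_order_uniform hγ (M.alpha_nonneg hγ) hα
    (M.lpBdd_Q_quad_sub_alpha hγ) 1
  obtain ⟨C2, hC2, h2⟩ := (M.trace_Q_fluct hγ).2
  refine ⟨(1 + γ⁻¹ * Ct) * (1 + γ⁻¹ * Ct) * (C1 * Ct + C2), by positivity, fun i => ?_⟩
  have hN := Real.sqrt_pos.2 (M.N_pos i)
  have hint := M.integrable_dot_regInv hγ i (M.N i + 1)
  set α := M.alpha γ i with hαd
  set E := matIntegral (M.rows' i) fun z => regInv γ (gram z) with hE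
  set R := detRes γ (M.N i + 1) (M.F i) α with hRd
  have h3 : |(M.F i * (E - R)).trace| ≤ C1 / Real.sqrt (M.N i) * (M.F i).trace := by
    refine abs_trace_mul_le (M.F_psd i) (abs_quad_le_of_unit fun a ha => ?_)
    rw [Matrix.sub_mulVec, dotProduct_sub, hE, dot_matIntegral_mulVec hint]
    exact h1 i a a ha ha
  rw [mul_sub, Matrix.trace_sub, hE, trace_mul_matIntegral hint] at h3
  have h4 : |∫ z, (M.F i * regInv γ (gram z)).trace ∂(M.rows' i) - α| ≤
    C2 / Real.sqrt (M.N i) := h2 i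
  have h5 : C1 / Real.sqrt (M.N i) * (M.F i).trace ≤ C1 * Ct / Real.sqrt (M.N i) := by
    rw [div_mul_eq_mul_div]
    gcongr
    exact ht i
  have h6 : |α - (M.F i * R).trace| ≤ (C1 * Ct + C2) / Real.sqrt (M.N i) := by
    rw [add_div]
    rw [abs_le] at h3 h4 ⊢
    constructor <;> linarith
  have hα0 := M.alpha_nonneg hγ i
  refine (fixedPoint_stable hγ (by positivity) (M.F_psd i) hα0 (hδ i) (hδe i) h6).trans ?_
  rw [← mul_div_assoc]
  have hδ0 := hδ i
  gcongr
  · exact hα i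
  · exact hδ' i

/-- `y ⬝ Q y` differs from `δ` by `O(N ^ (-1/2))`. -/
theorem lpBdd_Q_quad_sub_delta (hγ : 0 < γ) {δ : ι → ℝ} (hδ : ∀ i, 0 ≤ δ i)
    (hδe : ∀ i, δ i = (M.F i * detRes γ (M.N i + 1) (M.F i) (δ i)).trace) :
    LpBdd 2 M.P (fun i ω => Real.sqrt (M.N i) * (ω.1 ⬝ᵥ M.Q γ i ω.2 *ᵥ ω.1 - δ i)) := by
  obtain ⟨C, hC, h⟩ := M.exists_abs_alpha_sub_le hγ hδ hδe
  have h1 : LpBdd 2 M.P (fun i _ => Real.sqrt (M.N i) * (M.alpha γ i - δ i)) := by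
    refine LpBdd.of_bound (fun i => measurable_const) C fun i _ => ?_
    have hN := Real.sqrt_pos.2 (M.N_pos i)
    have h2 := h i
    rw [le_div_iff₀ hN] at h2
    rw [abs_mul, abs_of_pos hN]
    linarith
  refine ((M.lpBdd_Q_quad_sub_alpha hγ).add h1).mono (fun i => ?_)
    fun i ω => le_of_eq (by congr 1; ring)
  exact ((M.measurable_dot_snd (M.matMeasurable_Q γ i) measurable_fst
    measurable_fst).sub_const _).const_mul _

/-- The deterministic equivalent of `Q A Q`, for the fixed point `δ`. -/
theorem sandwich_equivalent (hγ : 0 < γ) (hK : 0 ≤ K)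
    (hA : ∀ i, SpikeBdd K (M.N i) (M.m i) (A i)) {δ : ι → ℝ} (hδ : ∀ i, 0 ≤ δ i)
    (hδe : ∀ i, δ i = (M.F i * detRes γ (M.N i + 1) (M.F i) (δ i)).trace) {K' : ℝ}
    (hA' : ∀ i (x : Fin (M.T i) → ℝ), x ⬝ᵥ x ≤ 1 →
      (A i *ᵥ (detRes γ (M.N i + 1) (M.F i) (δ i) *ᵥ x)) ⬝ᵥ
        (A i *ᵥ (detRes γ (M.N i + 1) (M.F i) (δ i) *ᵥ x)) ≤ K') :
    ∃ C, 0 ≤ C ∧ ∀ i (R Ψ : Matrix (Fin (M.T i)) (Fin (M.T i)) ℝ) (n : ℝ), n = M.N i + 1 →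
      R = detRes γ n (M.F i) (δ i) → Ψ = (n / (1 + δ i)) • M.F i →
      ∀ a b : Fin (M.T i) → ℝ, a ⬝ᵥ a ≤ 1 → b ⬝ᵥ b ≤ 1 →
      |a ⬝ᵥ (matIntegral (M.rows' i) (fun z => regInv γ (gram z) * A i * regInv γ (gram z)) -
        (R * A i * R + (((1 + δ i)⁻¹ * (M.F i * (R * A i * R)).trace) /
          (1 - (1 + δ i)⁻¹ * (M.F i * (R * Ψ * R)).trace)) • (R * Ψ * R))) *ᵥ b| ≤
      C / Real.sqrt (M.N i) := by
  obtain ⟨Ct, hCt, ht⟩ := M.exists_trace_le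
  have hγ' : 0 < γ⁻¹ := by positivity
  have hδ' : ∀ i, δ i ≤ γ⁻¹ * Ct := fun i => by
    rw [hδe i]
    exact (trace_mul_detRes_le hγ (by positivity) (M.F_psd i) (hδ i)).trans
      (mul_le_mul_of_nonneg_left (ht i) hγ'.le)
  have hDd := M.lpBdd_Q_quad_sub_delta hγ hδ hδe
  obtain ⟨⟨C1, hC1, h1⟩, C2, hC2, h2⟩ := M.first_order_uniform hγ hδ hδ' hDd (max 1 K')
  obtain ⟨C3, hC3, h3⟩ := M.second_order_uniform hγ hK hA hδ hδ' hDd 1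
  obtain ⟨Cβ, hCβ, hβ⟩ := M.exists_abs_beta_le hγ hK hA
  obtain ⟨C4, hC4, h4⟩ := (M.trace_B_fluct hγ hK hA).2
  -- the expansion with the coefficient `β / (1 + δ)`
  set C5 := C3 + C1 + Cβ * (C2 + C1) with hC5
  have hC50 : 0 ≤ C5 := by positivity
  refine ⟨C5 + (C5 * Ct + C4) * γ⁻¹, by positivity, fun i R Ψ n hn hR hΨ => ?_⟩
  subst hn
  have hN := Real.sqrt_pos.2 (M.N_pos i)
  have hd1 : 0 < 1 + δ i := by linarith [hδ i]
  have hΨp : Ψ.PosSemidef := by rw [hΨ]; exact (M.F_psd i).smul (by positivity)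
  have hRs : Rᵀ = R := by
    rw [hR]; exact PSD.symm (detRes_posSemidef hγ (by positivity) (M.F_psd i) (hδ i))
  have hRΨ : R = regInv γ Ψ := by rw [hR, hΨ]; rfl
  have hint := M.integrable_dot_sandwich hγ hK hA i (M.N i + 1)
  set E := matIntegral (M.rows' i) (fun z => regInv γ (gram z) * A i * regInv γ (gram z)) with hE
  set β := M.beta γ A i with hβd
  set W := R * Ψ * R with hW
  have h5 : ∀ a b : Fin (M.T i) → ℝ, a ⬝ᵥ a ≤ 1 → b ⬝ᵥ b ≤ 1 →
      |a ⬝ᵥ (E - (R * A i * R + (β / (1 + δ i)) • W)) *ᵥ b| ≤ C5 / Real.sqrt (M.N i) := by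
    intro a b ha hb
    -- a section through `a`, as the lemmas concern families of vectors
    classical
    let a' : ∀ i, Fin (M.T i) → ℝ := Function.update (fun _ => 0) i a
    have ha' : a' i = a := Function.update_self _ _ _
    have hp : M.psiVec γ δ a' i = Ψ *ᵥ (R *ᵥ a) := by rw [psiVec, ha', hΨ, hR]
    have e3 := h3 i a' b (by rw [ha']; exact ha) hb
    have e2 := h2 i a' b (by rw [ha']; exact ha.trans (le_max_left _ _)) (hb.trans (le_max_left _ _))
    have hpn := M.psiVec_norm_le hγ hδ a' i
    rw [hp] at e3 e2 hpn
    rw [ha'] at e3 hpn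
    have e1 := h1 i (Ψ *ᵥ (R *ᵥ a)) b (hpn.trans (ha.trans (le_max_left _ _)))
      (hb.trans (le_max_left _ _))
    have e1' := h1 i (A i *ᵥ (R *ᵥ a)) b (by
      rw [hR]; exact (hA' i a ha).trans (le_max_right _ _)) (hb.trans (le_max_left _ _))
    rw [← hR] at e3 e1 e1'
    have hc : |β / (1 + δ i)| ≤ Cβ := by
      rw [abs_div, abs_of_pos hd1]
      exact (div_le_self (abs_nonneg _) (by linarith [hδ i])).trans (hβ i)
    rw [Matrix.sub_mulVec, dotProduct_sub, hE, dot_matIntegral_mulVec hint, Matrix.add_mulVec,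
      dotProduct_add, Matrix.smul_mulVec, dotProduct_smul, smul_eq_mul, hW, dot_sandwich hRs,
      dot_sandwich hRs, dot_mulVec_comm (PSD.symm (hA i).psd), dot_mulVec_comm (PSD.symm hΨp)]
    generalize β / (1 + δ i) = c at *
    generalize ∫ z, a ⬝ᵥ (regInv γ (gram z) * A i * regInv γ (gram z)) *ᵥ b ∂(M.rows' i) = I0 at *
    generalize ∫ z, (A i *ᵥ (R *ᵥ a)) ⬝ᵥ regInv γ (gram z) *ᵥ b ∂(M.rows' i) = I1 at *
    generalize ∫ z, (Ψ *ᵥ (R *ᵥ a)) ⬝ᵥ regInv γ (gram z) *ᵥ b ∂(M.rows' i) = I2 at *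
    generalize ∫ Y, (Ψ *ᵥ (R *ᵥ a)) ⬝ᵥ M.Q γ i Y *ᵥ b ∂(M.rows i) = I3 at *
    generalize (A i *ᵥ (R *ᵥ a)) ⬝ᵥ R *ᵥ b = J1 at *
    generalize (Ψ *ᵥ (R *ᵥ a)) ⬝ᵥ R *ᵥ b = J2 at *
    have e0 : I0 - (J1 + c * J2) = (I0 - I1 - c * I3) + (I1 - J1) + (c * (I2 - J2) - c * (I2 - I3)) := by
      ring
    rw [e0]
    refine (abs_add_three _ _ _).trans ?_
    have e5 : |c * (I2 - J2) - c * (I2 - I3)| ≤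
        Cβ * (C1 / Real.sqrt (M.N i)) + Cβ * (C2 / Real.sqrt (M.N i)) := by
      refine (abs_sub _ _).trans (add_le_add ?_ ?_) <;> rw [abs_mul] <;> gcongr
    have e6 : C5 / Real.sqrt (M.N i) = C3 / Real.sqrt (M.N i) + C1 / Real.sqrt (M.N i) +
        (Cβ * (C1 / Real.sqrt (M.N i)) + Cβ * (C2 / Real.sqrt (M.N i))) := by
      rw [hC5]; ring
    rw [e6]
    exact add_le_add (add_le_add e3 e1') e5
  -- tracing the expansion against `F` determines `β`
  set c := β / (1 + δ i) with hcd
  set κ := (1 + δ i)⁻¹ * (M.F i * (R * A i * R)).trace with hκ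
  set t := (M.F i * W).trace with ht'
  have ht1 : t ≤ δ i := by
    have := trace_sandwich_le hγ (by positivity : (0 : ℝ) ≤ M.N i + 1) (M.F_psd i) (hδ i) (hδe i)
    rwa [← hR, ← hΨ] at this
  have hΔ : (1 + δ i)⁻¹ ≤ 1 - (1 + δ i)⁻¹ * t := by
    have h6 : (1 + δ i)⁻¹ * (1 + t) ≤ (1 + δ i)⁻¹ * (1 + δ i) := by gcongr
    rw [inv_mul_cancel₀ hd1.ne'] at h6
    linarith
  have hΔ0 : 0 < 1 - (1 + δ i)⁻¹ * t := lt_of_lt_of_le (by positivity) hΔ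
  have h6 := abs_trace_mul_le (M.F_psd i) (abs_quad_le_of_unit fun a ha => h5 a a ha ha)
  rw [mul_sub, Matrix.trace_sub, hE, trace_mul_matIntegral hint, mul_add, Matrix.trace_add,
    Matrix.mul_smul, Matrix.trace_smul, smul_eq_mul] at h6
  have h7 : |∫ z, (M.F i * (regInv γ (gram z) * A i * regInv γ (gram z))).trace ∂(M.rows' i) - β| ≤
    C4 / Real.sqrt (M.N i) := h4 i
  have h8 : C5 / Real.sqrt (M.N i) * (M.F i).trace ≤ C5 * Ct / Real.sqrt (M.N i) := by
    rw [div_mul_eq_mul_div]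
    gcongr
    exact ht i
  have h9 : |β - ((M.F i * (R * A i * R)).trace + c * t)| ≤ (C5 * Ct + C4) / Real.sqrt (M.N i) := by
    rw [add_div (C5 * Ct) C4]
    rw [abs_le] at h6 h7 ⊢
    constructor <;> linarith
  have h10 : |c - κ / (1 - (1 + δ i)⁻¹ * t)| ≤ (C5 * Ct + C4) / Real.sqrt (M.N i) := by
    have e1 : c - κ / (1 - (1 + δ i)⁻¹ * t) =
        ((1 + δ i)⁻¹ / (1 - (1 + δ i)⁻¹ * t)) *
          (β - ((M.F i * (R * A i * R)).trace + c * t)) := by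
      have hβc : β = (1 + δ i) * c := by rw [hcd]; field_simp
      rw [hκ, hβc]
      have hΔ0' := hΔ0.ne'
      have hd1' := hd1.ne'
      generalize (M.F i * (R * A i * R)).trace = y
      rw [div_mul_eq_mul_div, eq_div_iff hΔ0', sub_mul, div_mul_cancel₀ _ hΔ0']
      field_simp
      ring
    rw [e1, abs_mul, abs_of_pos (by positivity)]
    refine (mul_le_of_le_one_left (abs_nonneg _) ?_).trans h9
    rwa [div_le_one hΔ0]
  intro a b ha hb
  have hWp : W.PosSemidef := sandwich_posSemidef
    (by rw [hRΨ]; exact regInv_posSemidef hγ hΨp) hΨp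
  have hW1 : ∀ x : Fin (M.T i) → ℝ, x ⬝ᵥ x ≤ 1 → x ⬝ᵥ W *ᵥ x ≤ γ⁻¹ := fun x hx => by
    rw [hW, dot_sandwich hRs, hRΨ]
    refine ((regInv_sandwich_le hγ hΨp x).trans (regInv_quad_le hγ hΨp x)).trans ?_
    exact mul_le_of_le_one_right hγ'.le hx
  have hWab : |a ⬝ᵥ W *ᵥ b| ≤ γ⁻¹ := by
    refine abs_le_of_sq_le_sq ((PSD.cauchy hWp a b).trans ?_) hγ'.le
    rw [sq]
    exact mul_le_mul (hW1 a ha) (hW1 b hb) (PSD.nonneg hWp b) hγ'.le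
  have e : E - (R * A i * R + (κ / (1 - (1 + δ i)⁻¹ * t)) • W) =
      (E - (R * A i * R + c • W)) + (c - κ / (1 - (1 + δ i)⁻¹ * t)) • W := by
    rw [sub_smul]; abel
  rw [e, Matrix.add_mulVec, dotProduct_add, Matrix.smul_mulVec, dotProduct_smul, smul_eq_mul,
    add_div, mul_div_right_comm (C5 * Ct + C4)]
  refine (abs_add_le _ _).trans (add_le_add (h5 a b ha hb) ?_)
  rw [abs_mul]
  exact mul_le_mul h10 hWab (abs_nonneg _) (by positivity)

end RowModel
end RandomFeatures

namespace RandomFeatures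

/-! ### Lipschitz images of Gaussian vectors -/

section Concentration

/-- The law of a vector of independent standard Gaussian variables indexed by `κ`. -/
noncomputable abbrev stdPi (κ : Type) [Fintype κ] : Measure (κ → ℝ) :=
  Measure.pi fun _ => gaussianReal 0 1

theorem lipschitzWith_ofLp {κ : Type} [Fintype κ] {f : (κ → ℝ) → ℝ} {l : ℝ} (hl : 0 ≤ l)
    (hf : ∀ w w', (f w - f w') ^ 2 ≤ l ^ 2 * ((w - w') ⬝ᵥ (w - w'))) :
    LipschitzWith l.toNNReal fun x : EuclideanSpace ℝ κ => f x.ofLp := by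
  refine LipschitzWith.of_dist_le_mul fun x y => ?_
  rw [Real.dist_eq, dist_eq_norm, Real.coe_toNNReal _ hl]
  refine abs_le_of_sq_le_sq ?_ (by positivity)
  rw [mul_pow, EuclideanSpace.real_norm_sq_eq]
  refine (hf _ _).trans (le_of_eq ?_)
  congr 1
  exact Finset.sum_congr rfl fun i _ => (sq _).symm

theorem continuous_of_sq_le {κ : Type} [Fintype κ] {f : (κ → ℝ) → ℝ} {l : ℝ} (hl : 0 ≤ l)
    (hf : ∀ w w', (f w - f w') ^ 2 ≤ l ^ 2 * ((w - w') ⬝ᵥ (w - w'))) : Continuous f := by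
  have := (lipschitzWith_ofLp hl hf).continuous.comp (PiLp.continuous_toLp 2 fun _ : κ => ℝ)
  exact this

theorem measurePreserving_toLp (κ : Type) [Fintype κ] :
    MeasurePreserving (MeasurableEquiv.toLp 2 (κ → ℝ)) (stdPi κ)
      (stdGaussian (EuclideanSpace ℝ κ)) :=
  ⟨MeasurableEquiv.measurable _, map_pi_eq_stdGaussian⟩

theorem integrable_stdPi_of_sq_le {κ : Type} [Fintype κ] {f : (κ → ℝ) → ℝ} {l : ℝ} (hl : 0 ≤ l)
    (hf : ∀ w w', (f w - f w') ^ 2 ≤ l ^ 2 * ((w - w') ⬝ᵥ (w - w'))) : Integrable f (stdPi κ) := by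
  have h := lipschitz_integrable_stdGaussian _ _ (lipschitzWith_ofLp hl hf)
  exact ((measurePreserving_toLp κ).integrable_comp_emb
    (MeasurableEquiv.measurableEmbedding _)).2 h

/-- Dimension-free moments of Lipschitz functions of a Gaussian vector. -/
theorem exists_lintegral_stdPi_le (k : ℕ) : ∃ C : ℝ≥0, ∀ (κ : Type) [Fintype κ] (f : (κ → ℝ) → ℝ)
    (l : ℝ), 0 ≤ l → (∀ w w', (f w - f w') ^ 2 ≤ l ^ 2 * ((w - w') ⬝ᵥ (w - w'))) →
    ∫⁻ w, ‖f w - ∫ w', f w' ∂(stdPi κ)‖ₑ ^ k ∂(stdPi κ) ≤ C * ‖l‖ₑ ^ k := by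
  rcases Nat.eq_zero_or_pos k with rfl | hk
  · exact ⟨1, fun κ _ f l _ _ => by simp⟩
  · have hfin : ENNReal.ofReal (Real.pi / 2) ^ k * gaussMoment k ≠ ∞ :=
      ENNReal.mul_ne_top (by simp) (gaussMoment_lt_top k).ne
    refine ⟨(ENNReal.ofReal (Real.pi / 2) ^ k * gaussMoment k).toNNReal, fun κ _ f l hl hf => ?_⟩
    rw [ENNReal.coe_toNNReal hfin]
    have h := lintegral_lipschitz_sub_integral_le _ _ (lipschitzWith_ofLp hl hf) k hk
    have hmp := measurePreserving_toLp κ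
    rw [← hmp.integral_comp (MeasurableEquiv.measurableEmbedding _),
      ← hmp.lintegral_comp_emb (MeasurableEquiv.measurableEmbedding _)] at h
    rw [Real.enorm_eq_ofReal hl]
    exact h

theorem momentBdd_stdPi {ι : Type} {κ : ι → Type} [∀ i, Fintype (κ i)] {f : ∀ i, (κ i → ℝ) → ℝ}
    {l : ℝ} (hl : 0 ≤ l)
    (hf : ∀ i w w', (f i w - f i w') ^ 2 ≤ l ^ 2 * ((w - w') ⬝ᵥ (w - w'))) :
    MomentBdd (fun i => stdPi (κ i)) fun i w => f i w - ∫ w', f i w' ∂(stdPi (κ i)) := by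
  intro k
  obtain ⟨C, hC⟩ := exists_lintegral_stdPi_le k
  refine ⟨fun i => (continuous_of_sq_le hl (hf i)).measurable.sub_const _, C * ‖l‖₊ ^ k,
    fun i => ?_⟩
  have := hC (κ i) (f i) l hl (hf i)
  rw [enorm_eq_nnnorm] at this
  exact_mod_cast this

theorem integrable_sq_stdPi (κ : Type) [Fintype κ] :
    Integrable (fun w : κ → ℝ => w ⬝ᵥ w) (stdPi κ) ∧
      ∫ w, w ⬝ᵥ w ∂(stdPi κ) = Fintype.card κ := by
  have h0 : Integrable (fun x : ℝ => x * x) (gaussianReal 0 1) := by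
    have := (memLp_id_gaussianReal (μ := 0) (v := 1) 2).integrable_sq
    simpa [sq] using this
  have h1 : ∫ x, x * x ∂(gaussianReal 0 1) = 1 := by
    have h := variance_id_gaussianReal (μ := 0) (v := 1)
    rw [variance_of_integral_eq_zero aemeasurable_id (by simp)] at h
    simpa [sq] using h
  have h2 : ∀ j : κ, Integrable (fun w : κ → ℝ => w j * w j) (stdPi κ) := fun j =>
    (measurePreserving_eval (fun _ : κ => gaussianReal 0 1) j).integrable_comp
      h0.aestronglyMeasurable |>.2 h0
  have h3 : ∀ j : κ, ∫ w : κ → ℝ, w j * w j ∂(stdPi κ) = 1 := fun j => by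
    have := integral_comp_eval (μ := fun _ : κ => gaussianReal 0 1) (i := j)
      h0.aestronglyMeasurable
    rw [this, h1]
  refine ⟨integrable_finsetSum _ fun j _ => h2 j, ?_⟩
  simp only [dotProduct]
  rw [integral_finsetSum _ fun j _ => h2 j]
  simp [h3]

theorem measurePreserving_curry (n p : ℕ) :
    MeasurePreserving (fun (w : Fin n × Fin p → ℝ) i k => w (i, k)) (stdPi (Fin n × Fin p))
      (gaussianMat n p) := by
  have h := Measure.infinitePi_map_curry (fun (_ : Fin n) (_ : Fin p) => gaussianReal 0 1)
  simp only [Measure.infinitePi_eq_pi] at h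
  refine ⟨by fun_prop, ?_⟩
  exact h

end Concentration

end RandomFeatures

namespace RandomFeatures

/-! ### Rows that are Lipschitz functions of Gaussian vectors -/

/-- The seminorm of a positive semidefinite form satisfies the triangle inequality. -/
theorem PSD.sqrt_sub_sq_le {τ : Type*} [Fintype τ] {B : Matrix τ τ ℝ} (hB : B.PosSemidef)
    (x y : τ → ℝ) :
    (Real.sqrt (x ⬝ᵥ B *ᵥ x) - Real.sqrt (y ⬝ᵥ B *ᵥ y)) ^ 2 ≤ (x - y) ⬝ᵥ B *ᵥ (x - y) := by
  have hx := PSD.nonneg hB x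
  have hy := PSD.nonneg hB y
  have h1 : x ⬝ᵥ B *ᵥ y ≤ Real.sqrt (x ⬝ᵥ B *ᵥ x) * Real.sqrt (y ⬝ᵥ B *ᵥ y) := by
    rw [← Real.sqrt_mul hx]
    exact Real.le_sqrt_of_sq_le (PSD.cauchy hB x y)
  have h2 := Real.sq_sqrt hx
  have h3 := Real.sq_sqrt hy
  simp only [Matrix.mulVec_sub, sub_dotProduct, dotProduct_sub]
  rw [dot_mulVec_swap (PSD.symm hB) y x]
  nlinarith

theorem sqrt_dot_self_sub_sq_le {τ : Type*} [Fintype τ] (x y : τ → ℝ) :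
    (Real.sqrt (x ⬝ᵥ x) - Real.sqrt (y ⬝ᵥ y)) ^ 2 ≤ (x - y) ⬝ᵥ (x - y) := by
  classical
  have := PSD.sqrt_sub_sq_le (Matrix.PosSemidef.one (n := τ) (R := ℝ)) x y
  simpa using this

theorem sum_dot_sum_le {τ : Type*} [Fintype τ] {n : ℕ} (x : Fin n → τ → ℝ) :
    (∑ i, x i) ⬝ᵥ (∑ i, x i) ≤ n * ∑ i, x i ⬝ᵥ x i := by
  simp only [dotProduct, Finset.sum_apply]
  rw [Finset.sum_comm, Finset.mul_sum]
  refine Finset.sum_le_sum fun j _ => ?_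
  have := sq_sum_le_card_mul_sum_sq (s := Finset.univ) (f := fun i => x i j)
  simpa [sq] using this

theorem integral_le_of_integral_sq_le {Ω : Type*} [MeasurableSpace Ω] {μ : Measure Ω}
    [IsProbabilityMeasure μ] {f : Ω → ℝ} (hf : Integrable f μ)
    (hf2 : Integrable (fun x => f x ^ 2) μ) {S : ℝ} (hS : ∫ x, f x ^ 2 ∂μ ≤ S) :
    ∫ x, f x ∂μ ≤ 1 + S := by
  have h1 : ∫ x, f x ∂μ ≤ ∫ x, (1 + f x ^ 2) ∂μ :=
    integral_mono hf ((integrable_const 1).add hf2) fun x => by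
      simp only
      nlinarith [sq_nonneg (f x - 1), sq_nonneg (f x)]
  rw [integral_add (integrable_const 1) hf2] at h1
  simp at h1
  linarith

/-- The empirical mean of `n` independent vectors has mean square deviation `O(1 / n)`. -/
theorem integral_empMean_sub_le {τ : Type} [Fintype τ] {ν : Measure (τ → ℝ)} [IsProbabilityMeasure ν]
    (h : Integrable (fun y : τ → ℝ => y ⬝ᵥ y) ν) {n : ℕ} (hn : 1 ≤ n) :
    Integrable (fun Y : Fin n → τ → ℝ =>
      n * ((empMean Y - meanVec ν) ⬝ᵥ (empMean Y - meanVec ν))) (Measure.pi fun _ => ν) ∧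
    ∫ Y : Fin n → τ → ℝ, n * ((empMean Y - meanVec ν) ⬝ᵥ (empMean Y - meanVec ν))
      ∂(Measure.pi fun _ => ν) ≤ ∫ y, y ⬝ᵥ y ∂ν := by
  have hn0 : (0 : ℝ) < n := by exact_mod_cast hn
  have hL : ∀ j, MemLp (fun y : τ → ℝ => y j) 2 ν := fun j =>
    (memLp_two_iff_integrable_sq (measurable_pi_apply j).aestronglyMeasurable).2
      (by simpa only [sq] using integrable_coord_mul h j j)
  have hL' : ∀ j (i : Fin n), MemLp (fun Y : Fin n → τ → ℝ => Y i j) 2 (Measure.pi fun _ => ν) :=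
    fun j i => (hL j).comp_measurePreserving (measurePreserving_eval (fun _ : Fin n => ν) i)
  have hsum : ∀ j, MemLp (∑ i, fun Y : Fin n → τ → ℝ => Y i j) 2 (Measure.pi fun _ => ν) :=
    fun j => memLp_finsetSum' _ fun i _ => hL' j i
  have hmean : ∀ j, ∫ Y : Fin n → τ → ℝ, (∑ i, fun Y : Fin n → τ → ℝ => Y i j) Y
      ∂(Measure.pi fun _ => ν) = n * meanVec ν j := by
    intro j
    simp only [Finset.sum_apply]
    rw [integral_finsetSum _ fun i _ => (hL' j i).integrable one_le_two]
    have e : ∀ i : Fin n, ∫ Y : Fin n → τ → ℝ, Y i j ∂(Measure.pi fun _ => ν) = meanVec ν j :=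
      fun i => integral_comp_eval (μ := fun _ : Fin n => ν) (i := i) (f := fun y : τ → ℝ => y j)
        (measurable_pi_apply j).aestronglyMeasurable
    simp [e]
  have ecoord : ∀ (Y : Fin n → τ → ℝ) j, n * ((empMean Y - meanVec ν) j * (empMean Y - meanVec ν) j) =
      (n : ℝ)⁻¹ * ((∑ i, fun Y : Fin n → τ → ℝ => Y i j) Y - n * meanVec ν j) ^ 2 := by
    intro Y j
    simp only [empMean, Pi.sub_apply, Pi.smul_apply, Finset.sum_apply, smul_eq_mul]
    field_simp
  have hvar : ∀ j, ∫ Y : Fin n → τ → ℝ, ((∑ i, fun Y : Fin n → τ → ℝ => Y i j) Y -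
      n * meanVec ν j) ^ 2 ∂(Measure.pi fun _ => ν) ≤ n * ∫ y, y j * y j ∂ν := by
    intro j
    have h1 := variance_eq_integral (hsum j).aestronglyMeasurable.aemeasurable
    rw [hmean j] at h1
    rw [← h1, variance_sum_pi (μ := fun _ : Fin n => ν) (X := fun _ (y : τ → ℝ) => y j)
      fun i => hL j]
    have h2 := variance_le_expectation_sq (hL j).aestronglyMeasurable
    simp only [Pi.pow_apply, sq] at h2
    simpa using mul_le_mul_of_nonneg_left h2 hn0.le
  have hi : ∀ j, Integrable (fun Y : Fin n → τ → ℝ =>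
      ((∑ i, fun Y : Fin n → τ → ℝ => Y i j) Y - n * meanVec ν j) ^ 2) (Measure.pi fun _ => ν) :=
    fun j => ((hsum j).sub (memLp_const _)).integrable_sq
  simp only [dotProduct, Finset.mul_sum, ecoord]
  refine ⟨integrable_finsetSum _ fun j _ => (hi j).const_mul _, ?_⟩
  rw [integral_finsetSum _ fun j _ => (hi j).const_mul _,
    integral_finsetSum _ fun j _ => integrable_coord_mul h j j]
  refine Finset.sum_le_sum fun j _ => ?_
  rw [integral_const_mul, inv_mul_le_iff₀ hn0]
  exact hvar j

theorem LpBdd.map {ι : Type*} {Ω Ω' : ι → Type*} [∀ i, MeasurableSpace (Ω i)]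
    [∀ i, MeasurableSpace (Ω' i)] {P : ∀ i, Measure (Ω i)} {Y : ∀ i, Ω i → Ω' i}
    (hY : ∀ i, Measurable (Y i)) {X : ∀ i, Ω' i → ℝ} (hX : ∀ i, Measurable (X i)) {k : ℕ}
    (h : LpBdd k P fun i ω => X i (Y i ω)) : LpBdd k (fun i => (P i).map (Y i)) X := by
  obtain ⟨-, C, hC⟩ := h
  refine ⟨hX, C, fun i => ?_⟩
  rw [lintegral_map ((hX i).enorm.pow_const k) (hY i)]
  exact hC i

/-- Rows `Y i w` that are Lipschitz functions of a standard Gaussian vector `w ∈ ℝ^p`, with Lipschitz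
constant `Λ / √N`, where `p = O(N)`. -/
structure GaussianRows (ι : Type) where
  /-- The order of magnitude of the dimensions; `1 / √N` is the scale of the fluctuations. -/
  N : ι → ℕ
  /-- The dimension of the Gaussian vector. -/
  p : ι → ℕ
  /-- The dimension of the rows. -/
  T : ι → ℕ
  /-- A row, as a function of the Gaussian vector. -/
  Y : ∀ i, (Fin (p i) → ℝ) → Fin (T i) → ℝ
  one_le : ∀ i, 1 ≤ N i
  /-- The Lipschitz constant, up to the factor `1 / √N`. -/
  Λ : ℝ
  Λ_nonneg : 0 ≤ Λ
  lip : ∀ i w w', N i * ((Y i w - Y i w') ⬝ᵥ (Y i w - Y i w')) ≤ Λ ^ 2 * ((w - w') ⬝ᵥ (w - w'))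
  /-- A bound for the squared length of a row at the origin. -/
  S : ℝ
  zero_le : ∀ i, Y i 0 ⬝ᵥ Y i 0 ≤ S
  /-- A bound for `p / N`. -/
  ρ : ℝ
  dim_le : ∀ i, (p i : ℝ) ≤ ρ * N i

namespace GaussianRows

variable {ι : Type} (R : GaussianRows ι)

theorem N_pos (i : ι) : (0 : ℝ) < R.N i := by exact_mod_cast R.one_le i

theorem lip' (i : ι) (w w' : Fin (R.p i) → ℝ) :
    (R.Y i w - R.Y i w') ⬝ᵥ (R.Y i w - R.Y i w') ≤ R.Λ ^ 2 * ((w - w') ⬝ᵥ (w - w')) := by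
  have hN : (1 : ℝ) ≤ R.N i := by exact_mod_cast R.one_le i
  nlinarith [R.lip i w w', dot_self_nonneg (R.Y i w - R.Y i w')]

theorem measurable_Y (i : ι) : Measurable (R.Y i) := by
  refine measurable_pi_lambda _ fun j => (continuous_of_sq_le R.Λ_nonneg fun w w' => ?_).measurable
  refine le_trans ?_ (R.lip' i w w')
  rw [sq]
  exact Finset.single_le_sum
    (f := fun l => (R.Y i w - R.Y i w') l * (R.Y i w - R.Y i w') l)
    (fun l _ => mul_self_nonneg _) (Finset.mem_univ j)

/-- The law of a row. -/
noncomputable abbrev ν (i : ι) : Measure (Fin (R.T i) → ℝ) := (stdPi (Fin (R.p i))).map (R.Y i)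

instance (i : ι) : IsProbabilityMeasure (R.ν i) :=
  Measure.isProbabilityMeasure_map (R.measurable_Y i).aemeasurable

theorem measurable_dot_self {n : ℕ} : Measurable fun y : Fin n → ℝ => y ⬝ᵥ y :=
  measurable_dot measurable_id measurable_id

theorem integrable_sq (i : ι) : Integrable (fun y : Fin (R.T i) → ℝ => y ⬝ᵥ y) (R.ν i) ∧
    ∫ y, y ⬝ᵥ y ∂(R.ν i) ≤ 2 * R.S + 2 * R.Λ ^ 2 * R.ρ := by
  have hm := measurable_dot_self (n := R.T i)
  obtain ⟨h1, h2⟩ := integrable_sq_stdPi (Fin (R.p i))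
  have hN := R.N_pos i
  have hb : ∀ w, R.Y i w ⬝ᵥ R.Y i w ≤ 2 * R.S + 2 * R.Λ ^ 2 / R.N i * (w ⬝ᵥ w) := by
    intro w
    have e1 := R.lip i w 0
    have e2 := R.zero_le i
    have e3 := PSD.add_quad_le (Matrix.PosSemidef.one (n := Fin (R.T i)) (R := ℝ)) (R.Y i 0)
      (R.Y i w - R.Y i 0)
    simp only [Matrix.one_mulVec, add_sub_cancel] at e3
    rw [sub_zero] at e1
    have e4 : (R.Y i w - R.Y i 0) ⬝ᵥ (R.Y i w - R.Y i 0) ≤ R.Λ ^ 2 / R.N i * (w ⬝ᵥ w) := by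
      rw [div_mul_eq_mul_div, le_div_iff₀ hN]
      linarith
    calc _ ≤ _ := e3
      _ ≤ 2 * R.S + 2 * (R.Λ ^ 2 / R.N i * (w ⬝ᵥ w)) := by gcongr
      _ = _ := by ring
  have hi : Integrable (fun w => 2 * R.S + 2 * R.Λ ^ 2 / R.N i * (w ⬝ᵥ w)) (stdPi (Fin (R.p i))) :=
    (integrable_const _).add (h1.const_mul _)
  have hY : Integrable (fun w => R.Y i w ⬝ᵥ R.Y i w) (stdPi (Fin (R.p i))) := by
    refine hi.mono' (hm.comp (R.measurable_Y i)).aestronglyMeasurable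
      (Eventually.of_forall fun w => ?_)
    rw [Real.norm_eq_abs, abs_of_nonneg (dot_self_nonneg _)]
    exact hb w
  refine ⟨(integrable_map_measure hm.aestronglyMeasurable (R.measurable_Y i).aemeasurable).2 hY, ?_⟩
  rw [integral_map (R.measurable_Y i).aemeasurable hm.aestronglyMeasurable]
  refine (integral_mono hY hi hb).trans ?_
  rw [integral_add (integrable_const _) (h1.const_mul _),
    integral_const_mul (2 * R.Λ ^ 2 / R.N i), h2]
  simp only [integral_const, probReal_univ, one_smul, Fintype.card_fin, add_le_add_iff_left]
  have := R.dim_le i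
  calc 2 * R.Λ ^ 2 / R.N i * R.p i ≤ 2 * R.Λ ^ 2 / R.N i * (R.ρ * R.N i) := by gcongr
    _ = _ := by field_simp

/-- A bound for the mean square length of a row. -/
noncomputable def S2 : ℝ := 2 * R.S + 2 * R.Λ ^ 2 * R.ρ

theorem moment : MomentBdd R.ν fun _ y => y ⬝ᵥ y := by
  have hl : ∀ i (w w' : Fin (R.p i) → ℝ), (Real.sqrt (R.Y i w ⬝ᵥ R.Y i w) -
      Real.sqrt (R.Y i w' ⬝ᵥ R.Y i w')) ^ 2 ≤ R.Λ ^ 2 * ((w - w') ⬝ᵥ (w - w')) := fun i w w' =>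
    (sqrt_dot_self_sub_sq_le _ _).trans (R.lip' i w w')
  have h1 := momentBdd_stdPi R.Λ_nonneg hl
  have h2 : MomentBdd (fun i => stdPi (Fin (R.p i))) fun i _ =>
      ∫ w', Real.sqrt (R.Y i w' ⬝ᵥ R.Y i w') ∂(stdPi (Fin (R.p i))) := by
    refine MomentBdd.of_bound (fun i => measurable_const) (1 + R.S2) fun i _ => ?_
    rw [abs_of_nonneg (integral_nonneg fun w => Real.sqrt_nonneg _)]
    have e : ∀ w, Real.sqrt (R.Y i w ⬝ᵥ R.Y i w) ^ 2 = R.Y i w ⬝ᵥ R.Y i w := fun w =>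
      Real.sq_sqrt (dot_self_nonneg _)
    obtain ⟨h3, h4⟩ := R.integrable_sq i
    have hm := measurable_dot_self (n := R.T i)
    refine integral_le_of_integral_sq_le (integrable_stdPi_of_sq_le R.Λ_nonneg (hl i)) ?_ ?_
    · simp only [e]
      exact (integrable_map_measure hm.aestronglyMeasurable (R.measurable_Y i).aemeasurable).1 h3
    · simp only [e]
      rwa [integral_map (R.measurable_Y i).aemeasurable hm.aestronglyMeasurable] at h4
  intro k
  refine LpBdd.map R.measurable_Y (fun i => measurable_dot_self) ?_
  refine (((h1.add h2).pow 2) k).mono (fun i => measurable_dot_self.comp (R.measurable_Y i))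
    fun i w => le_of_eq ?_
  rw [sub_add_cancel, Real.sq_sqrt (dot_self_nonneg _)]

theorem linear (k : ℕ) : ∃ C : ℝ≥0, ∀ i (h : Fin (R.T i) → ℝ) (H : ℝ), h ⬝ᵥ h ≤ H ^ 2 →
    ∫⁻ y, ‖Real.sqrt (R.N i) * (y ⬝ᵥ h - meanVec (R.ν i) ⬝ᵥ h)‖ₑ ^ k ∂(R.ν i) ≤ C * ‖H‖ₑ ^ k := by
  obtain ⟨C, hC⟩ := exists_lintegral_stdPi_le k
  refine ⟨C * ‖R.Λ‖₊ ^ k, fun i h H hH => ?_⟩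
  have hN := Real.sqrt_pos.2 (R.N_pos i)
  have hm : Measurable fun y : Fin (R.T i) → ℝ => y ⬝ᵥ h := measurable_dot measurable_id measurable_const
  have h1 := hC (Fin (R.p i)) (fun w => Real.sqrt (R.N i) * (R.Y i w ⬝ᵥ h)) (R.Λ * |H|)
    (mul_nonneg R.Λ_nonneg (abs_nonneg _)) fun w w' => by
      rw [← mul_sub, ← sub_dotProduct, mul_pow, Real.sq_sqrt (R.N_pos i).le, mul_pow, sq_abs]
      have e1 := dot_sq_le (R.Y i w - R.Y i w') h
      have e2 := R.lip i w w'
      have e3 := dot_self_nonneg h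
      calc _ ≤ R.N i * (((R.Y i w - R.Y i w') ⬝ᵥ (R.Y i w - R.Y i w')) * (h ⬝ᵥ h)) := by gcongr
        _ = (R.N i * ((R.Y i w - R.Y i w') ⬝ᵥ (R.Y i w - R.Y i w'))) * (h ⬝ᵥ h) := by ring
        _ ≤ (R.Λ ^ 2 * ((w - w') ⬝ᵥ (w - w'))) * H ^ 2 := by
          refine mul_le_mul e2 hH e3 ?_
          exact mul_nonneg (sq_nonneg _) (dot_self_nonneg _)
        _ = _ := by ring
  rw [lintegral_map (((hm.sub_const _).const_mul _).enorm.pow_const k) (R.measurable_Y i),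
    ← integral_dot (R.integrable_sq i).1,
    integral_map (R.measurable_Y i).aemeasurable hm.aestronglyMeasurable]
  rw [integral_const_mul, enorm_mul, mul_pow] at h1
  simp only [← mul_sub] at h1
  refine h1.trans (le_of_eq ?_)
  rw [Real.enorm_eq_ofReal_abs |H|, abs_abs, ← Real.enorm_eq_ofReal_abs, enorm_eq_nnnorm R.Λ]
  push_cast
  ring

/-- Positive semidefinite matrices with a positive bound for their forms. -/
def Form : Type :=
  Σ i, {q : Matrix (Fin (R.T i)) (Fin (R.T i)) ℝ × ℝ // q.1.PosSemidef ∧ 0 < q.2 ∧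
    ∀ x : Fin (R.T i) → ℝ, x ⬝ᵥ q.1 *ᵥ x ≤ q.2 * (x ⬝ᵥ x)}

/-- The square root of a quadratic form of a row is a Lipschitz function of the Gaussian vector, and
`f ^ 2 - E f ^ 2` is a polynomial in `f - E f`. -/
theorem quad_normalised (k : ℕ) : LpBdd k (fun j : R.Form => R.ν j.1) fun j y =>
    Real.sqrt (R.N j.1) * (y ⬝ᵥ j.2.1.1 *ᵥ y - (secondMoment (R.ν j.1) * j.2.1.1).trace) /
      j.2.1.2 := by
  have hmB : ∀ j : R.Form, Measurable fun y : Fin (R.T j.1) → ℝ => y ⬝ᵥ j.2.1.1 *ᵥ y := fun j =>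
    measurable_dot measurable_id ((MatMeasurable.const _).mulVec measurable_id)
  obtain ⟨f, hf⟩ : ∃ f : ∀ j : R.Form, (Fin (R.p j.1) → ℝ) → ℝ, f = fun j w =>
    Real.sqrt (R.N j.1 / j.2.1.2) * Real.sqrt (R.Y j.1 w ⬝ᵥ j.2.1.1 *ᵥ R.Y j.1 w) := ⟨_, rfl⟩
  have hNβ : ∀ j : R.Form, 0 ≤ R.N j.1 / j.2.1.2 := fun j =>
    div_nonneg (R.N_pos j.1).le j.2.2.2.1.le
  have hl : ∀ j w w', (f j w - f j w') ^ 2 ≤ R.Λ ^ 2 * ((w - w') ⬝ᵥ (w - w')) := by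
    intro j w w'
    have hβ := j.2.2.2.1
    have e1 := PSD.sqrt_sub_sq_le j.2.2.1 (R.Y j.1 w) (R.Y j.1 w')
    have e2 := j.2.2.2.2 (R.Y j.1 w - R.Y j.1 w')
    simp only [hf]
    rw [← mul_sub, mul_pow, Real.sq_sqrt (hNβ j)]
    refine le_trans ?_ (R.lip j.1 w w')
    calc _ ≤ R.N j.1 / j.2.1.2 * (j.2.1.2 *
          ((R.Y j.1 w - R.Y j.1 w') ⬝ᵥ (R.Y j.1 w - R.Y j.1 w'))) :=
          mul_le_mul_of_nonneg_left (e1.trans e2) (hNβ j)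
      _ = _ := by field_simp
  have hf2 : ∀ j w, f j w ^ 2 = R.N j.1 / j.2.1.2 * (R.Y j.1 w ⬝ᵥ j.2.1.1 *ᵥ R.Y j.1 w) := by
    intro j w
    simp only [hf]
    rw [mul_pow, Real.sq_sqrt (hNβ j), Real.sq_sqrt (PSD.nonneg j.2.2.1 _)]
  have hi2 : ∀ j : R.Form, Integrable (fun w => R.Y j.1 w ⬝ᵥ j.2.1.1 *ᵥ R.Y j.1 w) (stdPi (Fin (R.p j.1))) ∧
      ∫ w, R.Y j.1 w ⬝ᵥ j.2.1.1 *ᵥ R.Y j.1 w ∂(stdPi (Fin (R.p j.1))) =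
        (secondMoment (R.ν j.1) * j.2.1.1).trace := by
    intro j
    have e1 := integrable_quad (R.integrable_sq j.1).1 j.2.1.1
    refine ⟨(integrable_map_measure (hmB j).aestronglyMeasurable
      (R.measurable_Y j.1).aemeasurable).1 e1, ?_⟩
    rw [← integral_quad (R.integrable_sq j.1).1, integral_map (R.measurable_Y j.1).aemeasurable
      (hmB j).aestronglyMeasurable]
  have hfi : ∀ j : R.Form, Integrable (f j) (stdPi (Fin (R.p j.1))) := fun j =>
    integrable_stdPi_of_sq_le R.Λ_nonneg (hl j)
  have hf2i : ∀ j : R.Form, Integrable (fun w => f j w ^ 2) (stdPi (Fin (R.p j.1))) := fun j => by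
    simp only [hf2]
    exact (hi2 j).1.const_mul _
  obtain ⟨E, hE⟩ : ∃ E : R.Form → ℝ, E = fun j => ∫ w, f j w ∂(stdPi (Fin (R.p j.1))) := ⟨_, rfl⟩
  have hX := momentBdd_stdPi R.Λ_nonneg hl
  have hXE : ∀ j : R.Form, ∫ w, f j w ∂(stdPi (Fin (R.p j.1))) = E j := fun j => by rw [hE]
  simp only [hXE] at hX
  -- the mean of `f / √N` is bounded
  have hEb : ∀ j : R.Form, |E j / Real.sqrt (R.N j.1)| ≤ 1 + R.S2 := by
    intro j
    have hN := R.N_pos j.1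
    have hβ := j.2.2.2.1
    have hs := Real.sqrt_pos.2 hN
    have hE0 : 0 ≤ E j := by
      rw [← hXE]
      exact integral_nonneg fun w => by
        simp only [hf]
        exact mul_nonneg (Real.sqrt_nonneg _) (Real.sqrt_nonneg _)
    rw [abs_of_nonneg (by positivity), div_eq_mul_inv, ← hXE, ← integral_mul_const]
    have e : ∀ w, (f j w * (Real.sqrt (R.N j.1))⁻¹) ^ 2 =
        j.2.1.2⁻¹ * (R.Y j.1 w ⬝ᵥ j.2.1.1 *ᵥ R.Y j.1 w) := fun w => by
      rw [mul_pow, hf2, inv_pow, Real.sq_sqrt hN.le]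
      field_simp
    refine integral_le_of_integral_sq_le ((hfi j).mul_const _) ?_ ?_
    · simp only [e]
      exact (hi2 j).1.const_mul _
    · simp only [e]
      obtain ⟨h3, h4⟩ := R.integrable_sq j.1
      rw [integral_const_mul, (hi2 j).2, ← integral_quad h3, inv_mul_le_iff₀ hβ]
      refine (integral_mono (integrable_quad h3 _) (h3.const_mul _) j.2.2.2.2).trans ?_
      rw [integral_const_mul]
      exact mul_le_mul_of_nonneg_left h4 hβ.le
  have hX2 : ∀ j : R.Form, ∫ w, (f j w - E j) ^ 2 ∂(stdPi (Fin (R.p j.1))) =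
      ∫ w, f j w ^ 2 ∂(stdPi (Fin (R.p j.1))) - E j ^ 2 := by
    intro j
    have e : ∀ w, (f j w - E j) ^ 2 = f j w ^ 2 - 2 * E j * f j w + E j ^ 2 := fun w => by ring
    simp only [e]
    have h5 := integral_add ((hf2i j).sub ((hfi j).const_mul (2 * E j)))
      (integrable_const (μ := stdPi (Fin (R.p j.1))) (E j ^ 2))
    have h6 := integral_sub (hf2i j) ((hfi j).const_mul (2 * E j))
    simp only [Pi.sub_apply] at h5 h6
    rw [h5, h6, integral_const_mul, hXE]
    simp
    ring
  obtain ⟨C, hC, hV⟩ := ((hX.pow 2) 1).abs_integral_le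
  have hsN : ∀ j : R.Form, 1 ≤ Real.sqrt (R.N j.1) := fun j =>
    Real.one_le_sqrt.2 (by exact_mod_cast R.one_le j.1)
  have hinv : MomentBdd (fun j : R.Form => stdPi (Fin (R.p j.1))) fun j _ =>
      (Real.sqrt (R.N j.1))⁻¹ := by
    refine MomentBdd.of_bound (fun j => measurable_const) 1 fun j _ => ?_
    rw [abs_of_nonneg (by positivity)]
    exact inv_le_one_of_one_le₀ (hsN j)
  have hEB : MomentBdd (fun j : R.Form => stdPi (Fin (R.p j.1))) fun j _ =>
      E j / Real.sqrt (R.N j.1) := MomentBdd.of_bound (fun j => measurable_const) _ fun j _ => hEb j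
  have hVB : MomentBdd (fun j : R.Form => stdPi (Fin (R.p j.1))) fun j _ =>
      ∫ w, (f j w - E j) ^ 2 ∂(stdPi (Fin (R.p j.1))) :=
    MomentBdd.of_bound (fun j => measurable_const) _ fun j _ => hV j
  have hall := ((((hX.pow 2).mul hinv).add ((hEB.mul hX).const_mul 2)).add
    ((hVB.mul hinv).const_mul (-1)))
  have hYm : ∀ j : R.Form, Measurable (R.Y j.1) := fun j => R.measurable_Y j.1
  refine LpBdd.map hYm (fun j => (((hmB j).sub_const _).const_mul _).div_const _) ?_
  refine (hall k).mono (fun j => ((((hmB j).comp (R.measurable_Y j.1)).sub_const _).const_mul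
    _).div_const _) fun j w => le_of_eq ?_
  have hN := R.N_pos j.1
  have hβ := j.2.2.2.1
  have hs := Real.sqrt_pos.2 hN
  have hss := Real.sq_sqrt hN.le
  have e1 := hf2 j w
  have e2 : ∫ w, f j w ^ 2 ∂(stdPi (Fin (R.p j.1))) =
      R.N j.1 / j.2.1.2 * (secondMoment (R.ν j.1) * j.2.1.1).trace := by
    simp only [hf2]
    rw [integral_const_mul, (hi2 j).2]
  congr 1
  rw [hX2, e2]
  have e3 : R.Y j.1 w ⬝ᵥ j.2.1.1 *ᵥ R.Y j.1 w = j.2.1.2 / R.N j.1 * f j w ^ 2 := by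
    rw [e1]; field_simp
  rw [e3]
  generalize Real.sqrt (R.N j.1) = s at hs hss ⊢
  rw [← hss]
  field_simp
  ring

theorem quad (k : ℕ) : ∃ C : ℝ≥0, ∀ i (B : Matrix (Fin (R.T i)) (Fin (R.T i)) ℝ) (β : ℝ),
    B.PosSemidef → (∀ x : Fin (R.T i) → ℝ, x ⬝ᵥ B *ᵥ x ≤ β * (x ⬝ᵥ x)) →
    ∫⁻ y, ‖Real.sqrt (R.N i) * (y ⬝ᵥ B *ᵥ y - (secondMoment (R.ν i) * B).trace)‖ₑ ^ k ∂(R.ν i) ≤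
      C * ‖β‖ₑ ^ k := by
  obtain ⟨-, C, hC⟩ := R.quad_normalised k
  refine ⟨C + 1, fun i B β hB h => ?_⟩
  rcases le_or_gt β 0 with hβ | hβ
  · -- in this case the form vanishes
    have h0 : ∀ x : Fin (R.T i) → ℝ, x ⬝ᵥ B *ᵥ x = 0 := fun x =>
      le_antisymm ((h x).trans (mul_nonpos_of_nonpos_of_nonneg hβ (dot_self_nonneg x)))
        (PSD.nonneg hB x)
    have h1 : (secondMoment (R.ν i) * B).trace = 0 := by
      rw [← integral_quad (R.integrable_sq i).1]
      simp [h0]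
    rcases Nat.eq_zero_or_pos k with rfl | hk
    · simp
    · simp [h0, h1, hk.ne']
  · have h1 := hC ⟨i, (B, β), hB, hβ, h⟩
    have h2 : ∀ y : Fin (R.T i) → ℝ,
        ‖Real.sqrt (R.N i) * (y ⬝ᵥ B *ᵥ y - (secondMoment (R.ν i) * B).trace)‖ₑ ^ k =
        ‖β‖ₑ ^ k * ‖Real.sqrt (R.N i) * (y ⬝ᵥ B *ᵥ y - (secondMoment (R.ν i) * B).trace) /
          β‖ₑ ^ k := fun y => by
      rw [← mul_pow, ← enorm_mul, mul_div_cancel₀ _ hβ.ne']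
    simp only [h2]
    rw [lintegral_const_mul' _ _ (by simp), mul_comm]
    push_cast
    gcongr
    exact h1.trans le_self_add

/-- `√N |ȳ - m|` is a Lipschitz function of the whole Gaussian array, with a bounded mean. -/
theorem mean : MomentBdd (fun i => Measure.pi fun _ : Fin (R.N i) => R.ν i)
    fun i Y => meanDev (meanVec (R.ν i)) Y := by
  have hMm : ∀ i, Measurable fun (w : Fin (R.N i) × Fin (R.p i) → ℝ) (j : Fin (R.N i)) =>
      R.Y i fun l => w (j, l) := fun i => measurable_pi_lambda _ fun j =>
    (R.measurable_Y i).comp (by fun_prop)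
  -- the law of the array of rows, as an image of a Gaussian vector
  have hmap : ∀ i, (Measure.pi fun _ : Fin (R.N i) => R.ν i) =
      (stdPi (Fin (R.N i) × Fin (R.p i))).map fun w j => R.Y i fun l => w (j, l) := by
    intro i
    have h1 := Measure.pi_map_pi (μ := fun _ : Fin (R.N i) => gaussianVec (R.p i))
      (f := fun _ => R.Y i) (hμ := fun _ => inferInstanceAs (SigmaFinite (R.ν i)))
      fun _ => (R.measurable_Y i).aemeasurable
    have h2 := (measurePreserving_curry (R.N i) (R.p i)).map_eq
    rw [gaussianMat] at h2
    have h3 : Measurable fun (x : Fin (R.N i) → Fin (R.p i) → ℝ) j => R.Y i (x j) :=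
      measurable_pi_lambda _ fun j => (R.measurable_Y i).comp (measurable_pi_apply j)
    rw [← h2, Measure.map_map h3 (measurePreserving_curry _ _).measurable] at h1
    exact h1.symm
  have hmeas : ∀ i, Measurable fun Y : Fin (R.N i) → Fin (R.T i) → ℝ =>
      (R.N i : ℝ) * ((empMean Y - meanVec (R.ν i)) ⬝ᵥ (empMean Y - meanVec (R.ν i))) := by
    intro i
    have : Measurable fun Y : Fin (R.N i) → Fin (R.T i) → ℝ => empMean Y - meanVec (R.ν i) := by
      unfold empMean
      fun_prop
    exact (measurable_dot this this).const_mul _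
  obtain ⟨f, hf⟩ : ∃ f : ∀ i, (Fin (R.N i) → Fin (R.T i) → ℝ) → ℝ, f = fun i Y =>
    Real.sqrt (R.N i) *
      Real.sqrt ((empMean Y - meanVec (R.ν i)) ⬝ᵥ (empMean Y - meanVec (R.ν i))) := ⟨_, rfl⟩
  have hf2 : ∀ i Y, f i Y ^ 2 =
      R.N i * ((empMean Y - meanVec (R.ν i)) ⬝ᵥ (empMean Y - meanVec (R.ν i))) := fun i Y => by
    simp only [hf]
    rw [mul_pow, Real.sq_sqrt (R.N_pos i).le, Real.sq_sqrt (dot_self_nonneg _)]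
  have hl : ∀ i (w w' : Fin (R.N i) × Fin (R.p i) → ℝ),
      (f i (fun j => R.Y i fun l => w (j, l)) - f i (fun j => R.Y i fun l => w' (j, l))) ^ 2 ≤
      R.Λ ^ 2 * ((w - w') ⬝ᵥ (w - w')) := by
    intro i w w'
    have hN := R.N_pos i
    simp only [hf]
    rw [← mul_sub, mul_pow, Real.sq_sqrt hN.le]
    have e1 := sqrt_dot_self_sub_sq_le
      (empMean (fun j => R.Y i fun l => w (j, l)) - meanVec (R.ν i))
      (empMean (fun j => R.Y i fun l => w' (j, l)) - meanVec (R.ν i))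
    have e2 : empMean (fun j => R.Y i fun l => w (j, l)) - meanVec (R.ν i) -
        (empMean (fun j => R.Y i fun l => w' (j, l)) - meanVec (R.ν i)) =
        (R.N i : ℝ)⁻¹ • ∑ j, ((R.Y i fun l => w (j, l)) - R.Y i fun l => w' (j, l)) := by
      rw [sub_sub_sub_cancel_right, empMean, empMean, ← smul_sub, Finset.sum_sub_distrib]
    have e3 := sum_dot_sum_le fun j : Fin (R.N i) =>
      (R.Y i fun l => w (j, l)) - R.Y i fun l => w' (j, l)
    rw [e2, smul_dotProduct, dotProduct_smul, smul_eq_mul, smul_eq_mul] at e1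
    have e4 : ∑ j : Fin (R.N i), ((R.Y i fun l => w (j, l)) - R.Y i fun l => w' (j, l)) ⬝ᵥ
        ((R.Y i fun l => w (j, l)) - R.Y i fun l => w' (j, l)) ≤
        R.Λ ^ 2 * ((w - w') ⬝ᵥ (w - w')) := by
      have e5 : (w - w') ⬝ᵥ (w - w') = ∑ j : Fin (R.N i),
          ((fun l => w (j, l)) - fun l => w' (j, l)) ⬝ᵥ ((fun l => w (j, l)) - fun l => w' (j, l)) := by
        simp only [dotProduct, Fintype.sum_prod_type, Pi.sub_apply]
      rw [e5, Finset.mul_sum]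
      exact Finset.sum_le_sum fun j _ => R.lip' i _ _
    calc _ ≤ R.N i * ((R.N i : ℝ)⁻¹ * ((R.N i : ℝ)⁻¹ * (R.N i * ∑ j : Fin (R.N i),
          ((R.Y i fun l => w (j, l)) - R.Y i fun l => w' (j, l)) ⬝ᵥ
          ((R.Y i fun l => w (j, l)) - R.Y i fun l => w' (j, l))))) := by
          refine mul_le_mul_of_nonneg_left (e1.trans ?_) hN.le
          gcongr
      _ = ∑ j : Fin (R.N i), ((R.Y i fun l => w (j, l)) - R.Y i fun l => w' (j, l)) ⬝ᵥ
          ((R.Y i fun l => w (j, l)) - R.Y i fun l => w' (j, l)) := by field_simp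
      _ ≤ _ := e4
  have hX := momentBdd_stdPi R.Λ_nonneg hl
  have hE : MomentBdd (fun i => stdPi (Fin (R.N i) × Fin (R.p i))) fun i _ =>
      ∫ w, f i (fun j => R.Y i fun l => w (j, l)) ∂(stdPi (Fin (R.N i) × Fin (R.p i))) := by
    refine MomentBdd.of_bound (fun i => measurable_const) (1 + R.S2) fun i _ => ?_
    rw [abs_of_nonneg (integral_nonneg fun w => by
      simp only [hf]; exact mul_nonneg (Real.sqrt_nonneg _) (Real.sqrt_nonneg _))]
    obtain ⟨h3, h4⟩ := R.integrable_sq i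
    obtain ⟨h5, h6⟩ := integral_empMean_sub_le h3 (R.one_le i)
    rw [hmap i] at h5 h6
    refine integral_le_of_integral_sq_le (integrable_stdPi_of_sq_le R.Λ_nonneg (hl i)) ?_ ?_
    · simp only [hf2]
      exact (integrable_map_measure (hmeas i).aestronglyMeasurable (hMm i).aemeasurable).1 h5
    · simp only [hf2]
      rw [integral_map (hMm i).aemeasurable (hmeas i).aestronglyMeasurable] at h6
      exact h6.trans h4
  have hmd : ∀ i, Measurable fun Y : Fin (R.N i) → Fin (R.T i) → ℝ => meanDev (meanVec (R.ν i)) Y :=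
    fun i => (hmeas i).const_add 1
  intro k
  simp only [hmap]
  refine LpBdd.map hMm hmd ?_
  refine (((MomentBdd.const 1).add ((hX.add hE).pow 2)) k).mono (fun i => (hmd i).comp (hMm i))
    fun i w => le_of_eq ?_
  rw [sub_add_cancel, hf2]
  rfl

/-- The family of row laws. -/
noncomputable def toRowModel : RowModel ι where
  N := R.N
  T := R.T
  ν := R.ν
  prob _ := inferInstance
  one_le := R.one_le
  moment := R.moment
  linear := R.linear
  quad := R.quad
  mean := R.mean

end GaussianRows

end RandomFeatures

namespace RandomFeatures

/-! ### Euclidean operator norms -/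

theorem mulVec_dot_self_le {τ τ' : Type*} [Fintype τ] [Fintype τ'] [DecidableEq τ']
    (M : Matrix τ τ' ℝ) (x : τ' → ℝ) : (M *ᵥ x) ⬝ᵥ (M *ᵥ x) ≤ ‖M‖ ^ 2 * (x ⬝ᵥ x) := by
  have h := pow_le_pow_left₀ (norm_nonneg _) (M.l2_opNorm_mulVec (WithLp.toLp 2 x)) 2
  rw [mul_pow, EuclideanSpace.real_norm_sq_eq, EuclideanSpace.real_norm_sq_eq] at h
  simpa [dotProduct, ← sq] using h

theorem vecMul_dot_self_le {τ τ' : Type*} [Fintype τ] [Fintype τ'] [DecidableEq τ] [DecidableEq τ']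
    (M : Matrix τ τ' ℝ) (x : τ → ℝ) : (x ᵥ* M) ⬝ᵥ (x ᵥ* M) ≤ ‖M‖ ^ 2 * (x ⬝ᵥ x) := by
  have h := mulVec_dot_self_le Mᵀ x
  rwa [Matrix.mulVec_transpose, ← Matrix.conjTranspose_eq_transpose_of_trivial,
    Matrix.l2_opNorm_conjTranspose] at h

theorem opNorm_le_of_abs_dot_le {τ : Type*} [Fintype τ] [DecidableEq τ] {M : Matrix τ τ ℝ} {c : ℝ}
    (hc : 0 ≤ c) (h : ∀ a b : τ → ℝ, a ⬝ᵥ a ≤ 1 → b ⬝ᵥ b ≤ 1 → |a ⬝ᵥ M *ᵥ b| ≤ c) : ‖M‖ ≤ c := by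
  rw [← Matrix.l2_opNorm_toEuclideanCLM]
  refine ContinuousLinearMap.opNorm_le_of_re_inner_le (𝕜 := ℝ) hc fun x y hx hy => ?_
  have hu : ∀ z : EuclideanSpace ℝ τ, ‖z‖ = 1 → z.ofLp ⬝ᵥ z.ofLp ≤ 1 := fun z hz => by
    have h1 := EuclideanSpace.real_norm_sq_eq z
    rw [hz, one_pow] at h1
    simp only [dotProduct, ← sq]
    exact h1.symm.le
  refine le_trans (le_of_eq ?_) ((le_abs_self _).trans (h y.ofLp x.ofLp (hu y hy) (hu x hx)))
  simp [EuclideanSpace.inner_eq_star_dotProduct]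

/-! ### Rows of the feature matrix -/

section FeatureRow

variable {p T : ℕ} (σ φ : ℝ → ℝ) (X : Matrix (Fin p) (Fin T) ℝ)

/-- A row of the feature matrix `σ (φ (W̃) X)`, divided by `√T`, as a function of the corresponding
row of `W̃`. -/
noncomputable def featureRow (w : Fin p → ℝ) : Fin T → ℝ := fun j =>
  (Real.sqrt T)⁻¹ * σ (((fun k => φ (w k)) ᵥ* X) j)

variable {σ φ} {X}

theorem sq_sub_le_of_lipschitzWith {f : ℝ → ℝ} {l : ℝ≥0} (hf : LipschitzWith l f) (s t : ℝ) :
    (f s - f t) ^ 2 ≤ (l : ℝ) ^ 2 * (s - t) ^ 2 := by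
  have h := hf.dist_le_mul s t
  rw [Real.dist_eq, Real.dist_eq] at h
  rw [← sq_abs, ← sq_abs (s - t), ← mul_pow]
  exact pow_le_pow_left₀ (abs_nonneg _) h 2

theorem featureRow_sub_dot_self_le {lamσ lamφ : ℝ≥0} (hσ : LipschitzWith lamσ σ)
    (hφ : LipschitzWith lamφ φ) (w w' : Fin p → ℝ) :
    (featureRow σ φ X w - featureRow σ φ X w') ⬝ᵥ (featureRow σ φ X w - featureRow σ φ X w') ≤
      (T : ℝ)⁻¹ * (lamσ * ‖X‖ * lamφ) ^ 2 * ((w - w') ⬝ᵥ (w - w')) := by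
  set u : Fin p → ℝ := fun k => φ (w k) with hu
  set u' : Fin p → ℝ := fun k => φ (w' k) with hu'
  have h1 : (u - u') ⬝ᵥ (u - u') ≤ (lamφ : ℝ) ^ 2 * ((w - w') ⬝ᵥ (w - w')) := by
    simp only [dotProduct, Finset.mul_sum, ← sq]
    exact Finset.sum_le_sum fun k _ => sq_sub_le_of_lipschitzWith hφ _ _
  have h2 := vecMul_dot_self_le X (u - u')
  have hT : ((Real.sqrt T)⁻¹) ^ 2 = (T : ℝ)⁻¹ := by rw [inv_pow, Real.sq_sqrt (Nat.cast_nonneg T)]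
  have h3 : (featureRow σ φ X w - featureRow σ φ X w') ⬝ᵥ
      (featureRow σ φ X w - featureRow σ φ X w') ≤
      (T : ℝ)⁻¹ * ((lamσ : ℝ) ^ 2 * (((u - u') ᵥ* X) ⬝ᵥ ((u - u') ᵥ* X))) := by
    simp only [dotProduct, Finset.mul_sum, ← sq]
    refine Finset.sum_le_sum fun j _ => ?_
    simp only [Pi.sub_apply, featureRow, ← hu, ← hu', Matrix.sub_vecMul]
    rw [← mul_sub, mul_pow, hT]
    exact mul_le_mul_of_nonneg_left (sq_sub_le_of_lipschitzWith hσ _ _) (by positivity)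
  calc _ ≤ _ := h3
    _ ≤ (T : ℝ)⁻¹ * ((lamσ : ℝ) ^ 2 * (‖X‖ ^ 2 * ((lamφ : ℝ) ^ 2 * ((w - w') ⬝ᵥ (w - w'))))) := by
        gcongr
        exact h2.trans (by gcongr)
    _ = _ := by ring

theorem featureRow_zero_dot_self_le {lamσ : ℝ≥0} (hσ : LipschitzWith lamσ σ) :
    featureRow σ φ X 0 ⬝ᵥ featureRow σ φ X 0 ≤
      2 * σ 0 ^ 2 + 2 * (T : ℝ)⁻¹ * ((lamσ : ℝ) ^ 2 * (‖X‖ ^ 2 * (p * φ 0 ^ 2))) := by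
  set u : Fin p → ℝ := fun _ => φ 0 with hu
  have h1 : u ⬝ᵥ u = p * φ 0 ^ 2 := by simp [dotProduct, hu, sq]
  have h2 := vecMul_dot_self_le X u
  have hT : ((Real.sqrt T)⁻¹) ^ 2 = (T : ℝ)⁻¹ := by rw [inv_pow, Real.sq_sqrt (Nat.cast_nonneg T)]
  have h3 : featureRow σ φ X 0 ⬝ᵥ featureRow σ φ X 0 ≤
      (T : ℝ)⁻¹ * ∑ j, (2 * σ 0 ^ 2 + 2 * (lamσ : ℝ) ^ 2 * ((u ᵥ* X) j * (u ᵥ* X) j)) := by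
    simp only [dotProduct, Finset.mul_sum, ← sq]
    refine Finset.sum_le_sum fun j _ => ?_
    simp only [featureRow, Pi.zero_apply, ← hu]
    rw [mul_pow, hT]
    refine mul_le_mul_of_nonneg_left ?_ (by positivity)
    have := sq_sub_le_of_lipschitzWith hσ ((u ᵥ* X) j) 0
    rw [sub_zero] at this
    nlinarith [sq_nonneg (σ ((u ᵥ* X) j) - 2 * σ 0)]
  rw [Finset.sum_add_distrib, Finset.sum_const, ← Finset.mul_sum, Finset.card_univ,
    Fintype.card_fin, nsmul_eq_mul] at h3
  have h4 : ∑ j, (u ᵥ* X) j * (u ᵥ* X) j ≤ ‖X‖ ^ 2 * (p * φ 0 ^ 2) := by rw [← h1]; exact h2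
  refine h3.trans ?_
  rw [mul_add]
  refine add_le_add ?_ ?_
  · rw [← mul_assoc]
    exact mul_le_of_le_one_left (by positivity) (inv_mul_le_one_of_le₀ le_rfl (Nat.cast_nonneg T))
  · calc _ ≤ (T : ℝ)⁻¹ * (2 * (lamσ : ℝ) ^ 2 * (‖X‖ ^ 2 * (p * φ 0 ^ 2))) := by gcongr
      _ = _ := by ring

end FeatureRow

/-! ### The matrices of the random features model -/

section Model

variable {σ φ : ℝ → ℝ} {n p T : ℕ} {X : Matrix (Fin p) (Fin T) ℝ}

theorem gram_featureRow (W : Fin n → Fin p → ℝ) :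
    gram (fun i => featureRow σ φ X (W i)) =
      (1 / (T : ℝ)) • ((featureMatrix σ φ X W)ᵀ * featureMatrix σ φ X W) := by
  ext j l
  have hT : ((Real.sqrt T)⁻¹) * ((Real.sqrt T)⁻¹) = 1 / (T : ℝ) := by
    rw [← mul_inv, Real.mul_self_sqrt (Nat.cast_nonneg T), one_div]
  simp only [gram, Matrix.sum_apply, Matrix.vecMulVec_apply, featureRow, Matrix.smul_apply,
    Matrix.mul_apply, Matrix.transpose_apply, smul_eq_mul, Finset.mul_sum, ← hT]
  refine Finset.sum_congr rfl fun i _ => ?_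
  have e : ∀ j, featureMatrix σ φ X W i j = σ (((fun k => φ (W i k)) ᵥ* X) j) := fun j => rfl
  rw [e, e]
  ring

theorem resolvent_eq (γ : ℝ) (W : Fin n → Fin p → ℝ) :
    resolvent σ φ γ X W = regInv γ (gram fun i => featureRow σ φ X (W i)) := by
  rw [gram_featureRow]; rfl

theorem measurable_featureRow {lamσ lamφ : ℝ≥0} (hσ : LipschitzWith lamσ σ)
    (hφ : LipschitzWith lamφ φ) : Measurable (featureRow σ φ X) := by
  refine measurable_pi_lambda _ fun j => (hσ.continuous.measurable.comp ?_).const_mul _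
  simp only [Matrix.vecMul, dotProduct]
  exact Finset.measurable_sum _ fun k _ =>
    (hφ.continuous.measurable.comp (measurable_pi_apply k)).mul_const _

/-- The second moment matrix of a row is `Φ / T`. -/
theorem secondMoment_featureRow {lamσ lamφ : ℝ≥0} (hσ : LipschitzWith lamσ σ)
    (hφ : LipschitzWith lamφ φ) :
    secondMoment ((gaussianVec p).map (featureRow σ φ X)) = (1 / (T : ℝ)) • Phi σ φ X := by
  have hT : ((Real.sqrt T)⁻¹) * ((Real.sqrt T)⁻¹) = 1 / (T : ℝ) := by
    rw [← mul_inv, Real.mul_self_sqrt (Nat.cast_nonneg T), one_div]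
  ext j l
  simp only [secondMoment, Matrix.of_apply, Matrix.smul_apply, Phi, smul_eq_mul]
  rw [integral_map (measurable_featureRow hσ hφ).aemeasurable (by fun_prop),
    ← integral_const_mul, ← hT]
  refine integral_congr_ae (Eventually.of_forall fun w => ?_)
  simp only [featureRow]
  ring

theorem expectQAQ_eq {lamσ lamφ : ℝ≥0} (hσ : LipschitzWith lamσ σ)
    (hφ : LipschitzWith lamφ φ) (γ : ℝ) (A : Matrix (Fin T) (Fin T) ℝ) :
    expectQAQ σ φ γ n X A =
      matIntegral (Measure.pi fun _ : Fin n => (gaussianVec p).map (featureRow σ φ X))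
        (fun z => regInv γ (gram z) * A * regInv γ (gram z)) := by
  have hm := measurable_featureRow (X := X) hσ hφ
  have hprob : IsProbabilityMeasure (gaussianVec p) := inferInstanceAs
    (IsProbabilityMeasure (stdPi (Fin p)))
  have hprob' := Measure.isProbabilityMeasure_map (μ := gaussianVec p) hm.aemeasurable
  have h1 := Measure.pi_map_pi (μ := fun _ : Fin n => gaussianVec p)
    (f := fun _ => featureRow σ φ X) fun _ => hm.aemeasurable
  have h3 : Measurable fun (W : Fin n → Fin p → ℝ) i => featureRow σ φ X (W i) :=
    measurable_pi_lambda _ fun i => hm.comp (measurable_pi_apply i)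
  have hQ := matMeasurable_regInv_gram (τ := Fin T) γ n
  ext j l
  simp only [expectQAQ, matIntegral, Matrix.of_apply, resolvent_eq]
  rw [← h1, integral_map h3.aemeasurable
    (((hQ.mul (MatMeasurable.const A)).mul hQ) j l).aestronglyMeasurable]
  rfl

/-- The normalised second moment matrix `Φ / T` is positive semidefinite. -/
theorem smul_Phi_posSemidef {lamσ lamφ : ℝ≥0} (hσ : LipschitzWith lamσ σ)
    (hφ : LipschitzWith lamφ φ) : ((1 / (T : ℝ)) • Phi σ φ X).PosSemidef := by
  let R : GaussianRows Unit :=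
    { N := fun _ => 1
      p := fun _ => p
      T := fun _ => T
      Y := fun _ => featureRow σ φ X
      one_le := fun _ => le_rfl
      Λ := Real.sqrt ((T : ℝ)⁻¹ * (lamσ * ‖X‖ * lamφ) ^ 2)
      Λ_nonneg := Real.sqrt_nonneg _
      lip := fun _ w w' => by
        rw [Real.sq_sqrt (by positivity), Nat.cast_one, one_mul]
        exact featureRow_sub_dot_self_le hσ hφ w w'
      S := 2 * σ 0 ^ 2 + 2 * (T : ℝ)⁻¹ * ((lamσ : ℝ) ^ 2 * (‖X‖ ^ 2 * (p * φ 0 ^ 2)))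
      zero_le := fun _ => featureRow_zero_dot_self_le hσ
      ρ := p
      dim_le := fun _ => by simp }
  rw [← secondMoment_featureRow hσ hφ]
  exact secondMoment_posSemidef (R.integrable_sq ()).1

theorem Psi_eq (Φ : Matrix (Fin T) (Fin T) ℝ) (δ : ℝ) :
    Psi n Φ δ = ((n : ℝ) / (1 + δ)) • ((1 / (T : ℝ)) • Φ) := by
  rw [Psi, smul_smul]
  congr 1
  ring

theorem Qbar_eq (γ : ℝ) (Φ : Matrix (Fin T) (Fin T) ℝ) (δ : ℝ) :
    Qbar n γ Φ δ = detRes γ n ((1 / (T : ℝ)) • Φ) δ := by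
  rw [Qbar, Psi_eq]; rfl

theorem isDelta_iff {γ : ℝ} {Φ : Matrix (Fin T) (Fin T) ℝ} {δ : ℝ} :
    IsDelta n γ Φ δ ↔ 0 ≤ δ ∧
      δ = (((1 / (T : ℝ)) • Φ) * detRes γ n ((1 / (T : ℝ)) • Φ) δ).trace := by
  rw [IsDelta, Qbar_eq, Matrix.smul_mul, Matrix.trace_smul, smul_eq_mul]

/-- The equation for `δ` has exactly one nonnegative solution. -/
theorem exists_unique_isDelta {γ : ℝ} (hγ : 0 < γ) {Φ : Matrix (Fin T) (Fin T) ℝ}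
    (hΦ : ((1 / (T : ℝ)) • Φ).PosSemidef) :
    ∃ δ : ℝ, IsDelta n γ Φ δ ∧ ∀ d, IsDelta n γ Φ d → d = δ := by
  obtain ⟨δ, h0, h1⟩ := exists_fixedPoint hγ (Nat.cast_nonneg n) hΦ
  refine ⟨δ, isDelta_iff.2 ⟨h0, h1⟩, fun d hd => ?_⟩
  obtain ⟨h2, h3⟩ := isDelta_iff.1 hd
  exact fixedPoint_unique hγ (Nat.cast_nonneg n) hΦ h2 h0 h3 h1

theorem regInv_comm {τ : Type*} [Fintype τ] [DecidableEq τ] {γ : ℝ} (hγ : 0 < γ) {S : Matrix τ τ ℝ}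
    (hS : S.PosSemidef) : S * regInv γ S = regInv γ S * S := by
  have h1 := mul_regInv hγ hS
  have h2 := regInv_mul hγ hS
  rw [add_mul, Matrix.smul_mul, one_mul] at h1
  rw [mul_add, Matrix.mul_smul, mul_one] at h2
  exact add_right_cancel (h1.trans h2.symm)

variable {γ δ : ℝ} {Φ : Matrix (Fin T) (Fin T) ℝ}

theorem Psi_mul_Qbar (hγ : 0 < γ) (hΦ : ((1 / (T : ℝ)) • Φ).PosSemidef) (hδ : 0 ≤ δ) :
    Psi n Φ δ * Qbar n γ Φ δ = Qbar n γ Φ δ * Psi n Φ δ := by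
  have h : (Psi n Φ δ).PosSemidef := by
    rw [Psi_eq]
    exact hΦ.smul (by positivity)
  exact regInv_comm hγ h

/-- As `Ψ` and `Q̄` commute, the trace in the denominator is the trace of `F` against `Q̄ Ψ Q̄`. -/
theorem trace_Psi_sq (hγ : 0 < γ) (hn : 1 ≤ n) (hΦ : ((1 / (T : ℝ)) • Φ).PosSemidef)
    (hδ : 0 ≤ δ) :
    1 / (n : ℝ) * (Psi n Φ δ ^ 2 * Qbar n γ Φ δ ^ 2).trace =
      (1 + δ)⁻¹ * (((1 / (T : ℝ)) • Φ) * (Qbar n γ Φ δ * Psi n Φ δ * Qbar n γ Φ δ)).trace := by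
  have hn0 : (n : ℝ) ≠ 0 := by positivity
  have hc := Psi_mul_Qbar (n := n) hγ hΦ hδ
  have e : Psi n Φ δ ^ 2 * Qbar n γ Φ δ ^ 2 =
      Psi n Φ δ * (Qbar n γ Φ δ * Psi n Φ δ * Qbar n γ Φ δ) := by
    rw [sq, sq, ← hc]
    simp only [mul_assoc]
  rw [e]
  generalize Qbar n γ Φ δ * Psi n Φ δ * Qbar n γ Φ δ = B
  rw [Psi_eq, Matrix.smul_mul, Matrix.trace_smul, smul_eq_mul]
  field_simp

theorem trace_Psi_sandwich (hn : 1 ≤ n) (A R : Matrix (Fin T) (Fin T) ℝ) :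
    1 / (n : ℝ) * (Psi n Φ δ * R * A * R).trace =
      (1 + δ)⁻¹ * (((1 / (T : ℝ)) • Φ) * (R * A * R)).trace := by
  have hn0 : (n : ℝ) ≠ 0 := by positivity
  have e : Psi n Φ δ * R * A * R = Psi n Φ δ * (R * A * R) := by simp only [mul_assoc]
  rw [e, Psi_eq, Matrix.smul_mul, Matrix.trace_smul, smul_eq_mul]
  field_simp

/-- The denominator of the deterministic equivalent is positive. -/
theorem one_sub_trace_pos (hγ : 0 < γ) (hn : 1 ≤ n) (hΦ : ((1 / (T : ℝ)) • Φ).PosSemidef)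
    (hδ : IsDelta n γ Φ δ) :
    0 < 1 - 1 / (n : ℝ) * (Psi n Φ δ ^ 2 * Qbar n γ Φ δ ^ 2).trace := by
  obtain ⟨h0, h1⟩ := isDelta_iff.1 hδ
  rw [trace_Psi_sq hγ hn hΦ h0]
  have h2 := trace_sandwich_le hγ (Nat.cast_nonneg n) hΦ h0 h1
  rw [← Qbar_eq, ← Psi_eq] at h2
  rw [sub_pos, inv_mul_lt_iff₀ (by linarith)]
  linarith

end Model

end RandomFeatures

namespace RandomFeatures

/-! ### The deterministic equivalent for random features -/

section Spike

variable {τ : Type*} [Fintype τ] {n : ℕ} {m : τ → ℝ}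

theorem SpikeBdd.smul_of_le {K s t : ℝ} {B : Matrix τ τ ℝ} (hB : SpikeBdd K n m B)
    (ht : 0 ≤ t) (hts : t ≤ s) : SpikeBdd (s * K) n m (t • B) := by
  refine ⟨hB.psd.smul ht, fun x => ?_⟩
  have hx := dot_self_nonneg x
  rw [Matrix.smul_mulVec, dotProduct_smul, smul_eq_mul, mul_assoc]
  exact mul_le_mul hts (hB.le x) (PSD.nonneg hB.psd x) (ht.trans hts)

variable [DecidableEq τ]

theorem spikeBdd_of_opNorm_le {L : ℝ} {B : Matrix τ τ ℝ} (hB : B.PosSemidef) (hL : ‖B‖ ≤ L) :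
    SpikeBdd |L| n m B := by
  refine ⟨hB, fun x => ?_⟩
  have hx := dot_self_nonneg x
  have h0 : (B *ᵥ x) ⬝ᵥ (B *ᵥ x) ≤ L ^ 2 * (x ⬝ᵥ x) := (mulVec_dot_self_le _ x).trans
    (mul_le_mul_of_nonneg_right (pow_le_pow_left₀ (norm_nonneg _) hL 2) hx)
  have h1 : x ⬝ᵥ B *ᵥ x ≤ |L| * (x ⬝ᵥ x) := by
    refine (le_abs_self _).trans (abs_le_of_sq_le_sq ((dot_sq_le _ _).trans ?_) (by positivity))
    rw [mul_pow, sq_abs]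
    nlinarith
  refine h1.trans (mul_le_mul_of_nonneg_left ?_ (abs_nonneg L))
  exact le_add_of_nonneg_right (by positivity)

/-- `F Q̄` is a multiple of `Ψ Q̄`, which is a contraction. -/
theorem smul_mulVec_detRes_norm_le {γ r d : ℝ} (hγ : 0 < γ) (hr : 0 < r) {F : Matrix τ τ ℝ}
    (hF : F.PosSemidef) (hd : 0 ≤ d) (s : ℝ) (x : τ → ℝ) :
    ((s • F) *ᵥ (detRes γ r F d *ᵥ x)) ⬝ᵥ ((s • F) *ᵥ (detRes γ r F d *ᵥ x)) ≤
      (s * ((1 + d) / r)) ^ 2 * (x ⬝ᵥ x) := by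
  have hΨ : ((r / (1 + d)) • F).PosSemidef := hF.smul (by positivity)
  have e : s • F = (s * ((1 + d) / r)) • ((r / (1 + d)) • F) := by
    rw [smul_smul]
    congr 1
    field_simp
  rw [detRes, e, Matrix.smul_mulVec, smul_dotProduct, dotProduct_smul, smul_eq_mul,
    smul_eq_mul, ← mul_assoc, ← sq]
  exact mul_le_mul_of_nonneg_left (mulVec_regInv_norm_le hγ hΨ x) (sq_nonneg _)

end Spike

section Sequence

variable {σ φ : ℝ → ℝ} {lamσ lamφ : ℝ≥0} {p T : ℕ → ℕ}
  {X : (n : ℕ) → Matrix (Fin (p n)) (Fin (T n)) ℝ} {c C K : ℝ} {n₀ : ℕ}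

/-- The rows of the feature matrices with `N + 1` rows, for all `N` such that the dimensions are
comparable to `N` and `X` is bounded. -/
noncomputable def featureRows (hσ : LipschitzWith lamσ σ) (hφ : LipschitzWith lamφ φ) (hc : 0 < c)
    (h : ∀ n, n₀ ≤ n → c * n ≤ T n ∧ (T n : ℝ) ≤ C * n ∧ (p n : ℝ) ≤ C * n ∧ ‖X n‖ ≤ K) :
    GaussianRows {N : ℕ // 1 ≤ N ∧ n₀ ≤ N + 1} where
  N i := i.1
  p i := p (i.1 + 1)
  T i := T (i.1 + 1)
  Y i := featureRow σ φ (X (i.1 + 1))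
  one_le i := i.2.1
  Λ := Real.sqrt (c⁻¹ * (lamσ * K * lamφ) ^ 2)
  Λ_nonneg := Real.sqrt_nonneg _
  lip := fun i w w' => by
    obtain ⟨h1, -, -, h4⟩ := h (i.1 + 1) i.2.2
    push_cast at h1
    have hT : (0 : ℝ) < T (i.1 + 1) := lt_of_lt_of_le (by positivity) h1
    have h5 : (i.1 : ℝ) * (T (i.1 + 1) : ℝ)⁻¹ ≤ c⁻¹ := by
      rw [← div_eq_mul_inv, div_le_iff₀ hT, inv_mul_eq_div, le_div_iff₀ hc]
      nlinarith
    have hw := dot_self_nonneg (w - w')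
    rw [Real.sq_sqrt (by positivity)]
    calc _ ≤ (i.1 : ℝ) * ((T (i.1 + 1) : ℝ)⁻¹ * (lamσ * ‖X (i.1 + 1)‖ * lamφ) ^ 2 *
          ((w - w') ⬝ᵥ (w - w'))) :=
          mul_le_mul_of_nonneg_left (featureRow_sub_dot_self_le hσ hφ w w') (Nat.cast_nonneg _)
      _ = (i.1 : ℝ) * (T (i.1 + 1) : ℝ)⁻¹ * (lamσ * ‖X (i.1 + 1)‖ * lamφ) ^ 2 *
          ((w - w') ⬝ᵥ (w - w')) := by ring
      _ ≤ _ := by gcongr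
  S := 2 * σ 0 ^ 2 + 2 * ((lamσ : ℝ) ^ 2 * (K ^ 2 * (C / c * φ 0 ^ 2)))
  zero_le := fun i => by
    obtain ⟨h1, -, h3, h4⟩ := h (i.1 + 1) i.2.2
    push_cast at h1 h3
    have hT : (0 : ℝ) < T (i.1 + 1) := lt_of_lt_of_le (by positivity) h1
    have h5 : (T (i.1 + 1) : ℝ)⁻¹ * p (i.1 + 1) ≤ C / c := by
      rw [inv_mul_eq_div, div_le_div_iff₀ hT hc]
      nlinarith
    refine (featureRow_zero_dot_self_le hσ).trans ?_
    calc _ = 2 * σ 0 ^ 2 + 2 * ((lamσ : ℝ) ^ 2 * (‖X (i.1 + 1)‖ ^ 2 *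
          ((T (i.1 + 1) : ℝ)⁻¹ * p (i.1 + 1) * φ 0 ^ 2))) := by ring
      _ ≤ _ := by gcongr
  ρ := 2 * C
  dim_le := fun i => by
    obtain ⟨-, -, h3, -⟩ := h (i.1 + 1) i.2.2
    push_cast at h3
    have hN : (1 : ℝ) ≤ i.1 := by exact_mod_cast i.2.1
    nlinarith

/-- The estimate for large `n = N + 1`, with the rate `N ^ (-1/2)`. The matrix `Φ` is of order `n`, as
is allowed by `SpikeBdd`. -/
theorem exists_opNorm_sub_le (hσ : LipschitzWith lamσ σ) (hφ : LipschitzWith lamφ φ) {γ : ℝ}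
    (hγ : 0 < γ) (hc : 0 < c) (hC : 0 ≤ C)
    (h : ∀ n, n₀ ≤ n → c * n ≤ T n ∧ (T n : ℝ) ≤ C * n ∧ (p n : ℝ) ≤ C * n ∧ ‖X n‖ ≤ K)
    {A : (n : ℕ) → Matrix (Fin (T n)) (Fin (T n)) ℝ} (hApos : ∀ n, (A n).PosSemidef)
    (hA : (∀ n, A n = Phi σ φ (X n)) ∨ ∃ K : ℝ, ∀ n, ‖A n‖ ≤ K) {δ : ℕ → ℝ}
    (hδ : ∀ n, 1 ≤ n → IsDelta n γ (Phi σ φ (X n)) (δ n)) :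
    ∃ C', 0 ≤ C' ∧ ∀ N : ℕ, 1 ≤ N → n₀ ≤ N + 1 →
      ‖expectQAQ σ φ γ (N + 1) (X (N + 1)) (A (N + 1)) -
        equivQAQ (N + 1) γ (Phi σ φ (X (N + 1))) (δ (N + 1)) (A (N + 1))‖ ≤ C' / Real.sqrt N := by
  set M : RowModel {N : ℕ // 1 ≤ N ∧ n₀ ≤ N + 1} := (featureRows hσ hφ hc h).toRowModel with hM
  have hN : ∀ i, M.N i = i.1 := fun i => rfl
  have hF : ∀ i, M.F i = (1 / (T (i.1 + 1) : ℝ)) • Phi σ φ (X (i.1 + 1)) := fun i =>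
    secondMoment_featureRow hσ hφ
  have hd : ∀ i : {N : ℕ // 1 ≤ N ∧ n₀ ≤ N + 1}, 0 ≤ δ (i.1 + 1) ∧
      δ (i.1 + 1) = (M.F i * detRes γ (M.N i + 1) (M.F i) (δ (i.1 + 1))).trace := by
    intro i
    have h1 := isDelta_iff.1 (hδ (i.1 + 1) (by omega))
    rw [hF, hN]
    push_cast at h1
    exact h1
  obtain ⟨Ct, hCt, ht⟩ := M.exists_trace_le
  have hδ' : ∀ i : {N : ℕ // 1 ≤ N ∧ n₀ ≤ N + 1}, δ (i.1 + 1) ≤ γ⁻¹ * Ct := fun i => by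
    rw [(hd i).2]
    exact (trace_mul_detRes_le hγ (by positivity) (M.F_psd i) (hd i).1).trans
      (mul_le_mul_of_nonneg_left (ht i) (by positivity))
  -- the two hypotheses on `A` of the abstract theorem
  obtain ⟨K₁, hK₁, K₂, h₁, h₂⟩ : ∃ K₁, 0 ≤ K₁ ∧ ∃ K₂,
      (∀ i, SpikeBdd K₁ (M.N i) (M.m i) (A (i.1 + 1))) ∧
      ∀ i (x : Fin (M.T i) → ℝ), x ⬝ᵥ x ≤ 1 →
      (A (i.1 + 1) *ᵥ (detRes γ (M.N i + 1) (M.F i) (δ (i.1 + 1)) *ᵥ x)) ⬝ᵥ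
        (A (i.1 + 1) *ᵥ (detRes γ (M.N i + 1) (M.F i) (δ (i.1 + 1)) *ᵥ x)) ≤ K₂ := by
    rcases hA with hA | ⟨L, hL⟩
    · -- `Φ` is a bounded multiple of `N F`, and `Φ R` is a bounded multiple of `Ψ R`
      obtain ⟨K₀, hK₀, hs⟩ := M.exists_spikeBdd_F
      have hT : ∀ i : {N : ℕ // 1 ≤ N ∧ n₀ ≤ N + 1}, 0 < (T (i.1 + 1) : ℝ) := fun i =>
        lt_of_lt_of_le (by positivity) (h (i.1 + 1) i.2.2).1
      have hTN : ∀ i : {N : ℕ // 1 ≤ N ∧ n₀ ≤ N + 1},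
          (T (i.1 + 1) : ℝ) ≤ C * ((M.N i : ℝ) + 1) := fun i => by
        have := (h (i.1 + 1) i.2.2).2.1
        push_cast at this
        exact this
      have hAF : ∀ i : {N : ℕ // 1 ≤ N ∧ n₀ ≤ N + 1},
          A (i.1 + 1) = (T (i.1 + 1) : ℝ) • M.F i := fun i => by
        have h1 : A (i.1 + 1) =
            (T (i.1 + 1) : ℝ) • ((1 / (T (i.1 + 1) : ℝ)) • Phi σ φ (X (i.1 + 1))) := by
          rw [hA, smul_smul, mul_one_div_cancel (hT i).ne', one_smul]
        rw [hF]
        exact h1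
      refine ⟨2 * C * K₀, by positivity, (C * (1 + γ⁻¹ * Ct)) ^ 2, fun i => ?_, fun i x hx => ?_⟩
      · have hNp := M.N_pos i
        have hN1 : (1 : ℝ) ≤ M.N i := by exact_mod_cast M.one_le i
        have h5 : (T (i.1 + 1) : ℝ) / M.N i ≤ 2 * C := by
          rw [div_le_iff₀ hNp]
          nlinarith [hTN i]
        have h6 := (hs i).smul_of_le (div_nonneg (hT i).le hNp.le) h5
        rw [smul_smul, div_mul_cancel₀ _ hNp.ne'] at h6
        rw [hAF]
        exact h6
      · have hd0 := (hd i).1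
        have h5 : (T (i.1 + 1) : ℝ) * ((1 + δ (i.1 + 1)) / (M.N i + 1)) ≤ C * (1 + γ⁻¹ * Ct) := by
          rw [mul_div_left_comm, mul_comm]
          have h6 : (T (i.1 + 1) : ℝ) / (M.N i + 1) ≤ C := by
            rw [div_le_iff₀ (by positivity)]
            exact hTN i
          have := hδ' i
          gcongr
        rw [hAF]
        refine (smul_mulVec_detRes_norm_le hγ (by positivity) (M.F_psd i) hd0 _ x).trans ?_
        refine (mul_le_of_le_one_right (by positivity) hx).trans ?_
        have := (hT i).le
        gcongr
    · refine ⟨|L|, abs_nonneg L, L ^ 2 * (γ⁻¹) ^ 2,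
        fun i => spikeBdd_of_opNorm_le (hApos _) (hL _), fun i x hx => ?_⟩
      have hΨ : (((M.N i + 1 : ℝ) / (1 + δ (i.1 + 1))) • M.F i).PosSemidef :=
        (M.F_psd i).smul (by have := (hd i).1; positivity)
      refine (mulVec_dot_self_le (A (i.1 + 1)) _).trans (mul_le_mul
        (pow_le_pow_left₀ (norm_nonneg _) (hL _) 2) ?_ (dot_self_nonneg _) (sq_nonneg L))
      exact (regInv_norm_le' hγ hΨ x).trans (mul_le_of_le_one_right (by positivity) hx)
  obtain ⟨C', hC', hb⟩ := M.sandwich_equivalent hγ hK₁ h₁ (fun i => (hd i).1) (fun i => (hd i).2) h₂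
  refine ⟨C', hC', fun N h1 h2 => ?_⟩
  have hn : 1 ≤ N + 1 := by omega
  have hΦ := smul_Phi_posSemidef (X := X (N + 1)) hσ hφ
  have hb' := hb ⟨N, h1, h2⟩ (Qbar (N + 1) γ (Phi σ φ (X (N + 1))) (δ (N + 1)))
    (Psi (N + 1) (Phi σ φ (X (N + 1))) (δ (N + 1))) ((N + 1 : ℕ) : ℝ) (by push_cast; rfl)
    (by rw [Qbar_eq, hF]; rfl) (by rw [Psi_eq, hF]; rfl)
  refine opNorm_le_of_abs_dot_le (by positivity) fun a b ha hb1 => ?_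
  have h3 := hb' a b ha hb1
  rw [hF] at h3
  rw [expectQAQ_eq hσ hφ]
  simp only [equivQAQ]
  rw [trace_Psi_sq hγ hn hΦ (hd ⟨N, h1, h2⟩).1, trace_Psi_sandwich hn]
  exact h3

/-- The asymptotic hypotheses on the dimensions and on `X`, as bounds for large `n`. -/
theorem exists_dimension_bounds
    (hlow : 0 < liminf (fun n : ℕ =>
      min ((p n : ℝ≥0∞) / (n : ℝ≥0∞)) ((T n : ℝ≥0∞) / (n : ℝ≥0∞))) atTop)
    (hupp : limsup (fun n : ℕ =>
      max ((p n : ℝ≥0∞) / (n : ℝ≥0∞)) ((T n : ℝ≥0∞) / (n : ℝ≥0∞))) atTop < ∞)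
    (hX : limsup (fun n : ℕ => ENNReal.ofReal ‖X n‖) atTop < ∞) :
    ∃ c C K : ℝ, 0 < c ∧ 0 ≤ C ∧ ∃ n₀ : ℕ, ∀ n, n₀ ≤ n →
      c * n ≤ T n ∧ (T n : ℝ) ≤ C * n ∧ (p n : ℝ) ≤ C * n ∧ ‖X n‖ ≤ K := by
  obtain ⟨c, hc0, hc⟩ := exists_between hlow
  obtain ⟨C, hC, hC1⟩ := exists_between hupp
  obtain ⟨K, hK, hK1⟩ := exists_between hX
  have h := ((eventually_lt_of_lt_liminf hc).and ((eventually_lt_of_limsup_lt hC).and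
    ((eventually_lt_of_limsup_lt hK).and (eventually_ge_atTop 1))))
  obtain ⟨n₀, hn₀⟩ := eventually_atTop.1 h
  refine ⟨c.toReal, C.toReal, K.toReal, ENNReal.toReal_pos hc0.ne' (hc.trans_le le_top).ne,
    ENNReal.toReal_nonneg, n₀, fun n hn => ?_⟩
  obtain ⟨h1, h2, h3, h4⟩ := hn₀ n hn
  have hn0 : (0 : ℝ) < n := by exact_mod_cast h4
  have hd : ∀ k : ℕ, (k : ℝ≥0∞) / n ≠ ∞ := fun k =>
    ENNReal.div_ne_top (ENNReal.natCast_ne_top k) (by exact_mod_cast (by omega : n ≠ 0))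
  have e : ∀ k : ℕ, ((k : ℝ≥0∞) / n).toReal = (k : ℝ) / n := fun k => by simp
  have h5 := ENNReal.toReal_mono (hd (T n)) (h1.le.trans (min_le_right _ _))
  have h6 := ENNReal.toReal_mono hC1.ne ((le_max_right _ _).trans h2.le)
  have h7 := ENNReal.toReal_mono hC1.ne ((le_max_left _ _).trans h2.le)
  rw [e] at h5 h6 h7
  refine ⟨(le_div_iff₀ hn0).1 h5, (div_le_iff₀ hn0).1 h6, (div_le_iff₀ hn0).1 h7, ?_⟩
  exact (ENNReal.ofReal_le_iff_le_toReal hK1.ne).1 h3.le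

end Sequence

/-- A sequence that is `O((n - 1) ^ (-1/2))` for large `n` is bounded by a multiple of
`n ^ (-1/2 + ε)` for all `n ≥ 1`. -/
theorem exists_le_mul_rpow {f : ℕ → ℝ} {C : ℝ} (hC : 0 ≤ C) {n₀ : ℕ}
    (h : ∀ N : ℕ, 1 ≤ N → n₀ ≤ N + 1 → f (N + 1) ≤ C / Real.sqrt N) {ε : ℝ} (hε : 0 < ε) :
    ∃ c : ℝ, 0 < c ∧ ∀ n : ℕ, 1 ≤ n → f n ≤ c * (n : ℝ) ^ (-(1 / 2 : ℝ) + ε) := by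
  set g : ℕ → ℝ := fun n => |f n| / (n : ℝ) ^ (-(1 / 2 : ℝ) + ε) with hg
  have hg0 : ∀ n, 0 ≤ g n := fun n => by positivity
  refine ⟨1 + 2 * C + ∑ n ∈ Finset.range (n₀ + 2), g n,
    by have := Finset.sum_nonneg fun n (_ : n ∈ Finset.range (n₀ + 2)) => hg0 n; positivity,
    fun n hn => ?_⟩
  have hS := Finset.sum_nonneg fun n (_ : n ∈ Finset.range (n₀ + 2)) => hg0 n
  have hn0 : (0 : ℝ) < n := by exact_mod_cast hn
  have hp : 0 < (n : ℝ) ^ (-(1 / 2 : ℝ) + ε) := Real.rpow_pos_of_pos hn0 _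
  rcases lt_or_ge n (n₀ + 2) with h1 | h1
  · have h2 : g n ≤ ∑ n ∈ Finset.range (n₀ + 2), g n :=
      Finset.single_le_sum (fun n _ => hg0 n) (Finset.mem_range.2 h1)
    have h3 : |f n| = g n * (n : ℝ) ^ (-(1 / 2 : ℝ) + ε) := by
      rw [hg]
      simp only
      rw [div_mul_cancel₀ _ hp.ne']
    refine (le_abs_self _).trans ?_
    rw [h3]
    gcongr
    linarith
  · obtain ⟨N, rfl⟩ : ∃ N, n = N + 1 := ⟨n - 1, by omega⟩
    have hN : (1 : ℝ) ≤ N := by exact_mod_cast (by omega : 1 ≤ N)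
    have hs := Real.sqrt_pos.2 (lt_of_lt_of_le one_pos hN)
    have hs' := Real.sqrt_pos.2 hn0
    have h2 : ((N + 1 : ℕ) : ℝ) ^ (-(1 / 2 : ℝ)) ≤ ((N + 1 : ℕ) : ℝ) ^ (-(1 / 2 : ℝ) + ε) :=
      Real.rpow_le_rpow_of_exponent_le (by push_cast; linarith) (by linarith)
    rw [Real.rpow_neg hn0.le, ← Real.sqrt_eq_rpow] at h2
    have h3 : Real.sqrt ((N + 1 : ℕ) : ℝ) ≤ 2 * Real.sqrt N := by
      rw [Real.sqrt_le_left (by positivity), mul_pow, Real.sq_sqrt (by linarith)]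
      push_cast
      linarith
    calc f (N + 1) ≤ C / Real.sqrt N := h N (by omega) (by omega)
      _ ≤ 2 * C * (Real.sqrt ((N + 1 : ℕ) : ℝ))⁻¹ := by
        rw [← div_eq_mul_inv, div_le_div_iff₀ hs hs']
        nlinarith
      _ ≤ _ := by
        gcongr
        linarith

end RandomFeatures

theorem proposition1
    (σ φ : ℝ → ℝ) (lamσ lamφ : ℝ≥0)
    (hφ : LipschitzWith lamφ φ) (hσ : LipschitzWith lamσ σ)
    (γ : ℝ) (hγ : 0 < γ)
    (p T : ℕ → ℕ)
    (hlow : 0 < liminf (fun n : ℕ =>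
      min ((p n : ℝ≥0∞) / (n : ℝ≥0∞)) ((T n : ℝ≥0∞) / (n : ℝ≥0∞))) atTop)
    (hupp : limsup (fun n : ℕ =>
      max ((p n : ℝ≥0∞) / (n : ℝ≥0∞)) ((T n : ℝ≥0∞) / (n : ℝ≥0∞))) atTop < ∞)
    (X : (n : ℕ) → Matrix (Fin (p n)) (Fin (T n)) ℝ)
    (hX : limsup (fun n : ℕ => ENNReal.ofReal ‖X n‖) atTop < ∞)
    (A : (n : ℕ) → Matrix (Fin (T n)) (Fin (T n)) ℝ)
    (hApos : ∀ n, (A n).PosSemidef)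
    (hA : (∀ n, A n = RandomFeatures.Phi σ φ (X n)) ∨ ∃ K : ℝ, ∀ n, ‖A n‖ ≤ K) :
    ∃ δ : ℕ → ℝ,
      -- `δ n` is the unique nonnegative solution of `δ = (1/T) tr (Φ Q̄)`
      (∀ n : ℕ, 1 ≤ n → RandomFeatures.IsDelta n γ (RandomFeatures.Phi σ φ (X n)) (δ n) ∧
        ∀ d : ℝ, RandomFeatures.IsDelta n γ (RandomFeatures.Phi σ φ (X n)) d → d = δ n) ∧
      -- the denominator is positive
      (∀ n : ℕ, 1 ≤ n →
        0 < 1 - 1 / (n : ℝ) *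
          (RandomFeatures.Psi n (RandomFeatures.Phi σ φ (X n)) (δ n) ^ 2 *
            RandomFeatures.Qbar n γ (RandomFeatures.Phi σ φ (X n)) (δ n) ^ 2).trace) ∧
      -- the estimate
      ∀ ε : ℝ, 0 < ε → ∃ c : ℝ, 0 < c ∧ ∀ n : ℕ, 1 ≤ n →
        ‖RandomFeatures.expectQAQ σ φ γ n (X n) (A n) -
            RandomFeatures.equivQAQ n γ (RandomFeatures.Phi σ φ (X n)) (δ n) (A n)‖ ≤
          c * (n : ℝ) ^ (-(1 / 2 : ℝ) + ε) := by
  have hΦ : ∀ n, ((1 / (T n : ℝ)) • RandomFeatures.Phi σ φ (X n)).PosSemidef := fun n =>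
    RandomFeatures.smul_Phi_posSemidef hσ hφ
  choose δ hδ hδ' using fun n =>
    RandomFeatures.exists_unique_isDelta (n := n) hγ (hΦ n)
  obtain ⟨c, C, K, hc, hC, n₀, h⟩ := RandomFeatures.exists_dimension_bounds hlow hupp hX
  obtain ⟨C', hC', hb⟩ := RandomFeatures.exists_opNorm_sub_le hσ hφ hγ hc hC h hApos hA
    fun n _ => hδ n
  exact ⟨δ, fun n _ => ⟨hδ n, hδ' n⟩,
    fun n hn => RandomFeatures.one_sub_trace_pos hγ hn (hΦ n) (hδ n),
    fun ε hε => RandomFeatures.exists_le_mul_rpow hC' hb hε⟩
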